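/- Let $\mathfrak g=\mathfrak{sl}_2$ over $\mathbb C$ with standard basis $e,h,f$, and let $\mathfrak T=\mathfrak g\otimes\mathbb C[x]/(x^2)=\mathfrak g\ltimes\bar{\mathfrak g}$ be the Takiff $\mathfrak{sl}_2$, where $\bar v=v\otimes x$ and $\bar{\mathfrak g}=\mathfrak g\otimes x$ is an abelian ideal. Put $U=U(\mathfrak T)$ and $\bar C=\bar h^2+4\bar f\bar e\in U$, the generator of the purely Takiff part of the center of $U$. A $\mathfrak T$-module is a *$\mathfrak g$-Harish-Chandra module* if its restriction to $\mathfrak g$ is a direct sum of simple finite-dimensional $\mathfrak g$-modules, each isomorphism class occurring with finite multiplicity. For $n\in\mathbb Z_{\ge0}$ let $L(n)$ be the simple quotient of the Verma module of $\mathfrak g$ with highest weight $n$; the $L(n)$ are, up to isomorphism, exactly the finite-dimensional simple $\mathfrak g$-modules. They are also regarded as $\mathfrak T$-modules with the trivial action of $\bar{\mathfrak g}$. The minimal $\mathfrak g$-type of a $\mathfrak T$-module $V$ is the $L(n)$ with the smallest $n\in\mathbb Z_{\ge 0}$ such that $L(n)$ is isomorphic to a $\mathfrak g$-submodule of $V$.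 For $\lambda_1,\lambda_2\in\mathbb C$ let $\Delta(\lambda_1,\lambda_2)=U\otimes_{U(\tilde{\mathfrak b})}\mathbb C_{\lambda}$ be the Verma module, where $\tilde{\mathfrak b}=\langle h,\bar h,e,\bar e\rangle$ acts on $\mathbb C_\lambda=\mathbb C$ by $h\mapsto\lambda_1$, $\bar h\mapsto\lambda_2$, $e,\bar e\mapsto0$. Let $U_{(f)}$ be the localization of $U$ at the powers of $f$, let $S_f=U_{(f)}/U$ (a $U$-$U$-bimodule), and for a $\mathfrak T$-module $M$ let $\mathbf{EA}(M)$ be the submodule of all $m\in S_f\otimes_U M$ with $\dim\mathbb C[e]m<\infty$. For $n\in\mathbb Z$ and $\lambda_2\in\mathbb C\setminus\{0\}$ put $V(n,\lambda_2)=\mathbf{EA}(\Delta(n-2,\lambda_2))$. **Theorem.** Let $V$ be a simple $\mathfrak g$-Harish-Chandra module for $\mathfrak T$. Then $\bar C$ acts on $V$ by a unique scalar $\chi\in\mathbb C$, and $V$ has a unique minimal $\mathfrak g$-type $L(n)$, $n\in\mathbb Z_{\ge 0}$. - If $\chi\ne0$, then $V\cong V(n,\lambda_2)$ for some $\lambda_2\in\mathbb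 C$ with $\lambda_2^2=\chi$. - If $\chi=0$, then $V\cong L(n)$ with the trivial action of $\bar{\mathfrak g}$. Conversely, for all $n\in\mathbb Z$ and $\lambda_2\in\mathbb C\setminus\{0\}$ the module $V(n,\lambda_2)$ is a simple $\mathfrak g$-Harish-Chandra module with minimal $\mathfrak g$-type $L(|n|)$, on which $\bar C$ acts by $\lambda_2^2$; and for all $n\in\mathbb Z_{\ge0}$ the module $L(n)$ with trivial action of $\bar{\mathfrak g}$ is a simple $\mathfrak g$-Harish-Chandra module with minimal $\mathfrak g$-type $L(n)$, on which $\bar C$ acts by $0$. Hence these modules form a complete list of the simple $\mathfrak g$-Harish-Chandra modules for $\mathfrak T$. The only isomorphisms between different members of the list are $V(n,\lambda_2)\cong V(-n,-\lambda_2)$: one has $V(n,\lambda_2)\cong V(n',\lambda_2')$ if and only if $(n',\lambda_2')=\pm(n,\lambda_2)$; $L(n)\cong L(m)$ only if $n=m$; and no $V(n,\lambda_2)$ is isomorphic to any $L(m)$. -/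

import Mathlib

open scoped TensorProduct

universe u

namespace TakiffHC

section Tensor

attribute [local instance 100] LieRing.ofAssociativeRing

/-! ### Modules pulled back along homomorphisms, tensor products over enveloping algebras -/

/-- The `L`-module `M` regarded as an `L'`-module through a Lie algebra homomorphism
`φ : L' → L` (restriction to a subalgebra, inflation from a quotient). -/
@[nolint unusedArguments]
def Pullback {L' L : Type*} [LieRing L'] [LieAlgebra ℂ L'] [LieRing L] [LieAlgebra ℂ L]
    (_φ : L' →ₗ⁅ℂ⁆ L) (M : Type*) : Type _ := M

variable {L' L : Type*} [LieRing L'] [LieAlgebra ℂ L'] [LieRing L] [LieAlgebra ℂ L]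

instance (φ : L' →ₗ⁅ℂ⁆ L) (M : Type*) [AddCommGroup M] : AddCommGroup (Pullback φ M) :=
  inferInstanceAs (AddCommGroup M)

instance (φ : L' →ₗ⁅ℂ⁆ L) (M : Type*) [AddCommGroup M] [Module ℂ M] : Module ℂ (Pullback φ M) :=
  inferInstanceAs (Module ℂ M)

instance (φ : L' →ₗ⁅ℂ⁆ L) (M : Type*) [AddCommGroup M] [LieRingModule L M] :
    LieRingModule L' (Pullback φ M) :=
  LieRingModule.compLieHom M φ

instance (φ : L' →ₗ⁅ℂ⁆ L) (M : Type*) [AddCommGroup M] [Module ℂ M] [LieRingModule L M]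
    [LieModule ℂ L M] : LieModule ℂ L' (Pullback φ M) :=
  LieModule.compLieHom M φ

/-- The action of the enveloping algebra on a Lie module. -/
noncomputable def envAction (L : Type*) [LieRing L] [LieAlgebra ℂ L] (M : Type*) [AddCommGroup M]
    [Module ℂ M] [LieRingModule L M] [LieModule ℂ L M] :
    UniversalEnvelopingAlgebra ℂ L →ₐ[ℂ] Module.End ℂ M :=
  UniversalEnvelopingAlgebra.lift ℂ (LieModule.toEnd ℂ L M)

variable {A : Type*} [Ring A] [Algebra ℂ A]
  {S : Type*} [AddCommGroup S] [Module ℂ S] [Module (UniversalEnvelopingAlgebra ℂ L) S]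
  [IsScalarTower ℂ (UniversalEnvelopingAlgebra ℂ L) S]
  {M : Type*} [AddCommGroup M] [Module ℂ M]

/-- The relations `s a ⊗ m = s ⊗ a m`. Here `S` is a `U(L)`-`A`-bimodule, the right action of `A`
being `ρ`, and `M` is a left `A`-module, the action being `σ`. -/
def balancedRel (ρ : Aᵐᵒᵖ →+* Module.End (UniversalEnvelopingAlgebra ℂ L) S)
    (σ : A →ₐ[ℂ] Module.End ℂ M) :
    Submodule (UniversalEnvelopingAlgebra ℂ L) (S ⊗[ℂ] M) :=
  Submodule.span _ {t | ∃ (s : S) (a : A) (m : M),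
    t = (ρ (MulOpposite.op a) s) ⊗ₜ[ℂ] m - s ⊗ₜ[ℂ] (σ a m)}

/-- The tensor product `S ⊗_A M` over the (noncommutative) algebra `A`, a left `U(L)`-module. -/
def BalancedTensor (ρ : Aᵐᵒᵖ →+* Module.End (UniversalEnvelopingAlgebra ℂ L) S)
    (σ : A →ₐ[ℂ] Module.End ℂ M) : Type _ :=
  (S ⊗[ℂ] M) ⧸ balancedRel ρ σ

variable (ρ : Aᵐᵒᵖ →+* Module.End (UniversalEnvelopingAlgebra ℂ L) S)
  (σ : A →ₐ[ℂ] Module.End ℂ M)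

noncomputable instance : AddCommGroup (BalancedTensor ρ σ) :=
  inferInstanceAs (AddCommGroup ((S ⊗[ℂ] M) ⧸ balancedRel ρ σ))

noncomputable instance : Module (UniversalEnvelopingAlgebra ℂ L) (BalancedTensor ρ σ) :=
  inferInstanceAs (Module (UniversalEnvelopingAlgebra ℂ L) ((S ⊗[ℂ] M) ⧸ balancedRel ρ σ))

noncomputable instance : Module ℂ (BalancedTensor ρ σ) :=
  inferInstanceAs (Module ℂ ((S ⊗[ℂ] M) ⧸ balancedRel ρ σ))

instance : IsScalarTower ℂ (UniversalEnvelopingAlgebra ℂ L) (BalancedTensor ρ σ) :=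
  inferInstanceAs
    (IsScalarTower ℂ (UniversalEnvelopingAlgebra ℂ L) ((S ⊗[ℂ] M) ⧸ balancedRel ρ σ))

noncomputable instance : LieRingModule L (BalancedTensor ρ σ) where
  bracket x t := UniversalEnvelopingAlgebra.ι ℂ x • t
  add_lie x y t := by
    change UniversalEnvelopingAlgebra.ι ℂ (x + y) • t = _
    rw [map_add, add_smul]
  lie_add x t t' := smul_add _ _ _
  leibniz_lie x y t := by
    change UniversalEnvelopingAlgebra.ι ℂ x • UniversalEnvelopingAlgebra.ι ℂ y • t =
      UniversalEnvelopingAlgebra.ι ℂ ⁅x, y⁆ • t +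
      UniversalEnvelopingAlgebra.ι ℂ y • UniversalEnvelopingAlgebra.ι ℂ x • t
    rw [LieHom.map_lie, LieRing.of_associative_ring_bracket, sub_smul, mul_smul, mul_smul]
    abel

instance : LieModule ℂ L (BalancedTensor ρ σ) where
  smul_lie c x t := by
    change UniversalEnvelopingAlgebra.ι ℂ (c • x) • t = c • (UniversalEnvelopingAlgebra.ι ℂ x • t)
    rw [map_smul, smul_assoc]
  lie_smul c x t := by
    change UniversalEnvelopingAlgebra.ι ℂ x • (c • t) = c • (UniversalEnvelopingAlgebra.ι ℂ x • t)
    rw [smul_comm]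

/-- Right multiplication through a ring homomorphism `φ : A → B`, for an algebra `B` that is
a left `U(L)`-module compatibly with its multiplication. -/
def rightMul {B : Type*} [Ring B] [Module (UniversalEnvelopingAlgebra ℂ L) B]
    [IsScalarTower (UniversalEnvelopingAlgebra ℂ L) B B] (φ : A →+* B) :
    Aᵐᵒᵖ →+* Module.End (UniversalEnvelopingAlgebra ℂ L) B where
  toFun a :=
    { toFun := fun s => s * φ a.unop
      map_add' := fun s t => add_mul s t _
      map_smul' := fun u s => smul_mul_assoc u s _ }
  map_one' := by ext s; simp
  map_mul' a b := by ext s; simp [mul_assoc]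
  map_zero' := by ext s; simp
  map_add' a b := by ext s; simp [mul_add]

/-- The Verma-type module `Ind_b^L ℂ_lam = U(L) ⊗_{U(b)} ℂ_lam`, for a Lie subalgebra `b` of `L`
and a Lie character `lam` of `b`. -/
noncomputable abbrev Verma (b : LieSubalgebra ℂ L) (lam : LieAlgebra.LieCharacter ℂ b) : Type _ :=
  BalancedTensor (L := L) (A := UniversalEnvelopingAlgebra ℂ b)
    (S := UniversalEnvelopingAlgebra ℂ L) (M := ℂ)
    (rightMul (UniversalEnvelopingAlgebra.lift ℂ
      ((UniversalEnvelopingAlgebra.ι ℂ).comp b.incl)).toRingHom)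
    ((Algebra.lmul ℂ ℂ).comp (UniversalEnvelopingAlgebra.lift ℂ lam))

end Tensor

section LocallyFinite

attribute [local instance 100] LieRing.ofAssociativeRing

/-! ### Vectors on which an element acts locally finitely -/

variable {L : Type*} [LieRing L] [LieAlgebra ℂ L] (x : L)
  {M : Type*} [AddCommGroup M] [Module ℂ M] [LieRingModule L M] [LieModule ℂ L M]

/-- The space `ℂ[x] m`. -/
def orbitSpan (m : M) : Submodule ℂ M :=
  Submodule.span ℂ (Set.range fun k : ℕ => (LieModule.toEnd ℂ L M x ^ k) m)

variable {x} in
theorem finiteDimensional_orbitSpan_of_le {m : M} (W : Submodule ℂ M) [FiniteDimensional ℂ W]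
    (hm : m ∈ W) (hW : ∀ w ∈ W, ⁅x, w⁆ ∈ W) : FiniteDimensional ℂ (orbitSpan x m) := by
  refine Submodule.finiteDimensional_of_le (S₂ := W) ?_
  rw [orbitSpan, Submodule.span_le]
  rintro _ ⟨k, rfl⟩
  induction k with
  | zero => simpa using hm
  | succ k ih =>
    simp only [pow_succ', Module.End.mul_apply, LieModule.toEnd_apply_apply]
    exact hW _ ih

theorem self_mem_orbitSpan (m : M) : m ∈ orbitSpan x m :=
  Submodule.subset_span ⟨0, by simp⟩

theorem lie_mem_orbitSpan (m w : M) (hw : w ∈ orbitSpan x m) : ⁅x, w⁆ ∈ orbitSpan x m := by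
  induction hw using Submodule.span_induction with
  | mem y hy =>
    obtain ⟨k, rfl⟩ := hy
    exact Submodule.subset_span ⟨k + 1, by simp [pow_succ', Module.End.mul_apply]⟩
  | zero => simp
  | add y z _ _ hy hz => rw [lie_add]; exact add_mem hy hz
  | smul c y _ hy => rw [lie_smul]; exact Submodule.smul_mem _ c hy

variable (M) in
/-- The submodule of all `m` with `dim ℂ[x] m < ∞`. -/
def locallyFinite [FiniteDimensional ℂ L] : LieSubmodule ℂ L M where
  carrier := {m | FiniteDimensional ℂ (orbitSpan x m)}
  zero_mem' := finiteDimensional_orbitSpan_of_le ⊥ (by simp) (by simp)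
  add_mem' := by
    intro a b (ha : FiniteDimensional ℂ (orbitSpan x a)) (hb : FiniteDimensional ℂ (orbitSpan x b))
    refine finiteDimensional_orbitSpan_of_le (orbitSpan x a ⊔ orbitSpan x b)
      (add_mem (Submodule.mem_sup_left (self_mem_orbitSpan x a))
        (Submodule.mem_sup_right (self_mem_orbitSpan x b))) ?_
    intro w hw
    obtain ⟨y, hy, z, hz, rfl⟩ := Submodule.mem_sup.1 hw
    rw [lie_add]
    exact add_mem (Submodule.mem_sup_left (lie_mem_orbitSpan x a y hy))
      (Submodule.mem_sup_right (lie_mem_orbitSpan x b z hz))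
  smul_mem' := by
    intro c a (ha : FiniteDimensional ℂ (orbitSpan x a))
    exact finiteDimensional_orbitSpan_of_le (orbitSpan x a)
      (Submodule.smul_mem _ c (self_mem_orbitSpan x a)) (lie_mem_orbitSpan x a)
  lie_mem := by
    intro y a (ha : FiniteDimensional ℂ (orbitSpan x a))
    -- the span of `⁅L, ℂ[x] a⁆` and `ℂ[x] a` is finite-dimensional and stable under `x`
    let P : Submodule ℂ M := Submodule.map₂ (LieModule.toEnd ℂ L M).toLinearMap ⊤ (orbitSpan x a)
    have hP : FiniteDimensional ℂ P :=
      Module.Finite.iff_fg.2 (Submodule.FG.map₂ _ (Module.Finite.fg_top)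
        (Module.Finite.iff_fg.1 ha))
    have hPm : ∀ (z : L) (w : M), w ∈ orbitSpan x a → ⁅z, w⁆ ∈ P := fun z w hw =>
      Submodule.apply_mem_map₂ (LieModule.toEnd ℂ L M).toLinearMap (Submodule.mem_top (x := z)) hw
    refine finiteDimensional_orbitSpan_of_le P (hPm y a (self_mem_orbitSpan x a)) ?_
    intro w hw
    have hle : P ≤ P.comap (LieModule.toEnd ℂ L M x) := by
      refine Submodule.map₂_le.2 ?_
      intro z _ v hv
      change ⁅x, ⁅z, v⁆⁆ ∈ P
      rw [leibniz_lie]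
      exact add_mem (hPm _ _ hv) (hPm _ _ (lie_mem_orbitSpan x a v hv))
    exact hle hw

end LocallyFinite

section Ore

/-! ### Localization at an `ad`-nilpotent element -/

variable {A : Type*} [Ring A] [Algebra ℂ A] (x : A)

/-- The commutator with `x`. -/
def adj : Module.End ℂ A := LinearMap.mulLeft ℂ x - LinearMap.mulRight ℂ x

theorem adj_apply (a : A) : adj x a = x * a - a * x := rfl

theorem commute_mulLeft_mulRight :
    Commute (LinearMap.mulLeft ℂ x) (LinearMap.mulRight ℂ x) :=
  LinearMap.ext fun a => (mul_assoc x a x).symm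

theorem adj_mul (a b : A) : adj x (a * b) = adj x a * b + a * adj x b := by
  simp only [adj_apply]; noncomm_ring

theorem adj_pow_mul (n : ℕ) : ∀ (k l : ℕ) (a b : A), k + l = n → (adj x ^ k) a = 0 →
    (adj x ^ l) b = 0 → (adj x ^ n) (a * b) = 0 := by
  induction n with
  | zero =>
    intro k l a b hkl ha hb
    obtain rfl : k = 0 := by omega
    have ha : a = 0 := ha
    simp [ha]
  | succ n ih =>
    intro k l a b hkl ha hb
    rcases k with _ | k
    · have ha : a = 0 := ha
      rw [ha, zero_mul, map_zero]
    rcases l with _ | l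
    · have hb : b = 0 := hb
      rw [hb, mul_zero, map_zero]
    rw [pow_succ, Module.End.mul_apply, adj_mul, map_add,
      ih k (l + 1) _ _ (by omega) (by rwa [pow_succ, Module.End.mul_apply] at ha) hb,
      ih (k + 1) l _ _ (by omega) ha (by rwa [pow_succ, Module.End.mul_apply] at hb), add_zero]

theorem adj_pow_le {k l : ℕ} (h : k ≤ l) {a : A} (ha : (adj x ^ k) a = 0) :
    (adj x ^ l) a = 0 := by
  obtain ⟨d, rfl⟩ := Nat.exists_eq_add_of_le' h
  rw [pow_add, Module.End.mul_apply, ha, map_zero]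

theorem pow_mul_eq_sum (N : ℕ) (a : A) :
    x ^ N * a = ∑ m ∈ Finset.range (N + 1), (N.choose m : ℂ) • ((adj x ^ m) a * x ^ (N - m)) := by
  have hc : Commute (adj x) (LinearMap.mulRight ℂ x) :=
    Commute.sub_left (commute_mulLeft_mulRight x) (Commute.refl _)
  have h : LinearMap.mulLeft ℂ x = adj x + LinearMap.mulRight ℂ x := by simp [adj]
  have h2 : x ^ N * a = (LinearMap.mulLeft ℂ x ^ N) a := by
    rw [LinearMap.pow_mulLeft, LinearMap.mulLeft_apply]
  rw [h2, h, hc.add_pow, LinearMap.sum_apply]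
  refine Finset.sum_congr rfl fun m _ => ?_
  rw [(hc.pow_pow m (N - m)).eq, LinearMap.pow_mulRight, ← Nat.cast_comm, ← nsmul_eq_mul,
    LinearMap.smul_apply, Module.End.mul_apply, LinearMap.mulRight_apply, Nat.cast_smul_eq_nsmul]

/-- The powers of an element with locally nilpotent commutator action satisfy the Ore conditions. -/
theorem nonempty_oreSet (hx : ∀ a : A, ∃ k : ℕ, (adj x ^ k) a = 0) :
    Nonempty (OreLocalization.OreSet (Submonoid.powers x)) := by
  rw [OreLocalization.nonempty_oreSet_iff]
  constructor
  · rintro r₁ r₂ ⟨_, s, rfl⟩ h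
    have h0 : (r₁ - r₂) * x ^ s = 0 := by rw [sub_mul]; exact sub_eq_zero.2 h
    obtain ⟨k, hk⟩ := hx (r₁ - r₂)
    refine ⟨⟨x ^ (k + s), k + s, rfl⟩, ?_⟩
    refine sub_eq_zero.1 ?_
    rw [← mul_sub]
    change x ^ (k + s) * (r₁ - r₂) = 0
    have hR : LinearMap.mulRight ℂ (x ^ s) (r₁ - r₂) = 0 := h0
    have hc : Commute (adj x) (LinearMap.mulRight ℂ (x ^ s)) := by
      rw [← LinearMap.pow_mulRight]
      exact Commute.pow_right
        (Commute.sub_left (commute_mulLeft_mulRight x) (Commute.refl _)) s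
    rw [pow_mul_eq_sum]
    refine Finset.sum_eq_zero fun m _ => ?_
    by_cases hm : k ≤ m
    · rw [adj_pow_le x hm hk, zero_mul, smul_zero]
    · have e : k + s - m = s + (k - m) := by omega
      have h3 : (adj x ^ m) (r₁ - r₂) * x ^ s = 0 := by
        change LinearMap.mulRight ℂ (x ^ s) ((adj x ^ m) (r₁ - r₂)) = 0
        rw [← Module.End.mul_apply, ← (hc.pow_left m).eq, Module.End.mul_apply, hR, map_zero]
      rw [e, pow_add, ← mul_assoc, h3, zero_mul, smul_zero]
  · rintro r ⟨_, s, rfl⟩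
    obtain ⟨k, hk⟩ := hx r
    refine ⟨∑ m ∈ Finset.range (k + s + 1),
      ((k + s).choose m : ℂ) • ((adj x ^ m) r * x ^ (k - m)), ⟨x ^ (k + s), k + s, rfl⟩, ?_⟩
    change x ^ (k + s) * r = _ * x ^ s
    rw [pow_mul_eq_sum, Finset.sum_mul]
    refine Finset.sum_congr rfl fun m _ => ?_
    by_cases hm : k ≤ m
    · rw [adj_pow_le x hm hk, zero_mul, zero_mul]; simp
    · have e : k + s - m = (k - m) + s := by omega
      rw [e, pow_add, smul_mul_assoc, mul_assoc]

attribute [local instance 100] LieRing.ofAssociativeRing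

/-- An `ad`-nilpotent element of `L` has locally nilpotent commutator action on `U(L)`. -/
theorem adj_ι_locally_nilpotent {L : Type*} [LieRing L] [LieAlgebra ℂ L] (y : L)
    (hy : ∀ z : L, ∃ k : ℕ, (LieAlgebra.ad ℂ L y ^ k) z = 0)
    (a : UniversalEnvelopingAlgebra ℂ L) :
    ∃ k : ℕ, (adj (UniversalEnvelopingAlgebra.ι ℂ y) ^ k) a = 0 := by
  set X := UniversalEnvelopingAlgebra.ι ℂ y with hX
  let B : Subalgebra ℂ (UniversalEnvelopingAlgebra ℂ L) :=
    { carrier := {a | ∃ k : ℕ, (adj X ^ k) a = 0}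
      mul_mem' := by
        rintro a b ⟨k, hk⟩ ⟨l, hl⟩
        exact ⟨k + l, adj_pow_mul X (k + l) k l a b rfl hk hl⟩
      add_mem' := by
        rintro a b ⟨k, hk⟩ ⟨l, hl⟩
        exact ⟨max k l, by
          rw [map_add, adj_pow_le X (le_max_left k l) hk, adj_pow_le X (le_max_right k l) hl,
            add_zero]⟩
      algebraMap_mem' := fun c => ⟨1, by
        rw [pow_one, adj_apply, Algebra.commutes, sub_self]⟩ }
  have hpow : ∀ (k : ℕ) (z : L), (adj X ^ k) (UniversalEnvelopingAlgebra.ι ℂ z) =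
      UniversalEnvelopingAlgebra.ι ℂ ((LieAlgebra.ad ℂ L y ^ k) z) := by
    intro k
    induction k with
    | zero => intro z; rfl
    | succ k ih =>
      intro z
      rw [pow_succ, Module.End.mul_apply, pow_succ, Module.End.mul_apply, ← ih, LieAlgebra.ad_apply,
        LieHom.map_lie, adj_apply, LieRing.of_associative_ring_bracket]
  let f : L →ₗ⁅ℂ⁆ B :=
    { toFun := fun z => ⟨UniversalEnvelopingAlgebra.ι ℂ z, by
        obtain ⟨k, hk⟩ := hy z
        exact ⟨k, by rw [hpow, hk, map_zero]⟩⟩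
      map_add' := fun z w => Subtype.ext (map_add _ z w)
      map_smul' := fun c z => Subtype.ext (map_smul _ c z)
      map_lie' := fun {z w} => Subtype.ext (LieHom.map_lie _ z w) }
  have hid : B.val.comp (UniversalEnvelopingAlgebra.lift ℂ f) = AlgHom.id ℂ _ := by
    apply UniversalEnvelopingAlgebra.hom_ext
    ext z
    change ((UniversalEnvelopingAlgebra.lift ℂ f (UniversalEnvelopingAlgebra.ι ℂ z) : B) :
      UniversalEnvelopingAlgebra ℂ L) = UniversalEnvelopingAlgebra.ι ℂ z
    rw [UniversalEnvelopingAlgebra.lift_ι_apply]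
    rfl
  have := (UniversalEnvelopingAlgebra.lift ℂ f a).2
  have h2 : ((UniversalEnvelopingAlgebra.lift ℂ f a : B) : UniversalEnvelopingAlgebra ℂ L) = a :=
    DFunLike.congr_fun hid a
  rw [h2] at this
  exact this

end Ore

section Takiff

/-! ### Takiff Lie algebras -/

/-- The Takiff Lie algebra `g ⊗ ℂ[x]/(x²) = g ⋉ ḡ`; the pair `(lev, bar)` is the element
`lev ⊗ 1 + bar ⊗ x`. -/
@[ext]
structure Takiff (g : Type*) where
  /-- The component in `g ⊗ 1`. -/
  lev : g
  /-- The component in `g ⊗ x`. -/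
  bar : g

namespace Takiff

variable (g : Type*)

/-- The underlying pair. -/
def toProd : Takiff g ≃ g × g where
  toFun x := (x.lev, x.bar)
  invFun p := ⟨p.1, p.2⟩
  left_inv _ := rfl
  right_inv _ := rfl

section Bracket

variable [LieRing g]

instance : AddCommGroup (Takiff g) := (toProd g).addCommGroup

instance [LieAlgebra ℂ g] : Module ℂ (Takiff g) := (toProd g).module ℂ

@[simp] theorem lev_add (x y : Takiff g) : (x + y).lev = x.lev + y.lev := rfl
@[simp] theorem bar_add (x y : Takiff g) : (x + y).bar = x.bar + y.bar := rfl
@[simp] theorem lev_zero : (0 : Takiff g).lev = 0 := rfl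
@[simp] theorem bar_zero : (0 : Takiff g).bar = 0 := rfl
@[simp] theorem lev_smul [LieAlgebra ℂ g] (c : ℂ) (x : Takiff g) : (c • x).lev = c • x.lev := rfl
@[simp] theorem bar_smul [LieAlgebra ℂ g] (c : ℂ) (x : Takiff g) : (c • x).bar = c • x.bar := rfl

/-- `[a ⊗ 1 + b ⊗ x, c ⊗ 1 + d ⊗ x] = [a, c] ⊗ 1 + ([a, d] + [b, c]) ⊗ x`. -/
instance : Bracket (Takiff g) (Takiff g) where
  bracket x y := ⟨⁅x.lev, y.lev⁆, ⁅x.lev, y.bar⁆ + ⁅x.bar, y.lev⁆⟩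

@[simp] theorem lev_lie (x y : Takiff g) : ⁅x, y⁆.lev = ⁅x.lev, y.lev⁆ := rfl
@[simp] theorem bar_lie (x y : Takiff g) : ⁅x, y⁆.bar = ⁅x.lev, y.bar⁆ + ⁅x.bar, y.lev⁆ := rfl

instance : LieRing (Takiff g) where
  add_lie x y z := by
    ext
    · simp
    · simp only [bar_lie, lev_add, bar_add, add_lie]; abel
  lie_add x y z := by
    ext
    · simp
    · simp only [bar_lie, lev_add, bar_add, lie_add]; abel
  lie_self x := by
    ext
    · simp
    · simp only [bar_lie, bar_zero]
      rw [← lie_skew x.lev x.bar, neg_add_cancel]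
  leibniz_lie x y z := by
    ext
    · simp
    · simp only [bar_lie, lev_lie, bar_add, lie_add, add_lie, leibniz_lie x.lev y.lev z.bar,
        leibniz_lie x.lev y.bar z.lev, leibniz_lie x.bar y.lev z.lev]
      abel

end Bracket

variable [LieRing g] [LieAlgebra ℂ g]

instance : LieAlgebra ℂ (Takiff g) where
  lie_smul c x y := by ext <;> simp

/-- The linear identification with `g × g`. -/
def toProdₗ : Takiff g ≃ₗ[ℂ] g × g where
  __ := toProd g
  map_add' _ _ := rfl
  map_smul' _ _ := rfl

instance [FiniteDimensional ℂ g] : FiniteDimensional ℂ (Takiff g) :=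
  Module.Finite.equiv (toProdₗ g).symm

/-- The inclusion `g → g ⋉ ḡ`, `a ↦ a ⊗ 1`. -/
def incl : g →ₗ⁅ℂ⁆ Takiff g where
  toFun a := ⟨a, 0⟩
  map_add' a b := by ext <;> simp
  map_smul' c a := by ext <;> simp
  map_lie' {a b} := by ext <;> simp

/-- The projection `g ⋉ ḡ → g` with kernel `ḡ`. -/
def proj : Takiff g →ₗ⁅ℂ⁆ g where
  toFun x := x.lev
  map_add' _ _ := rfl
  map_smul' _ _ := rfl
  map_lie' := rfl

end Takiff

section

attribute [local instance 100] LieRing.ofAssociativeRing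

/-- The Lie algebra `sl₂` of traceless complex `2 × 2` matrices. -/
def sl2 : Type := LieAlgebra.SpecialLinear.sl (Fin 2) ℂ

noncomputable instance : LieRing sl2 :=
  inferInstanceAs (LieRing (LieAlgebra.SpecialLinear.sl (Fin 2) ℂ))

noncomputable instance : LieAlgebra ℂ sl2 :=
  inferInstanceAs (LieAlgebra ℂ (LieAlgebra.SpecialLinear.sl (Fin 2) ℂ))

instance : FiniteDimensional ℂ sl2 :=
  inferInstanceAs (FiniteDimensional ℂ (LieAlgebra.SpecialLinear.sl (Fin 2) ℂ).toSubmodule)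

/-- The matrix of an element of `sl₂`. -/
def sl2.mat (a : sl2) : Matrix (Fin 2) (Fin 2) ℂ := Subtype.val a

theorem sl2.ext {a b : sl2} (h : a.mat = b.mat) : a = b := Subtype.ext h

@[simp] theorem sl2.mat_zero : (0 : sl2).mat = 0 := rfl
@[simp] theorem sl2.mat_add (a b : sl2) : (a + b).mat = a.mat + b.mat := rfl
@[simp] theorem sl2.mat_smul (c : ℂ) (a : sl2) : (c • a).mat = c • a.mat := rfl
@[simp] theorem sl2.mat_lie (a b : sl2) : ⁅a, b⁆.mat = a.mat * b.mat - b.mat * a.mat := rfl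
theorem sl2.trace_mat (a : sl2) : a.mat.trace = 0 := LinearMap.mem_ker.1 a.2

/-- The Takiff `sl₂`. -/
abbrev TT : Type := Takiff sl2

/-- The element `e` of `sl₂`. -/
def sl2e : sl2 := ⟨!![0, 1; 0, 0], by
  simp [LieAlgebra.SpecialLinear.sl, Matrix.trace_fin_two]⟩

/-- The element `h` of `sl₂`. -/
def sl2h : sl2 := ⟨!![1, 0; 0, -1], by
  simp [LieAlgebra.SpecialLinear.sl, Matrix.trace_fin_two]⟩

/-- The element `f` of `sl₂`. -/
def sl2f : sl2 := ⟨!![0, 0; 1, 0], by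
  simp [LieAlgebra.SpecialLinear.sl, Matrix.trace_fin_two]⟩

/-- The element `e` of the Takiff `sl₂`. -/
noncomputable def Te : TT := ⟨sl2e, 0⟩

/-- The element `f` of the Takiff `sl₂`. -/
noncomputable def Tf : TT := ⟨sl2f, 0⟩

/-- The element `ē`. -/
noncomputable def Teb : TT := ⟨0, sl2e⟩

/-- The element `h̄`. -/
noncomputable def Thb : TT := ⟨0, sl2h⟩

/-- The element `f̄`. -/
noncomputable def Tfb : TT := ⟨0, sl2f⟩

/-- The generator `C̄ = h̄² + 4 f̄ ē` of the purely Takiff part of the center of `U(T)`. -/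
noncomputable def Cbar : UniversalEnvelopingAlgebra ℂ TT :=
  UniversalEnvelopingAlgebra.ι ℂ Thb ^ 2 +
    4 * (UniversalEnvelopingAlgebra.ι ℂ Tfb * UniversalEnvelopingAlgebra.ι ℂ Teb)

theorem ad_Tf_nilpotent (z : TT) : ∃ k : ℕ, (LieAlgebra.ad ℂ TT Tf ^ k) z = 0 := by
  refine ⟨3, ?_⟩
  have key : ∀ w : sl2, ⁅sl2f, ⁅sl2f, ⁅sl2f, w⁆⁆⁆ = 0 := by
    intro w
    apply sl2.ext
    have hf : sl2f.mat * sl2f.mat = 0 := by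
      ext i j
      fin_cases i <;> fin_cases j <;> simp [sl2f, sl2.mat]
    simp only [sl2.mat_lie, sl2.mat_zero, mul_sub, sub_mul, ← mul_assoc, hf, zero_mul]
    simp only [mul_assoc, hf, mul_zero]
    simp
  simp only [pow_succ, pow_zero, one_mul, Module.End.mul_apply, LieAlgebra.ad_apply]
  ext1
  · simpa [Tf] using key z.lev
  · simpa [Tf] using key z.bar

end

section Functor

attribute [local instance 100] LieRing.ofAssociativeRing

/-! ### Verma modules and the Enright-Arkhipov completion -/

/-- Powers of `f` in `U(T)`. -/
noncomputable abbrev fPowers : Submonoid (UniversalEnvelopingAlgebra ℂ TT) :=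
  Submonoid.powers (UniversalEnvelopingAlgebra.ι ℂ Tf)

noncomputable instance : OreLocalization.OreSet fPowers :=
  (nonempty_oreSet _ (adj_ι_locally_nilpotent Tf ad_Tf_nilpotent)).some

/-- The localization `U_(f)` of `U = U(T)`. -/
noncomputable abbrev Uf : Type := OreLocalization fPowers (UniversalEnvelopingAlgebra ℂ TT)

/-- The image of `U` in `U_(f)`. -/
noncomputable def Uimage : Submodule (UniversalEnvelopingAlgebra ℂ TT) Uf :=
  LinearMap.range (LinearMap.toSpanSingleton (UniversalEnvelopingAlgebra ℂ TT) Uf 1)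

/-- The canonical homomorphism `U → U_(f)`. -/
noncomputable abbrev toUf : UniversalEnvelopingAlgebra ℂ TT →+* Uf :=
  OreLocalization.numeratorRingHom

theorem smul_one_eq_toUf (u : UniversalEnvelopingAlgebra ℂ TT) : u • (1 : Uf) = toUf u := by
  rw [OreLocalization.one_def, OreLocalization.smul_oreDiv_one, smul_eq_mul, mul_one]
  rfl

theorem Uimage_le_comap (a : (UniversalEnvelopingAlgebra ℂ TT)ᵐᵒᵖ) :
    Uimage ≤ Uimage.comap (rightMul toUf a) := by
  rintro _ ⟨u, rfl⟩
  refine ⟨u * a.unop, ?_⟩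
  simp only [LinearMap.toSpanSingleton_apply]
  rw [smul_one_eq_toUf, smul_one_eq_toUf, map_mul]
  rfl

/-- The bimodule `S_f = U_(f) / U`, as a left module. -/
abbrev Sf : Type := Uf ⧸ Uimage

/-- The right action of `U` on `S_f`. -/
noncomputable def SfRight : (UniversalEnvelopingAlgebra ℂ TT)ᵐᵒᵖ →+*
    Module.End (UniversalEnvelopingAlgebra ℂ TT) Sf where
  toFun a := Submodule.mapQ Uimage Uimage (rightMul toUf a) (Uimage_le_comap a)
  map_one' := by ext s; simp
  map_mul' a b := by ext s; simp
  map_zero' := by ext s; simp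
  map_add' a b := by ext s; simp

/-- The Enright-Arkhipov completion `EA(M) = ᵉ(S_f ⊗_U M)`: the vectors of `S_f ⊗_U M` on which
`e` acts locally finitely. -/
noncomputable def EA (M : Type*) [AddCommGroup M] [Module ℂ M] [LieRingModule TT M]
    [LieModule ℂ TT M] : LieSubmodule ℂ TT (BalancedTensor SfRight (envAction TT M)) :=
  locallyFinite Te (BalancedTensor SfRight (envAction TT M))

/-- The subalgebra of `sl₂` spanned by `h` and `e`. -/
noncomputable def borelSl2 : LieSubalgebra ℂ sl2 where
  carrier := {a | a.mat 1 0 = 0}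
  add_mem' := by
    intro a b (ha : a.mat 1 0 = 0) (hb : b.mat 1 0 = 0)
    simp [ha, hb]
  zero_mem' := by simp
  smul_mem' := by
    intro c a (ha : a.mat 1 0 = 0)
    simp [ha]
  lie_mem' := by
    intro a b (ha : a.mat 1 0 = 0) (hb : b.mat 1 0 = 0)
    simp [Matrix.mul_apply, Fin.sum_univ_two, ha, hb]

/-- The subalgebra of the Takiff `sl₂` spanned by `h`, `h̄`, `e` and `ē`. -/
noncomputable def borelT : LieSubalgebra ℂ TT where
  carrier := {x | x.lev ∈ borelSl2 ∧ x.bar ∈ borelSl2}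
  add_mem' := fun ha hb => ⟨add_mem ha.1 hb.1, add_mem ha.2 hb.2⟩
  zero_mem' := ⟨zero_mem _, zero_mem _⟩
  smul_mem' := fun c _ ha => ⟨borelSl2.smul_mem c ha.1, borelSl2.smul_mem c ha.2⟩
  lie_mem' := fun ha hb => ⟨borelSl2.lie_mem ha.1 hb.1,
    add_mem (borelSl2.lie_mem ha.1 hb.2) (borelSl2.lie_mem ha.2 hb.1)⟩

theorem mat_lie_zero_zero {a b : sl2} (ha : a ∈ borelSl2) (hb : b ∈ borelSl2) :
    ⁅a, b⁆.mat 0 0 = 0 := by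
  have ha : a.mat 1 0 = 0 := ha
  have hb : b.mat 1 0 = 0 := hb
  simp [Matrix.mul_apply, Fin.sum_univ_two, ha, hb, mul_comm]

/-- The character of `borelSl2` with `h ↦ mu`, `e ↦ 0`. -/
noncomputable def char (mu : ℂ) : LieAlgebra.LieCharacter ℂ borelSl2 where
  toFun a := mu * a.1.mat 0 0
  map_add' a b := by simp [mul_add]
  map_smul' c a := by simp [mul_left_comm]
  map_lie' {a b} := by
    simp [mat_lie_zero_zero a.2 b.2, mul_comm, LieRing.of_associative_ring_bracket]

/-- The character of `borelT` with `h ↦ lam1`, `h̄ ↦ lam2`, `e, ē ↦ 0`. -/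
noncomputable def charT (lam1 lam2 : ℂ) : LieAlgebra.LieCharacter ℂ borelT where
  toFun x := lam1 * x.1.lev.mat 0 0 + lam2 * x.1.bar.mat 0 0
  map_add' x y := by simp; ring
  map_smul' c x := by simp; ring
  map_lie' {x y} := by
    have h1 := mat_lie_zero_zero x.2.1 y.2.1
    have h2 := mat_lie_zero_zero x.2.1 y.2.2
    have h3 := mat_lie_zero_zero x.2.2 y.2.1
    simp only [LieSubalgebra.coe_bracket, Takiff.lev_lie, Takiff.bar_lie, sl2.mat_add,
      Matrix.add_apply, h1, h2, h3]
    simp [LieRing.of_associative_ring_bracket, mul_comm]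

/-- The Verma module `Δ(lam1, lam2)` of the Takiff `sl₂`, where `lam1` and `lam2` are the values
of the highest weight on `h` and `h̄`. -/
noncomputable abbrev VermaT (lam1 lam2 : ℂ) : Type := Verma borelT (charT lam1 lam2)

/-- `V(n, lam2) = EA(Δ(n - 2, lam2))`. -/
noncomputable abbrev VEA (n : ℤ) (lam2 : ℂ) :
    LieSubmodule ℂ TT (BalancedTensor SfRight (envAction TT (VermaT ((n : ℂ) - 2) lam2))) :=
  EA (VermaT ((n : ℂ) - 2) lam2)

/-- The Verma module `Δ(mu)` of `sl₂`. -/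
noncomputable abbrev VermaSl2 (mu : ℂ) : Type := Verma borelSl2 (char mu)

/-- The simple `sl₂`-module `L(mu)`: the quotient of the Verma module by the sum of its proper
submodules. -/
noncomputable abbrev SimpleL (mu : ℂ) : Type :=
  VermaSl2 mu ⧸ (sSup {N | N ≠ ⊤} : LieSubmodule ℂ sl2 (VermaSl2 mu))

/-- An `sl₂`-module regarded as a `T`-module with the trivial action of the ideal. -/
abbrev Infl (W : Type*) : Type _ := Pullback (Takiff.proj sl2) W

/-- The restriction of a `T`-module to `sl₂`. -/
abbrev Res (V : Type*) : Type _ := Pullback (Takiff.incl sl2) V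

variable (V : Type*) [AddCommGroup V] [Module ℂ V] [LieRingModule TT V] [LieModule ℂ TT V]

/-- `sl₂`-Harish-Chandra modules: the restriction to `sl₂` is the direct sum of a set `D` of simple
finite-dimensional submodules, each of them isomorphic to only finitely many members of `D`. -/
def IsHarishChandra : Prop :=
  ∃ D : Set (LieSubmodule ℂ sl2 (Res V)),
    (∀ W ∈ D, LieModule.IsIrreducible ℂ sl2 W ∧ FiniteDimensional ℂ W) ∧
    sSupIndep D ∧ sSup D = ⊤ ∧
    ∀ W ∈ D, {W' ∈ D | Nonempty (W' ≃ₗ⁅ℂ, sl2⁆ W)}.Finite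

/-- `L(n)` is isomorphic to an `sl₂`-submodule of `V`. -/
def HasType (n : ℕ) : Prop :=
  ∃ W : LieSubmodule ℂ sl2 (Res V), Nonempty (W ≃ₗ⁅ℂ, sl2⁆ SimpleL n)

/-- `L(n)` is the minimal `sl₂`-type of `V`. -/
def IsMinimalType (n : ℕ) : Prop := HasType V n ∧ ∀ m : ℕ, HasType V m → n ≤ m

/-- `C̄` acts on `V` as the scalar `chi`. -/
def CbarActsBy (chi : ℂ) : Prop := ∀ v : V, envAction TT V Cbar v = chi • v

end Functor

end Takiff

end TakiffHC

/-! A simple Harish-Chandra module is pinned down by a lowest weight vector u of its minimal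
sl₂-type L(m) and by the scalars of two central operators: C̄, and D = h h̄ + 2 e f̄ + 2 f ē, which
is half the polarization of the sl₂-Casimir. Both act by scalars because they preserve the
finite-dimensional space of lowest weight vectors of a given weight
(`IsHarishChandra.exists_eq_smul`). Minimality forces the L(m - 2)-component of ḡ ⊗ L(m) to act on u
by zero. Together with the eigenvalue of D this expresses ē u through e u and e e f̄ u. For m > 0 it
also yields one number λ with D = mλ and C̄ = λ² (`opC_eq_sq_of_lie_eb`); for m = 0 it gives D = 0,
and λ is any square root of C̄. These data are `IsMinimalVector m λ u`.

Uniqueness: the relations make the span of the e ^ j f̄ ^ k u a submodule, in which the lowest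
weight vectors of weight -m are multiples of u. If V and V' are simple with minimal vectors u and u'
for the same (m, λ), then (u, u') is a minimal vector of V × V'. The submodule that it generates
contains neither (u, 0) nor (0, u'), so it is the graph of an isomorphism
(`IsMinimalVector.nonempty_equiv`).

Existence: the localization of Δ(n - 2, λ) at f is modelled on symbols f̄ ^ b f ^ j with j ∈ ℤ, and
S_f ⊗ Δ(n - 2, λ) on the quotient by those with j ≥ 0. The action is given by formulas whose
relations are checked directly, so independence of the spanning vectors of the tensor product comes
from its map to the model (`LocModel.sfTensorHom_bijective`). The lowest weight vectors of the
quotient are the multiples of y_i = f̄ ^ i f ^ (-1), of weight n - 2i. For λ ≠ 0, e is locally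
finite on y_i exactly when n ≤ i. Hence V(n, λ) has the types L(2i - n) with i ≥ max(n, 0), the
smallest being L(|n|). It is simple because f̄ leads from y_i to y_{i+1}, while the L(m -
2)-projection leads back from y_i to y_{i-1} with the factor λ² i (i - n).

If n = ε|n| with ε = ±1, then y_{max(n, 0)} is a minimal vector for (|n|, ελ). So every (m, λ) with
λ ≠ 0 is realized and V(n, λ) ≅ V(-n, -λ); all other pairs are separated by C̄ = λ² and D = nλ. The
inflated L(m) has a minimal vector for (m, 0), which settles C̄ = 0. -/

namespace TakiffHC

/-! ### Splitting a vector into its weight components. -/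

section Weights

variable {M : Type*} [AddCommGroup M] [Module ℂ M]

theorem aeval_eigen (T : Module.End ℂ M) (p : Polynomial ℂ) {μ : ℂ} {x : M} (hx : T x = μ • x) :
    Polynomial.aeval T p x = p.eval μ • x := by
  induction p using Polynomial.induction_on' with
  | add p q hp hq => simp [hp, hq, add_smul]
  | monomial n a =>
    have h : (T ^ n) x = μ ^ n • x := by
      induction n with
      | zero => simp
      | succ n ih => rw [pow_succ', Module.End.mul_apply, ih, map_smul, hx, smul_smul, pow_succ]
    rw [Polynomial.aeval_monomial, Module.End.mul_apply, h, Polynomial.eval_monomial,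
      Module.algebraMap_end_apply, smul_smul]

/-- The projection of a sum of eigenvectors to an eigenspace is given by a polynomial. -/
theorem exists_aeval_eq_filter {ι : Type*} (T : Module.End ℂ M) (s : Finset ι) (μ : ι → ℂ)
    (x : ι → M) (hx : ∀ i ∈ s, T (x i) = μ i • x i) (ν : ℂ) :
    ∃ p : Polynomial ℂ, p.eval ν = 1 ∧
      Polynomial.aeval T p (∑ i ∈ s, x i) = ∑ i ∈ s with μ i = ν, x i := by
  classical
  -- Lagrange interpolation: value 1 at `ν` and 0 at every other eigenvalue that occurs.
  let p : Polynomial ℂ := ∏ a ∈ (s.image μ).erase ν,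
    (Polynomial.C (ν - a)⁻¹ * (Polynomial.X - Polynomial.C a))
  have h1 : p.eval ν = 1 := by
    rw [Polynomial.eval_prod]
    refine Finset.prod_eq_one fun a ha => ?_
    have : ν - a ≠ 0 := sub_ne_zero.2 (Finset.ne_of_mem_erase ha).symm
    simp [this]
  refine ⟨p, h1, ?_⟩
  rw [map_sum, Finset.sum_filter]
  refine Finset.sum_congr rfl fun i hi => ?_
  rw [aeval_eigen T p (hx i hi)]
  split_ifs with h
  · rw [h, h1, one_smul]
  · have : p.eval (μ i) = 0 := by
      rw [Polynomial.eval_prod]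
      exact Finset.prod_eq_zero (Finset.mem_erase.2 ⟨h, Finset.mem_image_of_mem μ hi⟩) (by simp)
    rw [this, zero_smul]

theorem aeval_mem {T : Module.End ℂ M} (p : Polynomial ℂ) {W : Submodule ℂ M}
    (hW : ∀ x ∈ W, T x ∈ W) {x : M} (hx : x ∈ W) : Polynomial.aeval T p x ∈ W := by
  induction p using Polynomial.induction_on' with
  | add p q hp hq => simpa using add_mem hp hq
  | monomial n a =>
    have h : (T ^ n) x ∈ W := by
      induction n with
      | zero => simpa using hx
      | succ n ih => rw [pow_succ', Module.End.mul_apply]; exact hW _ ih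
    rw [Polynomial.aeval_monomial, Module.End.mul_apply, Module.algebraMap_end_apply]
    exact W.smul_mem _ h

/-- The component is a polynomial in `T` applied to the whole sum, so a `T`-stable subspace
containing the sum contains it. The individual `x i` need not lie in `W`. -/
theorem sum_filter_mem {ι : Type*} (T : Module.End ℂ M) (s : Finset ι) (μ : ι → ℂ)
    (x : ι → M) (hx : ∀ i ∈ s, T (x i) = μ i • x i) (ν : ℂ) {W : Submodule ℂ M}
    (hW : ∀ x ∈ W, T x ∈ W) (h : ∑ i ∈ s, x i ∈ W) : ∑ i ∈ s with μ i = ν, x i ∈ W := by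
  obtain ⟨p, -, hp⟩ := exists_aeval_eq_filter T s μ x hx ν
  rw [← hp]
  exact aeval_mem p hW h

theorem eq_sum_filter {ι : Type*} (T : Module.End ℂ M) (s : Finset ι) (μ : ι → ℂ)
    (x : ι → M) (hx : ∀ i ∈ s, T (x i) = μ i • x i) (ν : ℂ)
    (h : T (∑ i ∈ s, x i) = ν • ∑ i ∈ s, x i) : ∑ i ∈ s, x i = ∑ i ∈ s with μ i = ν, x i := by
  obtain ⟨p, hp1, hp⟩ := exists_aeval_eq_filter T s μ x hx ν
  rw [← hp, aeval_eigen T p h, hp1, one_smul]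

end Weights

/-! ### Elementary representation theory of sl₂, from lowest weight vectors. -/

section Sl2Rep

variable {M : Type*} [AddCommGroup M] [Module ℂ M]

/-- The defining relations of `sl₂` for three endomorphisms. -/
structure IsSl2Rep (e h f : Module.End ℂ M) : Prop where
  ef : ∀ x, e (f x) = f (e x) + h x
  he : ∀ x, h (e x) = e (h x) + (2 : ℂ) • e x
  hf : ∀ x, h (f x) = f (h x) - (2 : ℂ) • f x

namespace IsSl2Rep

variable {e h f : Module.End ℂ M} (H : IsSl2Rep e h f)
include H

/-- The Chevalley involution; it turns statements about lowest weight vectors into statements about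
highest weight vectors. -/
theorem symm : IsSl2Rep f (-h) e where
  ef x := by simp [H.ef]
  he x := by simp [H.hf]; abel
  hf x := by simp [H.he]; abel

theorem h_e_pow {x : M} {μ : ℂ} (hx : h x = μ • x) (j : ℕ) :
    h ((e ^ j) x) = (μ + 2 * j) • (e ^ j) x := by
  induction j with
  | zero => simp [hx]
  | succ j ih =>
    rw [pow_succ', Module.End.mul_apply, H.he, ih]
    push_cast
    rw [map_smul]; module

theorem h_f_pow {x : M} {μ : ℂ} (hx : h x = μ • x) (j : ℕ) :
    h ((f ^ j) x) = (μ - 2 * j) • (f ^ j) x := by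
  have := H.symm.h_e_pow (x := x) (μ := -μ) (by simp [hx]) j
  simp only [LinearMap.neg_apply] at this
  rw [← neg_inj, this]; module

theorem f_e_pow {x : M} {μ : ℂ} (hx : h x = μ • x) (hf : f x = 0) (j : ℕ) :
    f ((e ^ (j + 1)) x) = (-((j + 1) * (μ + j)) : ℂ) • (e ^ j) x := by
  induction j with
  | zero =>
    have := H.ef x
    rw [hf, map_zero, hx] at this
    simp [eq_neg_of_add_eq_zero_left this.symm]
  | succ j ih =>
    have := H.ef ((e ^ (j + 1)) x)
    rw [ih, H.h_e_pow hx, map_smul] at this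
    rw [pow_succ', Module.End.mul_apply, eq_sub_of_add_eq this.symm, pow_succ' e j,
      Module.End.mul_apply]
    push_cast
    module

/-- For the least power with e ^ (l + 1) x = 0, applying f gives the multiple -(l + 1)(μ + l) of the
nonzero vector e ^ l x, so μ = -l. -/
theorem exists_nat {x : M} {μ : ℂ} (hx : h x = μ • x) (hf : f x = 0) (h0 : x ≠ 0) {N : ℕ}
    (hN : (e ^ N) x = 0) : ∃ l : ℕ, μ = -l ∧ (e ^ (l + 1)) x = 0 ∧ (e ^ l) x ≠ 0 := by
  classical
  have hex : ∃ N, (e ^ N) x = 0 := ⟨N, hN⟩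
  obtain ⟨l, hl⟩ : ∃ l, Nat.find hex = l + 1 := by
    refine Nat.exists_eq_succ_of_ne_zero fun h => h0 ?_
    simpa [h] using Nat.find_spec hex
  have h1 : (e ^ (l + 1)) x = 0 := hl ▸ Nat.find_spec hex
  have h2 : (e ^ l) x ≠ 0 := Nat.find_min hex (by omega)
  refine ⟨l, ?_, h1, h2⟩
  have h3 := H.f_e_pow hx hf l
  rw [h1, map_zero, eq_comm, smul_eq_zero_iff_left h2, neg_eq_zero, mul_eq_zero] at h3
  exact eq_neg_of_add_eq_zero_left (h3.resolve_left (Nat.cast_add_one_ne_zero l))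

theorem f_pow_e_pow {x : M} {μ : ℂ} (hx : h x = μ • x) (hf : f x = 0) (j : ℕ)
    (hj : ∀ i < j, μ + i ≠ 0) : ∃ c : ℂ, c ≠ 0 ∧ (f ^ j) ((e ^ j) x) = c • x := by
  induction j with
  | zero => exact ⟨1, one_ne_zero, by simp⟩
  | succ j ih =>
    obtain ⟨c, hc, hcx⟩ := ih fun i hi => hj i (by omega)
    refine ⟨-((j + 1) * (μ + j)) * c, mul_ne_zero (neg_ne_zero.2
      (mul_ne_zero (Nat.cast_add_one_ne_zero j) (hj j (by omega)))) hc, ?_⟩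
    rw [pow_succ f, Module.End.mul_apply, H.f_e_pow hx hf, map_smul, hcx, smul_smul]

theorem f_pow_e_pow_eq_zero {x : M} {μ : ℂ} (hx : h x = μ • x) (hf : f x = 0) {j k : ℕ}
    (hjk : j < k) : (f ^ k) ((e ^ j) x) = 0 := by
  induction j generalizing k with
  | zero =>
    obtain ⟨k, rfl⟩ := Nat.exists_eq_succ_of_ne_zero hjk.ne'
    simp [pow_succ, hf]
  | succ j ih =>
    obtain ⟨k, rfl⟩ := Nat.exists_eq_succ_of_ne_zero (Nat.zero_lt_of_lt hjk).ne'
    rw [pow_succ f, Module.End.mul_apply, H.f_e_pow hx hf, map_smul, ih (by omega), smul_zero]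

/-- The e ^ j x have pairwise different weights. If none vanished, they would be infinitely many
independent vectors of `W`. -/
theorem exists_e_pow_eq_zero {x : M} {μ : ℂ} (hx : h x = μ • x) (W : Submodule ℂ M)
    [FiniteDimensional ℂ W] (hW : ∀ j, (e ^ j) x ∈ W) : ∃ N, (e ^ N) x = 0 := by
  by_contra! hne
  have hli : LinearIndependent ℂ fun j : ℕ => (e ^ j) x := by
    refine Module.End.eigenvectors_linearIndependent' h (fun j : ℕ => μ + 2 * j) ?_ _ ?_
    · intro a b hab
      have : (2 * a : ℂ) = 2 * b := add_left_cancel hab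
      exact_mod_cast mul_left_cancel₀ two_ne_zero this
    · exact fun j => ⟨Module.End.mem_eigenspace_iff.2 (H.h_e_pow hx j), hne j⟩
  have hli' : LinearIndependent ℂ fun j : ℕ => (⟨(e ^ j) x, hW j⟩ : W) :=
    LinearIndependent.of_comp W.subtype hli
  exact Set.infinite_univ (α := ℕ) (Set.finite_univ_iff.2 hli'.finite)

/-- A subspace stable under `f` that contains a nonzero combination of the `e ^ j x`, `x` being a
lowest weight vector of a finite-dimensional simple module, contains `x`. -/
theorem mem_of_sum_e_pow {x : M} {l : ℕ} (hx : h x = (-l : ℂ) • x) (hf : f x = 0)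
    (hl : (e ^ (l + 1)) x = 0) {W : Submodule ℂ M} (hW : ∀ y ∈ W, f y ∈ W)
    {y : M} (hy : y ∈ W) (hy0 : y ≠ 0)
    (hspan : y ∈ Submodule.span ℂ (Set.range fun j : ℕ => (e ^ j) x)) : x ∈ W := by
  obtain ⟨c, rfl⟩ := Finsupp.mem_span_range_iff_exists_finsupp.1 hspan
  classical
  have hz : ∀ j, l < j → (e ^ j) x = 0 := fun j hj => by
    obtain ⟨d, rfl⟩ := Nat.exists_eq_add_of_le' (Nat.succ_le_of_lt hj)
    rw [pow_add, Module.End.mul_apply, Nat.succ_eq_add_one, hl, map_zero]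
  have hex : ∃ j, (c j) • (e ^ j) x ≠ 0 := by
    by_contra! hall
    exact hy0 (Finset.sum_eq_zero fun j _ => hall j)
  have hbd : ∀ j, (c j) • (e ^ j) x ≠ 0 → j ≤ l := fun j hj => by
    by_contra hlt
    exact hj (by rw [hz j (by omega), smul_zero])
  -- The index of the highest nonzero term: f ^ J kills the lower terms, the higher ones are zero,
  -- and the term of index `J` becomes a nonzero multiple of `x`.
  let J := Nat.findGreatest (fun j => (c j) • (e ^ j) x ≠ 0) l
  have hJ : (c J) • (e ^ J) x ≠ 0 := by
    obtain ⟨j, hj⟩ := hex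
    exact Nat.findGreatest_spec (P := fun j => (c j) • (e ^ j) x ≠ 0) (hbd j hj) hj
  have hJmax : ∀ j, J < j → (c j) • (e ^ j) x = 0 := fun j hj => by
    by_contra hne
    exact Nat.findGreatest_is_greatest hj (hbd j hne) hne
  have hJl : J ≤ l := Nat.findGreatest_le l
  have hcJ : c J ≠ 0 := fun h => hJ (by rw [h, zero_smul])
  have hmem : (f ^ J) (c.sum fun i a => a • (e ^ i) x) ∈ W := by
    induction J with
    | zero => simpa using hy
    | succ j ih => rw [pow_succ', Module.End.mul_apply]; exact hW _ ih
  obtain ⟨d, hd, hdx⟩ := H.f_pow_e_pow hx hf J (fun i hi => by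
    have : (i : ℂ) ≠ l := by exact_mod_cast (by omega : i ≠ l)
    rw [neg_add_eq_sub]; exact sub_ne_zero.2 this)
  have : (f ^ J) (c.sum fun i a => a • (e ^ i) x) = (c J * d) • x := by
    rw [Finsupp.sum, map_sum, Finset.sum_eq_single J]
    · rw [map_smul, hdx, smul_smul]
    · intro j _ hj
      rcases lt_or_gt_of_ne hj with h | h
      · rw [map_smul, H.f_pow_e_pow_eq_zero hx hf h, smul_zero]
      · rw [hJmax j h, map_zero]
    · intro hn
      exact absurd (Finsupp.notMem_support_iff.1 hn) hcJ
  rw [this] at hmem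
  exact (W.smul_mem_iff (mul_ne_zero hcJ hd)).1 hmem

omit H in
/-- The Casimir element. -/
def casimir (e h f : Module.End ℂ M) : Module.End ℂ M := h * h - (2 : ℂ) • h + (4 : ℂ) • (e * f)

theorem casimir_e (x : M) : casimir e h f (e x) = e (casimir e h f x) := by
  have h1 : f (e x) = e (f x) - h x := by rw [H.ef]; abel
  simp only [casimir, LinearMap.add_apply, LinearMap.sub_apply, LinearMap.smul_apply,
    Module.End.mul_apply, h1, H.he, map_add, map_sub, map_smul]
  module

theorem casimir_f (x : M) : casimir e h f (f x) = f (casimir e h f x) := by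
  simp only [casimir, LinearMap.add_apply, LinearMap.sub_apply, LinearMap.smul_apply,
    Module.End.mul_apply, H.ef, H.hf, map_add, map_sub, map_smul]
  module

theorem casimir_h (x : M) : casimir e h f (h x) = h (casimir e h f x) := by
  have h1 : f (h x) = h (f x) + (2 : ℂ) • f x := by rw [H.hf]; abel
  simp only [casimir, LinearMap.add_apply, LinearMap.sub_apply, LinearMap.smul_apply,
    Module.End.mul_apply, h1, H.he, map_add, map_sub, map_smul]

omit H in
theorem casimir_lowest {x : M} {μ : ℂ} (hx : h x = μ • x) (hf : f x = 0) :
    casimir e h f x = (μ * (μ - 2)) • x := by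
  simp only [casimir, LinearMap.add_apply, LinearMap.sub_apply, LinearMap.smul_apply,
    Module.End.mul_apply, hx, hf, map_zero, map_smul]
  module

theorem casimir_highest {x : M} {μ : ℂ} (hx : h x = μ • x) (he : e x = 0) :
    casimir e h f x = (μ * (μ + 2)) • x := by
  have h1 : e (f x) = μ • x := by rw [H.ef, he, map_zero, zero_add, hx]
  simp only [casimir, LinearMap.add_apply, LinearMap.sub_apply, LinearMap.smul_apply,
    Module.End.mul_apply, hx, h1, map_smul]
  module

/-- If `f ^ k x = 0` for a weight vector `x`, then a product of `k` shifted Casimir elements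
kills `x`. -/
theorem prod_casimir_eq_zero (k : ℕ) {x : M} {μ : ℂ} (hx : h x = μ • x) (hk : (f ^ k) x = 0) :
    Polynomial.aeval (casimir e h f) (∏ i ∈ Finset.range k, (Polynomial.X -
      Polynomial.C ((μ - 2 * i) * (μ - 2 * i - 2)))) x = 0 := by
  induction k generalizing x with
  | zero => simpa using hk
  | succ k ih =>
    -- The vector f ^ k x is a lowest weight vector of weight μ - 2k. The last factor of the product
    -- therefore kills it, and so moves `x` into the kernel of f ^ k.
    rw [Finset.prod_range_succ, map_mul, Module.End.mul_apply]
    set C := casimir e h f with hC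
    have e1 : Polynomial.aeval C (Polynomial.X -
        Polynomial.C ((μ - 2 * k) * (μ - 2 * k - 2))) x =
        C x - ((μ - 2 * k) * (μ - 2 * k - 2)) • x := by
      rw [map_sub, Polynomial.aeval_X, Polynomial.aeval_C, LinearMap.sub_apply,
        Module.algebraMap_end_apply]
    rw [e1]
    refine ih ?_ ?_
    · rw [map_sub, ← H.casimir_h, hx, map_smul, map_smul, hx]
      simp only [← hC]; module
    · have h2 : ∀ j, (f ^ j) (C x) = C ((f ^ j) x) := by
        intro j
        induction j with
        | zero => rfl
        | succ j ihj => rw [pow_succ', Module.End.mul_apply, Module.End.mul_apply, ihj, H.casimir_f]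
      rw [map_sub, h2, map_smul, casimir_lowest (H.h_f_pow hx k)
        (by rw [← Module.End.mul_apply, ← pow_succ', hk]), sub_self]

/-- `f ^ p` is injective on the weight space of weight `p` if `e` is nilpotent there. -/
theorem f_pow_injective {p : ℕ} {x : M} (hx : h x = (p : ℂ) • x) {N : ℕ}
    (hN : (e ^ N) x = 0) (hp : (f ^ p) x = 0) : x = 0 := by
  by_contra h0
  classical
  have hex : ∃ N, (e ^ N) x = 0 := ⟨N, hN⟩
  obtain ⟨m, hm⟩ : ∃ m, Nat.find hex = m + 1 := by
    refine Nat.exists_eq_succ_of_ne_zero fun h => h0 ?_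
    simpa [h] using Nat.find_spec hex
  have h1 : (e ^ (m + 1)) x = 0 := hm ▸ Nat.find_spec hex
  have h2 : (e ^ m) x ≠ 0 := Nat.find_min hex (by omega)
  have h3 := H.prod_casimir_eq_zero p hx hp
  set C := casimir e h f with hC
  have hcomm : Commute (e ^ m) C := Commute.pow_left (LinearMap.ext fun y => (H.casimir_e y).symm) m
  set q : Polynomial ℂ := ∏ i ∈ Finset.range p, (Polynomial.X -
      Polynomial.C (((p : ℂ) - 2 * i) * (p - 2 * i - 2))) with hq
  have h4 : Polynomial.aeval C q ((e ^ m) x) = 0 := by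
    have : Commute (e ^ m) (Polynomial.aeval C q) := by
      induction q using Polynomial.induction_on' with
      | add a b ha hb => rw [map_add]; exact ha.add_right hb
      | monomial n a =>
        rw [Polynomial.aeval_monomial]
        exact Commute.mul_right (Algebra.commutes a (e ^ m)).symm (hcomm.pow_right n)
    have h := LinearMap.congr_fun this.eq x
    rw [Module.End.mul_apply, Module.End.mul_apply, h3, map_zero] at h
    exact h.symm
  rw [aeval_eigen C q (H.casimir_highest (H.h_e_pow hx m)
    (by rw [← Module.End.mul_apply, ← pow_succ', h1])), smul_eq_zero_iff_left h2, hq,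
    Polynomial.eval_prod, Finset.prod_eq_zero_iff] at h4
  obtain ⟨i, hi, h4⟩ := h4
  rw [Polynomial.eval_sub, Polynomial.eval_X, Polynomial.eval_C] at h4
  -- The highest weight vector e ^ m x has weight p + 2m, and its Casimir eigenvalue must be a root
  -- of `q`. After adding 1, both eigenvalues are squares, of p + 2m + 1 and of p - 2i - 1; for i <
  -- p these cannot agree up to sign.
  have h6 : ((p + 2 * m + 1 : ℤ) : ℂ) ^ 2 = ((p - 2 * i - 1 : ℤ) : ℂ) ^ 2 := by
    push_cast
    linear_combination h4
  have h7 : (p + 2 * m + 1 : ℤ) ^ 2 = (p - 2 * i - 1 : ℤ) ^ 2 := by exact_mod_cast h6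
  have := Finset.mem_range.1 hi
  rcases sq_eq_sq_iff_eq_or_eq_neg.1 h7 with h | h <;> omega

/-- In a subspace on whose weight vectors `e` and `f` are nilpotent, the weight vectors are
combinations of the `e ^ j u`, for lowest weight vectors `u`. -/
theorem mem_span_of_nilpotent {K : Submodule ℂ M} (hKe : ∀ x ∈ K, e x ∈ K)
    (hKf : ∀ x ∈ K, f x ∈ K) (hn : ∀ x ∈ K, ∀ μ : ℂ, h x = μ • x → ∃ N, (e ^ N) x = 0)
    (k : ℕ) {x : M} {μ : ℂ} (hxK : x ∈ K) (hx : h x = μ • x) (hk : (f ^ k) x = 0) :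
    x ∈ Submodule.span ℂ {y | ∃ u ∈ K, ∃ j : ℕ, ∃ ν : ℂ, h u = ν • u ∧ f u = 0 ∧
      y = (e ^ j) u} := by
  have hKf' : ∀ j, ∀ x ∈ K, (f ^ j) x ∈ K := fun j x hx => by
    induction j with
    | zero => exact hx
    | succ j ih => rw [pow_succ', Module.End.mul_apply]; exact hKf _ ih
  have hKe' : ∀ j, ∀ x ∈ K, (e ^ j) x ∈ K := fun j x hx => by
    induction j with
    | zero => exact hx
    | succ j ih => rw [pow_succ', Module.End.mul_apply]; exact hKe _ ih
  induction k generalizing x with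
  | zero =>
    have : x = 0 := hk
    rw [this]; exact zero_mem _
  | succ k ih =>
    set w := (f ^ k) x with hw
    have hwK : w ∈ K := hKf' k x hxK
    have hwh : h w = (μ - 2 * k) • w := H.h_f_pow hx k
    have hwf : f w = 0 := by rw [hw, ← Module.End.mul_apply, ← pow_succ', hk]
    by_cases hw0 : w = 0
    · exact ih hxK hx hw0
    obtain ⟨N, hN⟩ := hn w hwK _ hwh
    obtain ⟨l, hl, -, -⟩ := H.exists_nat hwh hwf hw0 hN
    -- If k = l + d + 1, then f ^ d x has weight l + 2 and is killed by f ^ (l + 2). By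
    -- `f_pow_injective` it vanishes, and then so does `w`.
    have hkl : k ≤ l := by
      by_contra hlt
      obtain ⟨d, rfl⟩ := Nat.exists_eq_add_of_lt (not_le.1 hlt)
      have hz : h ((f ^ d) x) = ((l + 2 : ℕ) : ℂ) • (f ^ d) x := by
        rw [H.h_f_pow hx d]
        congr 1
        push_cast at hl ⊢
        linear_combination hl
      obtain ⟨N', hN'⟩ := hn _ (hKf' d x hxK) _ hz
      have := H.f_pow_injective hz hN' (by
        rw [← Module.End.mul_apply, ← pow_add, show l + 2 + d = l + d + 1 + 1 by omega, hk])
      apply hw0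
      rw [hw, show l + d + 1 = (l + 1) + d by omega, pow_add, Module.End.mul_apply, this, map_zero]
    obtain ⟨c, hc, hcw⟩ := H.f_pow_e_pow hwh hwf k (fun i hi => by
      have : (i : ℂ) ≠ l := by exact_mod_cast (by omega : i ≠ l)
      rw [hl, neg_add_eq_sub]; exact sub_ne_zero.2 this)
    -- Since k ≤ l, f ^ k e ^ k w is a nonzero multiple of w = f ^ k x. Subtracting the right
    -- multiple of e ^ k w leaves a vector killed by f ^ k, to which the induction applies.
    have key : x - c⁻¹ • (e ^ k) w ∈ Submodule.span ℂ {y | ∃ u ∈ K, ∃ j : ℕ, ∃ ν : ℂ,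
        h u = ν • u ∧ f u = 0 ∧ y = (e ^ j) u} := by
      refine ih (sub_mem hxK (K.smul_mem _ (hKe' k w hwK))) ?_ ?_
      · rw [map_sub, map_smul, H.h_e_pow hwh, hx, smul_sub, smul_comm c⁻¹]
        congr 2
        ring
      · rw [map_sub, map_smul, hcw, smul_smul, inv_mul_cancel₀ hc, one_smul, ← hw, sub_self]
    have := add_mem key (Submodule.smul_mem _ c⁻¹ (Submodule.subset_span
      ⟨w, hwK, k, _, hwh, hwf, rfl⟩))
    rwa [sub_add_cancel] at this

end IsSl2Rep

end Sl2Rep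

/-! ### The enveloping algebra acting on Lie modules. -/

section Enveloping

attribute [local instance 100] LieRing.ofAssociativeRing

/-- The enveloping algebra is generated by the Lie algebra. -/
theorem uea_induction {L : Type*} [LieRing L] [LieAlgebra ℂ L]
    (B : Subalgebra ℂ (UniversalEnvelopingAlgebra ℂ L))
    (hB : ∀ z, UniversalEnvelopingAlgebra.ι ℂ z ∈ B) (a : UniversalEnvelopingAlgebra ℂ L) :
    a ∈ B := by
  let f : L →ₗ⁅ℂ⁆ B :=
    { toFun := fun z => ⟨UniversalEnvelopingAlgebra.ι ℂ z, hB z⟩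
      map_add' := fun z w => Subtype.ext (map_add _ z w)
      map_smul' := fun c z => Subtype.ext (map_smul _ c z)
      map_lie' := fun {z w} => Subtype.ext (LieHom.map_lie _ z w) }
  have hid : B.val.comp (UniversalEnvelopingAlgebra.lift ℂ f) = AlgHom.id ℂ _ := by
    ext z
    change ((UniversalEnvelopingAlgebra.lift ℂ f (UniversalEnvelopingAlgebra.ι ℂ z) : B) :
      UniversalEnvelopingAlgebra ℂ L) = UniversalEnvelopingAlgebra.ι ℂ z
    rw [UniversalEnvelopingAlgebra.lift_ι_apply]
    rfl
  have h2 : ((UniversalEnvelopingAlgebra.lift ℂ f a : B) : UniversalEnvelopingAlgebra ℂ L) = a :=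
    DFunLike.congr_fun hid a
  exact h2 ▸ (UniversalEnvelopingAlgebra.lift ℂ f a).2

variable {L : Type*} [LieRing L] [LieAlgebra ℂ L] {M : Type*} [AddCommGroup M] [Module ℂ M]
  [LieRingModule L M] [LieModule ℂ L M]

@[simp] theorem envAction_ι (z : L) (m : M) :
    envAction L M (UniversalEnvelopingAlgebra.ι ℂ z) m = ⁅z, m⁆ := by
  rw [envAction, UniversalEnvelopingAlgebra.lift_ι_apply, LieModule.toEnd_apply_apply]

theorem envAction_mem (W : Submodule ℂ M) (hW : ∀ (z : L), ∀ m ∈ W, ⁅z, m⁆ ∈ W)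
    (a : UniversalEnvelopingAlgebra ℂ L) {m : M} (hm : m ∈ W) : envAction L M a m ∈ W := by
  let B : Subalgebra ℂ (UniversalEnvelopingAlgebra ℂ L) :=
    { carrier := {a | ∀ m ∈ W, envAction L M a m ∈ W}
      mul_mem' := fun {a b} ha hb m hm => by
        rw [map_mul, Module.End.mul_apply]; exact ha _ (hb _ hm)
      add_mem' := fun {a b} ha hb m hm => by
        rw [map_add, LinearMap.add_apply]; exact add_mem (ha _ hm) (hb _ hm)
      algebraMap_mem' := fun c m hm => by
        rw [AlgHom.commutes, Module.algebraMap_end_apply]; exact W.smul_mem _ hm }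
  exact uea_induction B (fun z m hm => by rw [envAction_ι]; exact hW z m hm) a m hm

theorem envAction_map {M' : Type*} [AddCommGroup M'] [Module ℂ M'] [LieRingModule L M']
    [LieModule ℂ L M'] (φ : M →ₗ⁅ℂ, L⁆ M') (a : UniversalEnvelopingAlgebra ℂ L) (m : M) :
    φ (envAction L M a m) = envAction L M' a (φ m) := by
  let B : Subalgebra ℂ (UniversalEnvelopingAlgebra ℂ L) :=
    { carrier := {a | ∀ m, φ (envAction L M a m) = envAction L M' a (φ m)}
      mul_mem' := fun {a b} ha hb m => by
        rw [map_mul, Module.End.mul_apply, ha, hb, map_mul, Module.End.mul_apply]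
      add_mem' := fun {a b} ha hb m => by
        rw [map_add, LinearMap.add_apply, map_add, ha, hb, map_add, LinearMap.add_apply]
      algebraMap_mem' := fun c m => by
        rw [AlgHom.commutes, AlgHom.commutes, Module.algebraMap_end_apply,
          Module.algebraMap_end_apply, map_smul] }
  exact uea_induction B (fun z m => by rw [envAction_ι, envAction_ι, LieModuleHom.map_lie]) a m

end Enveloping

/-! ### Generators and relations of the Takiff sl₂, and two central operators. -/

section Generators

attribute [local instance 100] LieRing.ofAssociativeRing

/-- The element `h` of the Takiff `sl₂`. -/
noncomputable def Th : TT := ⟨sl2h, 0⟩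

theorem sl2.mat_one_one (a : sl2) : a.mat 1 1 = -a.mat 0 0 := by
  have := a.trace_mat
  rw [Matrix.trace_fin_two] at this
  exact eq_neg_of_add_eq_zero_right this

theorem sl2.eq_of_entries {a b : sl2} (h00 : a.mat 0 0 = b.mat 0 0) (h01 : a.mat 0 1 = b.mat 0 1)
    (h10 : a.mat 1 0 = b.mat 1 0) : a = b := by
  apply sl2.ext
  ext i j
  fin_cases i <;> fin_cases j
  · exact h00
  · exact h01
  · exact h10
  · change a.mat 1 1 = b.mat 1 1
    rw [sl2.mat_one_one, sl2.mat_one_one, h00]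

@[simp] theorem sl2.mat_neg (a : sl2) : (-a).mat = -a.mat := rfl
@[simp] theorem TT_lev_neg (z : TT) : (-z).lev = -z.lev := rfl
@[simp] theorem TT_bar_neg (z : TT) : (-z).bar = -z.bar := rfl

@[simp] theorem sl2e_mat : sl2e.mat = !![0, 1; 0, 0] := rfl
@[simp] theorem sl2h_mat : sl2h.mat = !![1, 0; 0, -1] := rfl
@[simp] theorem sl2f_mat : sl2f.mat = !![0, 0; 1, 0] := rfl

theorem sl2_decomp (a : sl2) : a = a.mat 0 1 • sl2e + a.mat 0 0 • sl2h + a.mat 1 0 • sl2f := by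
  apply sl2.eq_of_entries <;> simp

theorem TT_decomp (z : TT) : z = z.lev.mat 0 1 • Te + z.lev.mat 0 0 • Th + z.lev.mat 1 0 • Tf +
    z.bar.mat 0 1 • Teb + z.bar.mat 0 0 • Thb + z.bar.mat 1 0 • Tfb := by
  apply Takiff.ext <;> apply sl2.eq_of_entries <;> simp [Te, Th, Tf, Teb, Thb, Tfb]

theorem sl2_lie_e_f : ⁅sl2e, sl2f⁆ = sl2h := by
  apply sl2.eq_of_entries <;> simp
theorem sl2_lie_h_e : ⁅sl2h, sl2e⁆ = (2 : ℂ) • sl2e := by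
  apply sl2.eq_of_entries <;> norm_num
theorem sl2_lie_e_h : ⁅sl2e, sl2h⁆ = (-2 : ℂ) • sl2e := by
  apply sl2.eq_of_entries <;> norm_num
theorem sl2_lie_f_e : ⁅sl2f, sl2e⁆ = -sl2h := by
  apply sl2.eq_of_entries <;> simp
theorem sl2_lie_h_f : ⁅sl2h, sl2f⁆ = -((2 : ℂ) • sl2f) := by
  rw [← neg_smul]
  apply sl2.eq_of_entries <;> norm_num

theorem Te_lie_Tf : ⁅Te, Tf⁆ = Th := by
  ext1 <;> simp [Te, Tf, Th, sl2_lie_e_f]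
theorem Th_lie_Te : ⁅Th, Te⁆ = (2 : ℂ) • Te := by
  ext1 <;> simp [Te, Th, sl2_lie_h_e]
theorem Th_lie_Tf : ⁅Th, Tf⁆ = (-2 : ℂ) • Tf := by
  ext1 <;> simp [Tf, Th, sl2_lie_h_f]
theorem Te_lie_Teb : ⁅Te, Teb⁆ = 0 := by
  ext1 <;> simp [Te, Teb]
theorem Te_lie_Thb : ⁅Te, Thb⁆ = (-2 : ℂ) • Teb := by
  ext1 <;> simp [Te, Teb, Thb, sl2_lie_e_h]
theorem Te_lie_Tfb : ⁅Te, Tfb⁆ = Thb := by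
  ext1 <;> simp [Te, Thb, Tfb, sl2_lie_e_f]
theorem Th_lie_Teb : ⁅Th, Teb⁆ = (2 : ℂ) • Teb := by
  ext1 <;> simp [Th, Teb, sl2_lie_h_e]
theorem Th_lie_Thb : ⁅Th, Thb⁆ = 0 := by
  ext1 <;> simp [Th, Thb]
theorem Th_lie_Tfb : ⁅Th, Tfb⁆ = (-2 : ℂ) • Tfb := by
  ext1 <;> simp [Th, Tfb, sl2_lie_h_f]
theorem Tf_lie_Teb : ⁅Tf, Teb⁆ = -Thb := by
  ext1 <;> simp [Tf, Teb, Thb, sl2_lie_f_e]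
theorem Tf_lie_Thb : ⁅Tf, Thb⁆ = (2 : ℂ) • Tfb := by
  ext1
  · simp [Tf, Tfb, Thb]
  · simp only [Tf, Tfb, Thb, Takiff.bar_lie, Takiff.bar_smul, lie_zero, add_zero]
    rw [← lie_skew, sl2_lie_h_f, neg_neg]
theorem Tf_lie_Tfb : ⁅Tf, Tfb⁆ = 0 := by
  ext1 <;> simp [Tf, Tfb]
theorem Teb_lie_Thb : ⁅Teb, Thb⁆ = 0 := by
  ext1 <;> simp [Teb, Thb]
theorem Teb_lie_Tfb : ⁅Teb, Tfb⁆ = 0 := by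
  ext1 <;> simp [Teb, Tfb]
theorem Thb_lie_Tfb : ⁅Thb, Tfb⁆ = 0 := by
  ext1 <;> simp [Thb, Tfb]

/-- The defining relations of the Takiff `sl₂` in an associative algebra. -/
structure IsTakiffRep {A : Type*} [Ring A] [Algebra ℂ A] (e h f eb hb fb : A) : Prop where
  ef : e * f = f * e + h
  he : h * e = e * h + (2 : ℂ) • e
  hf : h * f = f * h - (2 : ℂ) • f
  eeb : e * eb = eb * e
  ehb : e * hb = hb * e - (2 : ℂ) • eb
  efb : e * fb = fb * e + hb
  heb : h * eb = eb * h + (2 : ℂ) • eb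
  hhb : h * hb = hb * h
  hfb : h * fb = fb * h - (2 : ℂ) • fb
  feb : f * eb = eb * f - hb
  fhb : f * hb = hb * f + (2 : ℂ) • fb
  ffb : f * fb = fb * f
  ebhb : eb * hb = hb * eb
  ebfb : eb * fb = fb * eb
  hbfb : hb * fb = fb * hb

/-- The homomorphism from the Takiff `sl₂` given by six elements with the right relations. -/
noncomputable def IsTakiffRep.hom {A : Type*} [Ring A] [Algebra ℂ A] {e h f eb hb fb : A}
    (H : IsTakiffRep e h f eb hb fb) : TT →ₗ⁅ℂ⁆ A where
  toFun z := z.lev.mat 0 1 • e + z.lev.mat 0 0 • h + z.lev.mat 1 0 • f +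
    z.bar.mat 0 1 • eb + z.bar.mat 0 0 • hb + z.bar.mat 1 0 • fb
  map_add' z w := by
    simp only [Takiff.lev_add, Takiff.bar_add, sl2.mat_add, Matrix.add_apply]; module
  map_smul' c z := by
    simp only [Takiff.lev_smul, Takiff.bar_smul, sl2.mat_smul, Matrix.smul_apply, smul_eq_mul,
      RingHom.id_apply]
    module
  map_lie' {z w} := by
    simp only [LieRing.of_associative_ring_bracket, Takiff.lev_lie, Takiff.bar_lie, sl2.mat_lie,
      sl2.mat_add, Matrix.add_apply, Matrix.sub_apply, Matrix.mul_apply, Fin.sum_univ_two,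
      sl2.mat_one_one, add_mul, mul_add, smul_mul_assoc, mul_smul_comm, smul_add, H.ef, H.he, H.hf,
      H.eeb, H.ehb, H.efb, H.heb, H.hhb, H.hfb, H.feb, H.fhb, H.ffb, H.ebhb, H.ebfb, H.hbfb]
    module

section
variable {A : Type*} [Ring A] [Algebra ℂ A] {e h f eb hb fb : A}
    (H : IsTakiffRep e h f eb hb fb)
@[simp] theorem IsTakiffRep.hom_Te : H.hom Te = e := by simp [IsTakiffRep.hom, Te]
@[simp] theorem IsTakiffRep.hom_Th : H.hom Th = h := by simp [IsTakiffRep.hom, Th]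
@[simp] theorem IsTakiffRep.hom_Tf : H.hom Tf = f := by simp [IsTakiffRep.hom, Tf]
@[simp] theorem IsTakiffRep.hom_Teb : H.hom Teb = eb := by simp [IsTakiffRep.hom, Teb]
@[simp] theorem IsTakiffRep.hom_Thb : H.hom Thb = hb := by simp [IsTakiffRep.hom, Thb]
@[simp] theorem IsTakiffRep.hom_Tfb : H.hom Tfb = fb := by simp [IsTakiffRep.hom, Tfb]
end

section

variable {M : Type*} [AddCommGroup M] [LieRingModule TT M]

theorem lie_ef (x : M) : ⁅Te, ⁅Tf, x⁆⁆ = ⁅Tf, ⁅Te, x⁆⁆ + ⁅Th, x⁆ := by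
  rw [leibniz_lie, Te_lie_Tf, add_comm]
theorem lie_fe (x : M) : ⁅Tf, ⁅Te, x⁆⁆ = ⁅Te, ⁅Tf, x⁆⁆ - ⁅Th, x⁆ := by
  rw [lie_ef]; abel
theorem lie_ebe (x : M) : ⁅Teb, ⁅Te, x⁆⁆ = ⁅Te, ⁅Teb, x⁆⁆ := by
  rw [leibniz_lie Te, Te_lie_Teb, zero_lie, zero_add]
theorem lie_fbe (x : M) : ⁅Tfb, ⁅Te, x⁆⁆ = ⁅Te, ⁅Tfb, x⁆⁆ - ⁅Thb, x⁆ := by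
  rw [leibniz_lie Te, Te_lie_Tfb]; abel
theorem lie_hhb (x : M) : ⁅Th, ⁅Thb, x⁆⁆ = ⁅Thb, ⁅Th, x⁆⁆ := by
  rw [leibniz_lie, Th_lie_Thb, zero_lie, zero_add]
theorem lie_feb (x : M) : ⁅Tf, ⁅Teb, x⁆⁆ = ⁅Teb, ⁅Tf, x⁆⁆ - ⁅Thb, x⁆ := by
  rw [leibniz_lie, Tf_lie_Teb, neg_lie]; abel
theorem lie_ffb (x : M) : ⁅Tf, ⁅Tfb, x⁆⁆ = ⁅Tfb, ⁅Tf, x⁆⁆ := by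
  rw [leibniz_lie, Tf_lie_Tfb, zero_lie, zero_add]
theorem lie_ebhb (x : M) : ⁅Teb, ⁅Thb, x⁆⁆ = ⁅Thb, ⁅Teb, x⁆⁆ := by
  rw [leibniz_lie, Teb_lie_Thb, zero_lie, zero_add]
theorem lie_ebfb (x : M) : ⁅Teb, ⁅Tfb, x⁆⁆ = ⁅Tfb, ⁅Teb, x⁆⁆ := by
  rw [leibniz_lie, Teb_lie_Tfb, zero_lie, zero_add]
theorem lie_hbfb (x : M) : ⁅Thb, ⁅Tfb, x⁆⁆ = ⁅Tfb, ⁅Thb, x⁆⁆ := by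
  rw [leibniz_lie, Thb_lie_Tfb, zero_lie, zero_add]

end

variable {M : Type*} [AddCommGroup M] [Module ℂ M] [LieRingModule TT M] [LieModule ℂ TT M]

theorem lie_he (x : M) : ⁅Th, ⁅Te, x⁆⁆ = ⁅Te, ⁅Th, x⁆⁆ + (2 : ℂ) • ⁅Te, x⁆ := by
  rw [leibniz_lie, Th_lie_Te, smul_lie, add_comm]
theorem lie_hf (x : M) : ⁅Th, ⁅Tf, x⁆⁆ = ⁅Tf, ⁅Th, x⁆⁆ - (2 : ℂ) • ⁅Tf, x⁆ := by
  rw [leibniz_lie, Th_lie_Tf, smul_lie]; module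
theorem lie_hbe (x : M) : ⁅Thb, ⁅Te, x⁆⁆ = ⁅Te, ⁅Thb, x⁆⁆ + (2 : ℂ) • ⁅Teb, x⁆ := by
  rw [leibniz_lie Te, Te_lie_Thb, smul_lie]; module
theorem lie_heb (x : M) : ⁅Th, ⁅Teb, x⁆⁆ = ⁅Teb, ⁅Th, x⁆⁆ + (2 : ℂ) • ⁅Teb, x⁆ := by
  rw [leibniz_lie, Th_lie_Teb, smul_lie, add_comm]
theorem lie_hfb (x : M) : ⁅Th, ⁅Tfb, x⁆⁆ = ⁅Tfb, ⁅Th, x⁆⁆ - (2 : ℂ) • ⁅Tfb, x⁆ := by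
  rw [leibniz_lie, Th_lie_Tfb, smul_lie]; module
theorem lie_fhb (x : M) : ⁅Tf, ⁅Thb, x⁆⁆ = ⁅Thb, ⁅Tf, x⁆⁆ + (2 : ℂ) • ⁅Tfb, x⁆ := by
  rw [leibniz_lie, Tf_lie_Thb, smul_lie, add_comm]

theorem lie_decomp (z : TT) (x : M) : ⁅z, x⁆ = z.lev.mat 0 1 • ⁅Te, x⁆ + z.lev.mat 0 0 • ⁅Th, x⁆ +
    z.lev.mat 1 0 • ⁅Tf, x⁆ + z.bar.mat 0 1 • ⁅Teb, x⁆ + z.bar.mat 0 0 • ⁅Thb, x⁆ +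
    z.bar.mat 1 0 • ⁅Tfb, x⁆ := by
  conv_lhs => rw [TT_decomp z]
  simp only [add_lie, smul_lie]

theorem lie_mem_of_generators {W : Submodule ℂ M} {x : M} (he : ⁅Te, x⁆ ∈ W) (hh : ⁅Th, x⁆ ∈ W)
    (hf : ⁅Tf, x⁆ ∈ W) (heb : ⁅Teb, x⁆ ∈ W) (hhb : ⁅Thb, x⁆ ∈ W) (hfb : ⁅Tfb, x⁆ ∈ W) (z : TT) :
    ⁅z, x⁆ ∈ W := by
  rw [lie_decomp]
  exact add_mem (add_mem (add_mem (add_mem (add_mem (W.smul_mem _ he) (W.smul_mem _ hh))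
    (W.smul_mem _ hf)) (W.smul_mem _ heb)) (W.smul_mem _ hhb)) (W.smul_mem _ hfb)

variable (M) in
/-- The `sl₂`-action on a module over the Takiff `sl₂`. -/
theorem isSl2Rep_TT : IsSl2Rep (LieModule.toEnd ℂ TT M Te) (LieModule.toEnd ℂ TT M Th)
    (LieModule.toEnd ℂ TT M Tf) :=
  ⟨lie_ef, lie_he, lie_hf⟩

theorem sl2_lie_decomp {W : Type*} [AddCommGroup W] [Module ℂ W] [LieRingModule sl2 W]
    [LieModule ℂ sl2 W] (z : sl2) (x : W) :
    ⁅z, x⁆ = z.mat 0 1 • ⁅sl2e, x⁆ + z.mat 0 0 • ⁅sl2h, x⁆ + z.mat 1 0 • ⁅sl2f, x⁆ := by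
  conv_lhs => rw [sl2_decomp z]
  simp only [add_lie, smul_lie]

/-- The `sl₂`-action on an `sl₂`-module. -/
theorem isSl2Rep_sl2 (W : Type*) [AddCommGroup W] [Module ℂ W] [LieRingModule sl2 W]
    [LieModule ℂ sl2 W] : IsSl2Rep (LieModule.toEnd ℂ sl2 W sl2e) (LieModule.toEnd ℂ sl2 W sl2h)
    (LieModule.toEnd ℂ sl2 W sl2f) where
  ef x := by
    simp only [LieModule.toEnd_apply_apply]
    rw [leibniz_lie, sl2_lie_e_f, add_comm]
  he x := by
    simp only [LieModule.toEnd_apply_apply]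
    rw [leibniz_lie, sl2_lie_h_e, smul_lie, add_comm]
  hf x := by
    simp only [LieModule.toEnd_apply_apply]
    rw [leibniz_lie, sl2_lie_h_f, neg_lie, smul_lie]; abel

variable (M) in
/-- The operator `h̄² + 4 f̄ ē`. -/
noncomputable def opC : Module.End ℂ M :=
  LieModule.toEnd ℂ TT M Thb * LieModule.toEnd ℂ TT M Thb +
    (4 : ℂ) • (LieModule.toEnd ℂ TT M Tfb * LieModule.toEnd ℂ TT M Teb)

variable (M) in
/-- The operator `h h̄ + 2 e f̄ + 2 f ē`. -/
noncomputable def opD : Module.End ℂ M :=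
  LieModule.toEnd ℂ TT M Th * LieModule.toEnd ℂ TT M Thb +
    (2 : ℂ) • (LieModule.toEnd ℂ TT M Te * LieModule.toEnd ℂ TT M Tfb) +
    (2 : ℂ) • (LieModule.toEnd ℂ TT M Tf * LieModule.toEnd ℂ TT M Teb)

theorem opC_apply (x : M) : opC M x = ⁅Thb, ⁅Thb, x⁆⁆ + (4 : ℂ) • ⁅Tfb, ⁅Teb, x⁆⁆ := rfl

theorem opD_apply (x : M) :
    opD M x = ⁅Th, ⁅Thb, x⁆⁆ + (2 : ℂ) • ⁅Te, ⁅Tfb, x⁆⁆ + (2 : ℂ) • ⁅Tf, ⁅Teb, x⁆⁆ := rfl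

theorem envAction_Cbar (x : M) : envAction TT M Cbar x = opC M x := by
  have h4 : (4 : UniversalEnvelopingAlgebra ℂ TT) =
      algebraMap ℂ (UniversalEnvelopingAlgebra ℂ TT) 4 := (map_ofNat _ 4).symm
  rw [Cbar, h4, map_add, map_pow, map_mul, map_mul, AlgHom.commutes, LinearMap.add_apply, pow_two,
    Module.End.mul_apply, Module.End.mul_apply, Module.End.mul_apply, Module.algebraMap_end_apply]
  simp only [envAction_ι, opC_apply]

theorem cbarActsBy_iff {χ : ℂ} : CbarActsBy M χ ↔ ∀ x : M, opC M x = χ • x := by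
  exact forall_congr' fun x => by rw [envAction_Cbar]

/-- C̄ is the Casimir form evaluated on the barred elements, hence invariant under sl₂; it commutes
with ḡ because ḡ is abelian. -/
theorem opC_lie (z : TT) (x : M) : opC M ⁅z, x⁆ = ⁅z, opC M x⁆ := by
  rw [lie_decomp z, lie_decomp z]
  simp only [map_add, map_smul]
  congr 1; congr 1; congr 1; congr 1; congr 1
  all_goals congr 1
  -- One goal for each of the six generators. The bracket relations bring both sides to a common
  -- order of the operators.
  all_goals simp only [opC_apply, lie_add, lie_sub, lie_smul, lie_ebe, lie_hbe, lie_fbe,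
    lie_heb, lie_hhb, lie_hfb, lie_feb, lie_fhb, lie_ffb, lie_ebhb, lie_ebfb, lie_hbfb]
  all_goals module

/-- Half the polarization of the Casimir h² + 2ef + 2fe, with one barred factor in each term; 2 e f̄
+ 2 f ē is e f̄ + f̄ e + f ē + ē f because the two corrections ±h̄ cancel. -/
theorem opD_lie (z : TT) (x : M) : opD M ⁅z, x⁆ = ⁅z, opD M x⁆ := by
  rw [lie_decomp z, lie_decomp z]
  simp only [map_add, map_smul]
  congr 1; congr 1; congr 1; congr 1; congr 1
  all_goals congr 1
  all_goals simp only [opD_apply, lie_add, lie_sub, lie_smul, lie_fe, lie_ebe, lie_hbe, lie_fbe,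
    lie_he, lie_hf, lie_heb, lie_hhb, lie_hfb, lie_feb, lie_fhb, lie_ffb, lie_ebhb, lie_ebfb,
    lie_hbfb]
  all_goals module

theorem opC_map {M' : Type*} [AddCommGroup M'] [Module ℂ M'] [LieRingModule TT M']
    [LieModule ℂ TT M'] (φ : M →ₗ⁅ℂ, TT⁆ M') (x : M) : φ (opC M x) = opC M' (φ x) := by
  simp only [opC_apply, map_add, map_smul, LieModuleHom.map_lie]

theorem opD_map {M' : Type*} [AddCommGroup M'] [Module ℂ M'] [LieRingModule TT M']
    [LieModule ℂ TT M'] (φ : M →ₗ⁅ℂ, TT⁆ M') (x : M) : φ (opD M x) = opD M' (φ x) := by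
  simp only [opD_apply, map_add, map_smul, LieModuleHom.map_lie]

/-- A central operator with an eigenvector acts on a simple module by a scalar. -/
theorem eq_smul_of_isIrreducible [LieModule.IsIrreducible ℂ TT M] {T : Module.End ℂ M}
    (hT : ∀ (z : TT) (x : M), T ⁅z, x⁆ = ⁅z, T x⁆) {c : ℂ} {x : M} (hx : x ≠ 0)
    (hTx : T x = c • x) (y : M) : T y = c • y := by
  let W : LieSubmodule ℂ TT M :=
    { Module.End.eigenspace T c with
      lie_mem := fun {z m} hm => by
        have hm : m ∈ Module.End.eigenspace T c := hm
        change _ ∈ Module.End.eigenspace T c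
        rw [Module.End.mem_eigenspace_iff] at hm ⊢
        rw [hT, hm, lie_smul] }
  have hW : W = ⊤ := (IsSimpleOrder.eq_bot_or_eq_top W).resolve_left fun h => hx <| by
    have : x ∈ W := Module.End.mem_eigenspace_iff.2 hTx
    rwa [h, LieSubmodule.mem_bot] at this
  have : y ∈ W := hW ▸ LieSubmodule.mem_top y
  exact Module.End.mem_eigenspace_iff.1 this

end Generators

section LieModules

/-- A bijective homomorphism of Lie modules as an isomorphism. -/
noncomputable def lieEquivOfBijective {L : Type*} [LieRing L] [LieAlgebra ℂ L]
    {M M' : Type*} [AddCommGroup M] [Module ℂ M]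
    [LieRingModule L M] [LieModule ℂ L M] [AddCommGroup M'] [Module ℂ M'] [LieRingModule L M']
    [LieModule ℂ L M'] (φ : M →ₗ⁅ℂ, L⁆ M') (hφ : Function.Bijective φ) : M ≃ₗ⁅ℂ, L⁆ M' :=
  { LinearEquiv.ofBijective (φ : M →ₗ[ℂ] M') hφ with
    map_lie' := fun {z m} => φ.map_lie z m }

end LieModules

/-! ### The submodule generated by a minimal vector. -/

section Uniqueness

variable {M : Type*} [AddCommGroup M] [Module ℂ M] [LieRingModule TT M] [LieModule ℂ TT M]

/-- A lowest weight vector of a minimal `sl₂`-type `L(m)`: the last relation says that the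
component of type `L(m - 2)` of `ḡ ⊗ L(m)` acts by zero. -/
structure IsMinimalVector (m : ℕ) (lam : ℂ) (u : M) : Prop where
  lie_f : ⁅Tf, u⁆ = 0
  lie_h : ⁅Th, u⁆ = (-m : ℂ) • u
  opC_eq : ∀ x : M, opC M x = lam ^ 2 • x
  opD_eq : ∀ x : M, opD M x = (m * lam) • x
  lie_eb : ((m + 1) * (m + 2) : ℂ) • ⁅Teb, u⁆ + ⁅Te, ⁅Te, ⁅Tfb, u⁆⁆⁆ =
    ((m + 1) * lam : ℂ) • ⁅Te, u⁆

/-- The vectors `f̄ ^ k u`. -/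
noncomputable def fbPow (u : M) (k : ℕ) : M := (LieModule.toEnd ℂ TT M Tfb ^ k) u

theorem fbPow_zero (u : M) : fbPow u 0 = u := rfl

theorem fbPow_succ (u : M) (k : ℕ) : fbPow u (k + 1) = ⁅Tfb, fbPow u k⁆ := by
  rw [fbPow, pow_succ', Module.End.mul_apply]; rfl

theorem lie_f_fbPow {u : M} (hu : ⁅Tf, u⁆ = 0) (k : ℕ) : ⁅Tf, fbPow u k⁆ = 0 := by
  induction k with
  | zero => exact hu
  | succ k ih => rw [fbPow_succ, lie_ffb, ih, lie_zero]

theorem lie_h_fbPow {u : M} {μ : ℂ} (hu : ⁅Th, u⁆ = μ • u) (k : ℕ) :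
    ⁅Th, fbPow u k⁆ = (μ - 2 * k) • fbPow u k := by
  induction k with
  | zero => simp [fbPow_zero, hu]
  | succ k ih => rw [fbPow_succ, lie_hfb, ih, lie_smul]; push_cast; module

/-- The vectors `e ^ j u`. -/
noncomputable def ePow (u : M) (j : ℕ) : M := (LieModule.toEnd ℂ TT M Te ^ j) u

theorem ePow_zero (u : M) : ePow u 0 = u := rfl

theorem ePow_succ (u : M) (j : ℕ) : ePow u (j + 1) = ⁅Te, ePow u j⁆ := by
  rw [ePow, pow_succ', Module.End.mul_apply]; rfl

/-- The span of the vectors `e ^ j f̄ ^ k u`. -/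
noncomputable def efbSpan (u : M) : Submodule ℂ M :=
  Submodule.span ℂ (Set.range fun p : ℕ × ℕ => ePow (fbPow u p.2) p.1)

theorem ePow_fbPow_mem (u : M) (j k : ℕ) : ePow (fbPow u k) j ∈ efbSpan u :=
  Submodule.subset_span ⟨(j, k), rfl⟩

theorem fbPow_mem (u : M) (k : ℕ) : fbPow u k ∈ efbSpan u := ePow_fbPow_mem u 0 k

theorem lie_mem_efbSpan {u : M} {z : TT} (hz : ∀ j k, ⁅z, ePow (fbPow u k) j⁆ ∈ efbSpan u)
    {x : M} (hx : x ∈ efbSpan u) : ⁅z, x⁆ ∈ efbSpan u := by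
  have : efbSpan u ≤ (efbSpan u).comap (LieModule.toEnd ℂ TT M z) := by
    rw [efbSpan, Submodule.span_le]
    rintro _ ⟨⟨j, k⟩, rfl⟩
    exact hz j k
  exact this hx

theorem lie_e_mem_efbSpan {u x : M} (hx : x ∈ efbSpan u) : ⁅Te, x⁆ ∈ efbSpan u :=
  lie_mem_efbSpan (fun j k => by rw [← ePow_succ]; exact ePow_fbPow_mem u (j + 1) k) hx

theorem lie_f_ePow {u : M} {μ : ℂ} (hf : ⁅Tf, u⁆ = 0) (hu : ⁅Th, u⁆ = μ • u) (j : ℕ) :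
    ⁅Tf, ePow u (j + 1)⁆ = (-((j + 1) * (μ + j)) : ℂ) • ePow u j :=
  (isSl2Rep_TT M).f_e_pow hu hf j

theorem lie_h_ePow {u : M} {μ : ℂ} (hu : ⁅Th, u⁆ = μ • u) (j : ℕ) :
    ⁅Th, ePow u j⁆ = (μ + 2 * j) • ePow u j :=
  (isSl2Rep_TT M).h_e_pow hu j

/-- On a lowest weight vector, f ē x = -h̄ x, so the eigenvalue equation of D can be solved for h̄ x
unless μ = 2. -/
theorem smul_lie_hb_of_opD {x : M} {d μ : ℂ} (hf : ⁅Tf, x⁆ = 0) (hx : ⁅Th, x⁆ = μ • x)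
    (hD : opD M x = d • x) : (2 - μ) • ⁅Thb, x⁆ = (2 : ℂ) • ⁅Te, ⁅Tfb, x⁆⁆ - d • x := by
  rw [opD_apply, lie_hhb, hx, lie_feb, hf, lie_zero, lie_smul] at hD
  rw [← hD]; module

/-- Applying h̄ to the relation `hx` and substituting it in C̄ x = c x solves for ē f̄ x. Commuting
h̄ past e contributes the extra ē f̄ x that turns 2 - μ into 3 - μ. -/
theorem smul_lie_eb_of_opC {x : M} {c d μ : ℂ} (hC : opC M x = c • x)
    (hx : (2 - μ) • ⁅Thb, x⁆ = (2 : ℂ) • ⁅Te, ⁅Tfb, x⁆⁆ - d • x) :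
    (4 * (3 - μ)) • ⁅Teb, ⁅Tfb, x⁆⁆ =
      ((2 - μ) * c) • x - (2 : ℂ) • ⁅Te, ⁅Thb, ⁅Tfb, x⁆⁆⁆ + d • ⁅Thb, x⁆ := by
  have h1 := congrArg (fun y => ⁅Thb, y⁆) hx
  simp only [lie_smul, lie_sub, lie_hbe] at h1
  have h2 := congrArg (fun y => (2 - μ) • y) hC
  simp only [opC_apply, smul_add, h1, ← lie_ebfb] at h2
  linear_combination (norm := module) h2

namespace IsMinimalVector

variable {m : ℕ} {lam : ℂ} {u : M} (H : IsMinimalVector m lam u)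
include H

/-- Each f̄ ^ k u is again a lowest weight vector, of weight μ = -m - 2k, and the factor 2 - μ is a
positive integer. -/
theorem lie_hb_fbPow (k : ℕ) : ((m + 2 * k + 2 : ℕ) : ℂ) • ⁅Thb, fbPow u k⁆ =
    (2 : ℂ) • ⁅Te, fbPow u (k + 1)⁆ - (m * lam) • fbPow u k := by
  rw [fbPow_succ, ← smul_lie_hb_of_opD (lie_f_fbPow H.lie_f k) (lie_h_fbPow H.lie_h k)
    (H.opD_eq _)]
  congr 1; push_cast; ring

theorem lie_hb_fbPow_mem (k : ℕ) : ⁅Thb, fbPow u k⁆ ∈ efbSpan u := by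
  have h0 : ((m + 2 * k + 2 : ℕ) : ℂ) ≠ 0 := Nat.cast_ne_zero.2 (by omega)
  rw [← Submodule.smul_mem_iff _ h0, H.lie_hb_fbPow]
  exact sub_mem (Submodule.smul_mem _ _ (lie_e_mem_efbSpan (fbPow_mem u _)))
    (Submodule.smul_mem _ _ (fbPow_mem u _))

/-- For k = 0 this is the last relation of a minimal vector. For k + 1 the operators C̄ and D
determine ē f̄ (f̄ ^ k u), with the nonzero factor 4(m + 2k + 3). -/
theorem lie_eb_fbPow_mem (k : ℕ) : ⁅Teb, fbPow u k⁆ ∈ efbSpan u := by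
  cases k with
  | zero =>
    have h0 : ((m + 1) * (m + 2) : ℂ) ≠ 0 := mul_ne_zero
      (Nat.cast_add_one_ne_zero m) (by exact_mod_cast (by omega : m + 2 ≠ 0))
    rw [← Submodule.smul_mem_iff _ h0, fbPow_zero, eq_sub_of_add_eq H.lie_eb]
    refine sub_mem (Submodule.smul_mem _ _ (lie_e_mem_efbSpan (fbPow_mem u 0)))
      (lie_e_mem_efbSpan (lie_e_mem_efbSpan ?_))
    have := fbPow_mem u 1
    rwa [fbPow_succ] at this
  | succ k =>
    have h0 : (4 * (3 - (-m - 2 * k)) : ℂ) ≠ 0 := by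
      have : (4 * (3 - (-m - 2 * k)) : ℂ) = ((4 * (m + 2 * k + 3) : ℕ) : ℂ) := by push_cast; ring
      rw [this]; exact Nat.cast_ne_zero.2 (by omega)
    have h1 := smul_lie_hb_of_opD (lie_f_fbPow H.lie_f k) (lie_h_fbPow H.lie_h k) (H.opD_eq _)
    rw [← Submodule.smul_mem_iff _ h0, fbPow_succ, smul_lie_eb_of_opC (H.opC_eq _) h1]
    refine add_mem (sub_mem (Submodule.smul_mem _ _ (fbPow_mem u k))
      (Submodule.smul_mem _ _ (lie_e_mem_efbSpan ?_)))
      (Submodule.smul_mem _ _ (H.lie_hb_fbPow_mem k))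
    rw [← fbPow_succ]; exact H.lie_hb_fbPow_mem (k + 1)

/-- Moving ē, h̄ and f̄ past one e produces only barred elements acting on shorter powers, so all
three are treated in one induction. -/
theorem lie_bar_mem (j k : ℕ) : ⁅Teb, ePow (fbPow u k) j⁆ ∈ efbSpan u ∧
    ⁅Thb, ePow (fbPow u k) j⁆ ∈ efbSpan u ∧ ⁅Tfb, ePow (fbPow u k) j⁆ ∈ efbSpan u := by
  induction j with
  | zero =>
    refine ⟨H.lie_eb_fbPow_mem k, H.lie_hb_fbPow_mem k, ?_⟩
    rw [ePow_zero, ← fbPow_succ]; exact fbPow_mem u (k + 1)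
  | succ j ih =>
    rw [ePow_succ, lie_ebe, lie_hbe, lie_fbe]
    exact ⟨lie_e_mem_efbSpan ih.1, add_mem (lie_e_mem_efbSpan ih.2.1)
      (Submodule.smul_mem _ _ ih.1), sub_mem (lie_e_mem_efbSpan ih.2.2) ih.2.1⟩

theorem lie_mem (z : TT) {x : M} (hx : x ∈ efbSpan u) : ⁅z, x⁆ ∈ efbSpan u := by
  refine lie_mem_of_generators (lie_e_mem_efbSpan hx) ?_ ?_
    (lie_mem_efbSpan (fun j k => (H.lie_bar_mem j k).1) hx)
    (lie_mem_efbSpan (fun j k => (H.lie_bar_mem j k).2.1) hx)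
    (lie_mem_efbSpan (fun j k => (H.lie_bar_mem j k).2.2) hx) z
  · refine lie_mem_efbSpan (fun j k => ?_) hx
    rw [lie_h_ePow (lie_h_fbPow H.lie_h k)]
    exact Submodule.smul_mem _ _ (ePow_fbPow_mem u j k)
  · refine lie_mem_efbSpan (fun j k => ?_) hx
    cases j with
    | zero => rw [ePow_zero, lie_f_fbPow H.lie_f]; exact zero_mem _
    | succ j =>
      rw [lie_f_ePow (lie_f_fbPow H.lie_f k) (lie_h_fbPow H.lie_h k)]
      exact Submodule.smul_mem _ _ (ePow_fbPow_mem u j k)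

/-- The submodule generated by `u`. -/
noncomputable def submodule : LieSubmodule ℂ TT M :=
  { efbSpan u with lie_mem := fun {z _} hm => H.lie_mem z hm }

theorem self_mem_submodule : u ∈ H.submodule := fbPow_mem u 0

/-- The f̄ ^ k u generate sl₂-modules of different types L(m + 2k), and a vector killed by f has no
component above the bottom of each. Only k = 0 lies at its bottom on the diagonal. -/
theorem sum_diag (c : ℕ → ℂ) (K : ℕ)
    (hf : ⁅Tf, ∑ k ∈ Finset.range (K + 1), c k • ePow (fbPow u k) k⁆ = 0) :
    ∑ k ∈ Finset.range (K + 1), c k • ePow (fbPow u k) k = c 0 • u := by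
  induction K with
  | zero => simp [fbPow_zero, ePow_zero]
  | succ K ih =>
    set F := LieModule.toEnd ℂ TT M Tf with hF
    -- The power f ^ (K + 1) kills the terms of index at most `K` and sends the last one to a
    -- nonzero multiple of f̄ ^ (K + 1) u. As it kills the sum, the last term is zero.
    have h0 : (F ^ (K + 1)) (∑ k ∈ Finset.range (K + 1 + 1), c k • ePow (fbPow u k) k) = 0 := by
      rw [pow_succ, Module.End.mul_apply, hF, LieModule.toEnd_apply_apply, hf, map_zero]
    obtain ⟨d, hd, hdx⟩ := (isSl2Rep_TT M).f_pow_e_pow (lie_h_fbPow H.lie_h (K + 1))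
      (lie_f_fbPow H.lie_f (K + 1)) (K + 1) (fun i hi => by
        have h1 : (-m - 2 * ((K + 1 : ℕ) : ℂ) + i) = -((m + 2 * (K + 1) - i : ℕ) : ℂ) := by
          rw [Nat.cast_sub (by omega)]; push_cast; ring
        rw [h1]; exact neg_ne_zero.2 (Nat.cast_ne_zero.2 (by omega)))
    rw [Finset.sum_range_succ, map_add, map_sum, Finset.sum_eq_zero, zero_add, map_smul] at h0
    · have h1 : (F ^ (K + 1)) (ePow (fbPow u (K + 1)) (K + 1)) = d • fbPow u (K + 1) := hdx
      rw [h1, smul_comm, smul_eq_zero_iff_right hd] at h0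
      have h2 : c (K + 1) • ePow (fbPow u (K + 1)) (K + 1) = 0 := by
        rw [ePow, ← map_smul, h0, map_zero]
      rw [Finset.sum_range_succ, h2, add_zero] at hf ⊢
      exact ih hf
    · intro k hk
      have h1 : (F ^ (K + 1)) (ePow (fbPow u k) k) = 0 :=
        (isSl2Rep_TT M).f_pow_e_pow_eq_zero (lie_h_fbPow H.lie_h k) (lie_f_fbPow H.lie_f k)
          (Finset.mem_range.1 hk)
      rw [map_smul, h1, smul_zero]

/-- The lowest weight vectors of type `L(m)` in the submodule generated by `u` are multiples of
`u`. -/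
theorem eq_smul_of_lowest {x : M} (hx : x ∈ efbSpan u) (hf : ⁅Tf, x⁆ = 0)
    (hh : ⁅Th, x⁆ = (-m : ℂ) • x) : ∃ c : ℂ, x = c • u := by
  obtain ⟨c, rfl⟩ := Finsupp.mem_span_range_iff_exists_finsupp.1 hx
  have h1 : (c.sum fun p a => a • ePow (fbPow u p.2) p.1) ∈
      Submodule.span ℂ (Set.range fun k => ePow (fbPow u k) k) := by
    -- The vector e ^ j f̄ ^ k u has weight -m - 2k + 2j, so only j = k contributes to weight -m.
    have := eq_sum_filter (LieModule.toEnd ℂ TT M Th) c.support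
      (fun p => -m - 2 * (p.2 : ℂ) + 2 * p.1) (fun p => c p • ePow (fbPow u p.2) p.1)
      (fun p _ => by
        rw [map_smul, LieModule.toEnd_apply_apply, lie_h_ePow (lie_h_fbPow H.lie_h p.2), smul_comm])
      (-m) hh
    rw [Finsupp.sum, this]
    refine Submodule.sum_mem _ fun p hp => Submodule.smul_mem _ _ (Submodule.subset_span ?_)
    have h2 : (p.1 : ℂ) = p.2 := by
      have := (Finset.mem_filter.1 hp).2
      linear_combination this / 2
    have h3 : p.1 = p.2 := by exact_mod_cast h2
    exact ⟨p.2, by simp only [h3]⟩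
  obtain ⟨d, hd⟩ := Finsupp.mem_span_range_iff_exists_finsupp.1 h1
  have h2 : d.sum (fun k a => a • ePow (fbPow u k) k) =
      ∑ k ∈ Finset.range (d.support.sup id + 1), d k • ePow (fbPow u k) k := by
    refine Finsupp.sum_of_support_subset _ (fun k hk => ?_) _ fun _ _ => zero_smul _ _
    exact Finset.mem_range.2 (Nat.lt_succ_of_le (Finset.le_sup (f := id) hk))
  rw [← hd, h2] at hf ⊢
  exact ⟨d 0, H.sum_diag _ _ hf⟩

end IsMinimalVector

/-! ### Comparing two simple modules inside their direct sum. -/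

section Product

/-- The direct sum of two modules over the Takiff `sl₂`. -/
instance prodLieRingModule (V V' : Type*) [AddCommGroup V] [LieRingModule TT V]
    [AddCommGroup V'] [LieRingModule TT V'] : LieRingModule TT (V × V') where
  bracket z p := (⁅z, p.1⁆, ⁅z, p.2⁆)
  add_lie _ _ _ := Prod.ext (add_lie _ _ _) (add_lie _ _ _)
  lie_add _ _ _ := Prod.ext (lie_add _ _ _) (lie_add _ _ _)
  leibniz_lie _ _ _ := Prod.ext (leibniz_lie _ _ _) (leibniz_lie _ _ _)

variable (V : Type*) [AddCommGroup V] [Module ℂ V] [LieRingModule TT V] [LieModule ℂ TT V]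
  (V' : Type*) [AddCommGroup V'] [Module ℂ V'] [LieRingModule TT V'] [LieModule ℂ TT V']

instance prodLieModule : LieModule ℂ TT (V × V') where
  smul_lie _ _ _ := Prod.ext (smul_lie _ _ _) (smul_lie _ _ _)
  lie_smul _ _ _ := Prod.ext (lie_smul _ _ _) (lie_smul _ _ _)

theorem prod_lie_mk {V V' : Type*} [AddCommGroup V] [LieRingModule TT V] [AddCommGroup V']
    [LieRingModule TT V'] (z : TT) (x : V) (y : V') : ⁅z, (x, y)⁆ = (⁅z, x⁆, ⁅z, y⁆) := rfl

variable {V V'}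

theorem IsMinimalVector.prod {m : ℕ} {lam : ℂ} {u : V} {u' : V'} (H : IsMinimalVector m lam u)
    (H' : IsMinimalVector m lam u') : IsMinimalVector m lam (u, u') where
  lie_f := Prod.ext H.lie_f H'.lie_f
  lie_h := Prod.ext H.lie_h H'.lie_h
  opC_eq x := Prod.ext (H.opC_eq x.1) (H'.opC_eq x.2)
  opD_eq x := Prod.ext (H.opD_eq x.1) (H'.opD_eq x.2)
  lie_eb := Prod.ext H.lie_eb H'.lie_eb

/-- A simple module is determined by `m` and `lam`, if it has a minimal vector for them. -/
theorem IsMinimalVector.nonempty_equiv [LieModule.IsIrreducible ℂ TT V]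
    [LieModule.IsIrreducible ℂ TT V'] {m : ℕ} {lam : ℂ} {u : V} {u' : V'}
    (H : IsMinimalVector m lam u) (H' : IsMinimalVector m lam u') (hu : u ≠ 0) (hu' : u' ≠ 0) :
    Nonempty (V ≃ₗ⁅ℂ, TT⁆ V') := by
  -- Goursat's argument: `G` projects onto both simple factors, and `A`, `A'` below are the kernels
  -- of its two projections.
  let G := (H.prod H').submodule
  let p : G →ₗ⁅ℂ, TT⁆ V :=
    { toFun := fun x => x.1.1
      map_add' := fun _ _ => rfl
      map_smul' := fun _ _ => rfl
      map_lie' := rfl }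
  let p' : G →ₗ⁅ℂ, TT⁆ V' :=
    { toFun := fun x => x.1.2
      map_add' := fun _ _ => rfl
      map_smul' := fun _ _ => rfl
      map_lie' := rfl }
  have hp : Function.Surjective p := by
    rw [← LieModuleHom.range_eq_top]
    exact (IsSimpleOrder.eq_bot_or_eq_top p.range).resolve_left fun h => hu <| by
      have : u ∈ p.range := (LieModuleHom.mem_range p u).2 ⟨⟨_, (H.prod H').self_mem_submodule⟩, rfl⟩
      rwa [h, LieSubmodule.mem_bot] at this
  have hp' : Function.Surjective p' := by
    rw [← LieModuleHom.range_eq_top]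
    exact (IsSimpleOrder.eq_bot_or_eq_top p'.range).resolve_left fun h => hu' <| by
      have : u' ∈ p'.range :=
        (LieModuleHom.mem_range p' u').2 ⟨⟨_, (H.prod H').self_mem_submodule⟩, rfl⟩
      rwa [h, LieSubmodule.mem_bot] at this
  let A : LieSubmodule ℂ TT V :=
    { carrier := {x | ((x, 0) : V × V') ∈ G}
      zero_mem' := G.zero_mem
      add_mem' := fun {a b} ha hb => by
        have := G.add_mem ha hb
        rwa [Prod.mk_add_mk, add_zero] at this
      smul_mem' := fun c a ha => by
        have := G.smul_mem c ha
        rwa [Prod.smul_mk, smul_zero] at this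
      lie_mem := fun {z a} ha => by
        have := G.lie_mem (x := z) ha
        rwa [prod_lie_mk, lie_zero] at this }
  let A' : LieSubmodule ℂ TT V' :=
    { carrier := {x | ((0, x) : V × V') ∈ G}
      zero_mem' := G.zero_mem
      add_mem' := fun {a b} ha hb => by
        have := G.add_mem ha hb
        rwa [Prod.mk_add_mk, add_zero] at this
      smul_mem' := fun c a ha => by
        have := G.smul_mem c ha
        rwa [Prod.smul_mk, smul_zero] at this
      lie_mem := fun {z a} ha => by
        have := G.lie_mem (x := z) ha
        rwa [prod_lie_mk, lie_zero] at this }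
  -- Otherwise (u, 0) would be a lowest weight vector of weight -m in `G`, hence a multiple of (u,
  -- u'), against u ≠ 0 and u' ≠ 0.
  have hA : A = ⊥ := (IsSimpleOrder.eq_bot_or_eq_top A).resolve_right fun h => by
    have h1 : u ∈ A := h ▸ LieSubmodule.mem_top u
    obtain ⟨c, hc⟩ := (H.prod H').eq_smul_of_lowest h1
      (Prod.ext H.lie_f (lie_zero _)) (Prod.ext H.lie_h (by simp [prod_lie_mk]))
    rw [Prod.smul_mk, Prod.mk.injEq] at hc
    rcases smul_eq_zero.1 hc.2.symm with h2 | h2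
    · exact hu (by rw [hc.1, h2, zero_smul])
    · exact hu' h2
  have hA' : A' = ⊥ := (IsSimpleOrder.eq_bot_or_eq_top A').resolve_right fun h => by
    have h1 : u' ∈ A' := h ▸ LieSubmodule.mem_top u'
    obtain ⟨c, hc⟩ := (H.prod H').eq_smul_of_lowest h1
      (Prod.ext (lie_zero _) H'.lie_f) (Prod.ext (by simp [prod_lie_mk]) H'.lie_h)
    rw [Prod.smul_mk, Prod.mk.injEq] at hc
    rcases smul_eq_zero.1 hc.1.symm with h2 | h2
    · exact hu' (by rw [hc.2, h2, zero_smul])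
    · exact hu h2
  have hpi : Function.Injective p := by
    refine (injective_iff_map_eq_zero p).2 fun x hx => ?_
    obtain ⟨⟨a, b⟩, hab⟩ := x
    obtain rfl : a = 0 := hx
    have : b ∈ A' := hab
    rw [hA', LieSubmodule.mem_bot] at this
    exact Subtype.ext (Prod.ext rfl this)
  have hpi' : Function.Injective p' := by
    refine (injective_iff_map_eq_zero p').2 fun x hx => ?_
    obtain ⟨⟨a, b⟩, hab⟩ := x
    obtain rfl : b = 0 := hx
    have : a ∈ A := hab
    rw [hA, LieSubmodule.mem_bot] at this
    exact Subtype.ext (Prod.ext this rfl)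
  exact ⟨(lieEquivOfBijective p ⟨hpi, hp⟩).symm.trans (lieEquivOfBijective p' ⟨hpi', hp'⟩)⟩

end Product

end Uniqueness

/-! ### Explicit models of the localized Verma module and of its quotient. -/

section Models

attribute [local instance 100] LieRing.ofAssociativeRing

/-! ### The formulas for the action on monomials -/

section Formulas

variable {X : Type*} [AddCommGroup X] [Module ℂ X] (n lam : ℂ) (w : ℕ → ℤ → X) (b : ℕ) (j : ℤ)

/-- The image of the monomial `w b j` under `e`. -/
def formE : X :=
  ((-(j + 1) * j - 2 * b * j + n * j : ℂ)) • w b (j - 1) + (lam * b) • w (b - 1) j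
/-- The image of the monomial `w b j` under `h`. -/
def formH : X := ((n - 2 - 2 * j - 2 * b : ℂ)) • w b j
/-- The image of the monomial `w b j` under `f`. -/
def formF : X := w b (j + 1)
/-- The image of the monomial `w b j` under `ē`. -/
def formEb : X := ((lam * j : ℂ)) • w b (j - 1) - ((j * (j - 1) : ℂ)) • w (b + 1) (j - 2)
/-- The image of the monomial `w b j` under `h̄`. -/
def formHb : X := lam • w b j - ((2 * j : ℂ)) • w (b + 1) (j - 1)
/-- The image of the monomial `w b j` under `f̄`. -/
def formFb : X := w (b + 1) j

end Formulas

/-- The localization of the Verma module `Δ(n - 2, lam)` at the powers of `f`, with the basis of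
monomials `f̄ ^ b f ^ j`, `b` being nonnegative and `j` an integer. -/
def LocModel (_n _lam : ℂ) : Type := ℕ × ℤ →₀ ℂ

/-- The quotient of the localization of `Δ(n - 2, lam)` by `Δ(n - 2, lam)`. -/
def QuotModel (_n _lam : ℂ) : Type := ℕ × ℕ →₀ ℂ

variable (n lam : ℂ)

noncomputable instance : AddCommGroup (LocModel n lam) := inferInstanceAs (AddCommGroup (_ →₀ ℂ))
noncomputable instance : Module ℂ (LocModel n lam) := inferInstanceAs (Module ℂ (_ →₀ ℂ))
noncomputable instance : AddCommGroup (QuotModel n lam) := inferInstanceAs (AddCommGroup (_ →₀ ℂ))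
noncomputable instance : Module ℂ (QuotModel n lam) := inferInstanceAs (Module ℂ (_ →₀ ℂ))

/-- The basis of `LocModel`. -/
noncomputable def LocModel.basis : Module.Basis (ℕ × ℤ) ℂ (LocModel n lam) :=
  Module.Basis.ofRepr (LinearEquiv.refl ℂ (ℕ × ℤ →₀ ℂ))

/-- The basis of `QuotModel`. -/
noncomputable def QuotModel.basis : Module.Basis (ℕ × ℕ) ℂ (QuotModel n lam) :=
  Module.Basis.ofRepr (LinearEquiv.refl ℂ (ℕ × ℕ →₀ ℂ))

namespace LocModel

/-- The basis vectors of `LocModel`. -/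
noncomputable def mon (b : ℕ) (j : ℤ) : LocModel n lam := basis n lam (b, j)

/-- An operator on `LocModel` given on the basis. -/
noncomputable def op (F : ℕ → ℤ → LocModel n lam) : Module.End ℂ (LocModel n lam) :=
  (basis n lam).constr ℂ fun p => F p.1 p.2

variable {n lam}

@[simp] theorem op_mon (F : ℕ → ℤ → LocModel n lam) (b : ℕ) (j : ℤ) :
    op n lam F (mon n lam b j) = F b j :=
  (basis n lam).constr_basis ℂ _ _

theorem hom_ext {X : Type*} [AddCommGroup X] [Module ℂ X] {S T : LocModel n lam →ₗ[ℂ] X}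
    (h : ∀ b j, S (mon n lam b j) = T (mon n lam b j)) : S = T :=
  (basis n lam).ext fun p => h p.1 p.2

variable (n lam)

theorem isTakiffRep : IsTakiffRep (op n lam (formE n lam (mon n lam)))
    (op n lam (formH n (mon n lam))) (op n lam (formF (mon n lam)))
    (op n lam (formEb lam (mon n lam))) (op n lam (formHb lam (mon n lam)))
    (op n lam (formFb (mon n lam))) := by
  -- The cases b = 0, b = 1 and b ≥ 2 resolve the truncated b - 1 in the formula for e. At b = 0 its
  -- coefficient lam * b vanishes, so the truncation is harmless.
  constructor <;> refine hom_ext fun b j => ?_ <;> rcases b with _ | _ | b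
  all_goals
    simp only [Module.End.mul_apply, LinearMap.add_apply, LinearMap.sub_apply,
      LinearMap.smul_apply, op_mon, formE, formH, formF, formEb, formHb, formFb, map_add, map_sub,
      map_smul, add_sub_cancel_right, sub_add_cancel, Nat.add_sub_cancel,
      show j - 1 - 1 = j - 2 by ring, show j + 1 - 2 = j - 1 by ring,
      show j - 2 + 1 = j - 1 by ring, show j - 1 - 2 = j - 3 by ring,
      show j - 2 - 1 = j - 3 by ring, zero_add,
      show (1 : ℕ) - 1 = 0 from rfl]
  all_goals
    push_cast
    module

noncomputable instance : LieRingModule TT (LocModel n lam) :=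
  LieRingModule.compLieHom _ (isTakiffRep n lam).hom

noncomputable instance : LieModule ℂ TT (LocModel n lam) :=
  LieModule.compLieHom _ (isTakiffRep n lam).hom

variable {n lam}

theorem lie_eq (z : TT) (x : LocModel n lam) : ⁅z, x⁆ = (isTakiffRep n lam).hom z x := rfl

theorem lie_e (b : ℕ) (j : ℤ) : ⁅Te, mon n lam b j⁆ = formE n lam (mon n lam) b j := by
  rw [lie_eq, IsTakiffRep.hom_Te, op_mon]
theorem lie_h (b : ℕ) (j : ℤ) : ⁅Th, mon n lam b j⁆ = formH n (mon n lam) b j := by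
  rw [lie_eq, IsTakiffRep.hom_Th, op_mon]
theorem lie_f (b : ℕ) (j : ℤ) : ⁅Tf, mon n lam b j⁆ = formF (mon n lam) b j := by
  rw [lie_eq, IsTakiffRep.hom_Tf, op_mon]
theorem lie_eb (b : ℕ) (j : ℤ) : ⁅Teb, mon n lam b j⁆ = formEb lam (mon n lam) b j := by
  rw [lie_eq, IsTakiffRep.hom_Teb, op_mon]
theorem lie_hb (b : ℕ) (j : ℤ) : ⁅Thb, mon n lam b j⁆ = formHb lam (mon n lam) b j := by
  rw [lie_eq, IsTakiffRep.hom_Thb, op_mon]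
theorem lie_fb (b : ℕ) (j : ℤ) : ⁅Tfb, mon n lam b j⁆ = formFb (mon n lam) b j := by
  rw [lie_eq, IsTakiffRep.hom_Tfb, op_mon]

end LocModel

namespace QuotModel

/-- The basis vectors of `QuotModel`. -/
noncomputable def mon (b k : ℕ) : QuotModel n lam := basis n lam (b, k)

/-- The image of a basis vector of `LocModel`. -/
noncomputable def zmon (b : ℕ) (j : ℤ) : QuotModel n lam :=
  if 0 ≤ j then 0 else mon n lam b (-j - 1).toNat

/-- An operator on `QuotModel` given on the basis. -/
noncomputable def op (F : ℕ → ℕ → QuotModel n lam) : Module.End ℂ (QuotModel n lam) :=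
  (basis n lam).constr ℂ fun p => F p.1 p.2

/-- The quotient map. -/
noncomputable def proj : LocModel n lam →ₗ[ℂ] QuotModel n lam :=
  (LocModel.basis n lam).constr ℂ fun p => zmon n lam p.1 p.2

variable {n lam}

@[simp] theorem proj_mon (b : ℕ) (j : ℤ) : proj n lam (LocModel.mon n lam b j) = zmon n lam b j :=
  (LocModel.basis n lam).constr_basis ℂ _ _

@[simp] theorem op_mon (F : ℕ → ℕ → QuotModel n lam) (b k : ℕ) :
    op n lam F (mon n lam b k) = F b k :=
  (basis n lam).constr_basis ℂ _ _

theorem zmon_of_nonneg (b : ℕ) {j : ℤ} (hj : 0 ≤ j) : zmon n lam b j = 0 := if_pos hj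

theorem zmon_neg (b k : ℕ) : zmon n lam b (-(k + 1)) = mon n lam b k := by
  rw [zmon, if_neg (by omega)]
  congr 1
  omega

theorem zmon_eq (b k : ℕ) {j : ℤ} (hj : j = -(k + 1)) : zmon n lam b j = mon n lam b k := by
  rw [hj, zmon_neg]

theorem hom_ext {X : Type*} [AddCommGroup X] [Module ℂ X] {S T : QuotModel n lam →ₗ[ℂ] X}
    (h : ∀ b k, S (mon n lam b k) = T (mon n lam b k)) : S = T :=
  (basis n lam).ext fun p => h p.1 p.2

theorem proj_surjective : Function.Surjective (proj n lam) := by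
  rw [← LinearMap.range_eq_top, eq_top_iff, ← (basis n lam).span_eq, Submodule.span_le]
  rintro _ ⟨⟨b, k⟩, rfl⟩
  exact ⟨LocModel.mon n lam b (-(k + 1)), by rw [proj_mon, zmon_neg]; rfl⟩

/-- The condition `hF` says that the symbols with j ≥ 0, which span the image of the Verma module,
are mapped into their own span; only then does the operator descend. -/
theorem op_proj {G : ℕ → ℤ → LocModel n lam} {F : ℕ → ℤ → QuotModel n lam}
    (hG : ∀ b j, proj n lam (G b j) = F b j) (hF : ∀ b j, 0 ≤ j → F b j = 0)
    (x : LocModel n lam) : op n lam (fun b k => F b (-(k + 1))) (proj n lam x) =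
      proj n lam (LocModel.op n lam G x) := by
  have : (op n lam (fun b k => F b (-(k + 1)))).comp (proj n lam) =
      (proj n lam).comp (LocModel.op n lam G) := by
    refine LocModel.hom_ext fun b j => ?_
    rw [LinearMap.comp_apply, LinearMap.comp_apply, LocModel.op_mon, hG, proj_mon]
    rcases le_or_gt 0 j with h | h
    · rw [zmon_of_nonneg b h, map_zero, hF b j h]
    · obtain ⟨k, rfl⟩ : ∃ k : ℕ, j = -(k + 1) := ⟨(-j - 1).toNat, by omega⟩
      rw [zmon_neg, op_mon]
  exact LinearMap.congr_fun this x

/-- The operators on `QuotModel`. -/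
noncomputable def opOf (F : (ℕ → ℤ → QuotModel n lam) → ℕ → ℤ → QuotModel n lam) :
    Module.End ℂ (QuotModel n lam) :=
  op n lam (fun b k => F (zmon n lam) b (-(k + 1)))

theorem opOf_E (x : LocModel n lam) : opOf (formE n lam) (proj n lam x) =
    proj n lam (LocModel.op n lam (formE n lam (LocModel.mon n lam)) x) := by
  refine op_proj (fun b j => by simp [formE]) (fun b j hj => ?_) x
  -- Only j = 0 could leave the range j ≥ 0, and there the coefficient of the symbol with exponent j
  -- - 1 vanishes.
  rcases hj.eq_or_lt with rfl | hj
  · simp [formE, zmon_of_nonneg]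
  · rw [formE, zmon_of_nonneg _ hj.le, zmon_of_nonneg _ (by omega)]; simp

theorem opOf_H (x : LocModel n lam) : opOf (formH n) (proj n lam x) =
    proj n lam (LocModel.op n lam (formH n (LocModel.mon n lam)) x) :=
  op_proj (fun b j => by simp [formH]) (fun b j hj => by rw [formH, zmon_of_nonneg _ hj]; simp) x

theorem opOf_F (x : LocModel n lam) : opOf formF (proj n lam x) =
    proj n lam (LocModel.op n lam (formF (LocModel.mon n lam)) x) :=
  op_proj (fun b j => by simp [formF])
    (fun b j hj => by rw [formF, zmon_of_nonneg _ (by omega)]) x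

theorem opOf_Eb (x : LocModel n lam) : opOf (formEb lam) (proj n lam x) =
    proj n lam (LocModel.op n lam (formEb lam (LocModel.mon n lam)) x) := by
  refine op_proj (fun b j => by simp [formEb]) (fun b j hj => ?_) x
  rcases hj.eq_or_lt with rfl | hj
  · simp [formEb]
  -- The term with exponent j - 2 leaves the range also at j = 1, where its coefficient j(j - 1)
  -- vanishes.
  rcases (Int.add_one_le_of_lt hj).eq_or_lt with hj' | hj'
  · obtain rfl : j = 1 := by omega
    simp [formEb, zmon_of_nonneg]
  · rw [formEb, zmon_of_nonneg _ (by omega), zmon_of_nonneg _ (by omega)]; simp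

theorem opOf_Hb (x : LocModel n lam) : opOf (formHb lam) (proj n lam x) =
    proj n lam (LocModel.op n lam (formHb lam (LocModel.mon n lam)) x) := by
  refine op_proj (fun b j => by simp [formHb]) (fun b j hj => ?_) x
  rcases hj.eq_or_lt with rfl | hj
  · simp [formHb, zmon_of_nonneg]
  · rw [formHb, zmon_of_nonneg _ hj.le, zmon_of_nonneg _ (by omega)]; simp

theorem opOf_Fb (x : LocModel n lam) : opOf formFb (proj n lam x) =
    proj n lam (LocModel.op n lam (formFb (LocModel.mon n lam)) x) :=
  op_proj (fun b j => by simp [formFb]) (fun b j hj => by rw [formFb, zmon_of_nonneg _ hj]) x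

variable (n lam)

theorem isTakiffRep : IsTakiffRep (opOf (formE n lam)) (opOf (formH n)) (opOf formF)
    (opOf (formEb lam)) (opOf (formHb lam)) (opOf (n := n) (lam := lam) formFb) := by
  have H := LocModel.isTakiffRep n lam
  constructor <;> refine LinearMap.ext fun y => ?_ <;> obtain ⟨x, rfl⟩ := proj_surjective y <;>
    simp only [Module.End.mul_apply, LinearMap.add_apply, LinearMap.sub_apply,
      LinearMap.smul_apply, opOf_E, opOf_H, opOf_F, opOf_Eb, opOf_Hb, opOf_Fb, ← map_add,
      ← map_sub, ← LinearMap.map_smul (proj n lam)]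
  · exact congrArg _ (LinearMap.congr_fun H.ef x)
  · exact congrArg _ (LinearMap.congr_fun H.he x)
  · exact congrArg _ (LinearMap.congr_fun H.hf x)
  · exact congrArg _ (LinearMap.congr_fun H.eeb x)
  · exact congrArg _ (LinearMap.congr_fun H.ehb x)
  · exact congrArg _ (LinearMap.congr_fun H.efb x)
  · exact congrArg _ (LinearMap.congr_fun H.heb x)
  · exact congrArg _ (LinearMap.congr_fun H.hhb x)
  · exact congrArg _ (LinearMap.congr_fun H.hfb x)
  · exact congrArg _ (LinearMap.congr_fun H.feb x)
  · exact congrArg _ (LinearMap.congr_fun H.fhb x)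
  · exact congrArg _ (LinearMap.congr_fun H.ffb x)
  · exact congrArg _ (LinearMap.congr_fun H.ebhb x)
  · exact congrArg _ (LinearMap.congr_fun H.ebfb x)
  · exact congrArg _ (LinearMap.congr_fun H.hbfb x)

noncomputable instance : LieRingModule TT (QuotModel n lam) :=
  LieRingModule.compLieHom _ (isTakiffRep n lam).hom

noncomputable instance : LieModule ℂ TT (QuotModel n lam) :=
  LieModule.compLieHom _ (isTakiffRep n lam).hom

variable {n lam}

theorem lie_eq (z : TT) (x : QuotModel n lam) : ⁅z, x⁆ = (isTakiffRep n lam).hom z x := rfl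

variable (n lam) in
/-- The quotient map as a homomorphism of modules. -/
noncomputable def projHom : LocModel n lam →ₗ⁅ℂ, TT⁆ QuotModel n lam :=
  { proj n lam with
    map_lie' := fun {z x} => by
      change proj n lam ⁅z, x⁆ = ⁅z, proj n lam x⁆
      rw [lie_decomp z x, lie_decomp z]
      simp only [lie_eq, LocModel.lie_eq, IsTakiffRep.hom_Te, IsTakiffRep.hom_Th,
        IsTakiffRep.hom_Tf, IsTakiffRep.hom_Teb, IsTakiffRep.hom_Thb, IsTakiffRep.hom_Tfb,
        opOf_E, opOf_H, opOf_F, opOf_Eb, opOf_Hb, opOf_Fb, map_add, map_smul] }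

/-- Here and below, `mon b k` stands for f̄ ^ b f ^ (-(k + 1)), so the formulas are those of the
localization at j = -(k + 1). -/
theorem lie_e (b k : ℕ) : ⁅Te, mon n lam b k⁆ = ((k + 1) * (2 * b - k - n) : ℂ) •
    mon n lam b (k + 1) + (lam * b) • mon n lam (b - 1) k := by
  rw [lie_eq, IsTakiffRep.hom_Te, opOf, op_mon, formE, zmon_neg,
    zmon_eq b (k + 1) (by push_cast; ring)]
  push_cast
  module

theorem lie_h (b k : ℕ) : ⁅Th, mon n lam b k⁆ = (n - 2 * b + 2 * k : ℂ) • mon n lam b k := by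
  rw [lie_eq, IsTakiffRep.hom_Th, opOf, op_mon, formH, zmon_neg]
  push_cast
  module

theorem lie_f_zero (b : ℕ) : ⁅Tf, mon n lam b 0⁆ = 0 := by
  rw [lie_eq, IsTakiffRep.hom_Tf, opOf, op_mon, formF, zmon_of_nonneg]
  norm_num

theorem lie_f_succ (b k : ℕ) : ⁅Tf, mon n lam b (k + 1)⁆ = mon n lam b k := by
  rw [lie_eq, IsTakiffRep.hom_Tf, opOf, op_mon, formF]
  exact zmon_eq b k (by push_cast; ring)

theorem lie_eb (b k : ℕ) : ⁅Teb, mon n lam b k⁆ = (-lam * (k + 1) : ℂ) • mon n lam b (k + 1) -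
    ((k + 1) * (k + 2) : ℂ) • mon n lam (b + 1) (k + 2) := by
  rw [lie_eq, IsTakiffRep.hom_Teb, opOf, op_mon, formEb, zmon_eq b (k + 1) (by push_cast; ring),
    zmon_eq (b + 1) (k + 2) (by push_cast; ring)]
  push_cast
  module

theorem lie_hb (b k : ℕ) : ⁅Thb, mon n lam b k⁆ = lam • mon n lam b k +
    (2 * (k + 1) : ℂ) • mon n lam (b + 1) (k + 1) := by
  rw [lie_eq, IsTakiffRep.hom_Thb, opOf, op_mon, formHb, zmon_neg,
    zmon_eq (b + 1) (k + 1) (by push_cast; ring)]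
  push_cast
  module

theorem lie_fb (b k : ℕ) : ⁅Tfb, mon n lam b k⁆ = mon n lam (b + 1) k := by
  rw [lie_eq, IsTakiffRep.hom_Tfb, opOf, op_mon, formFb, zmon_neg]

theorem opC_eq (x : QuotModel n lam) : opC _ x = lam ^ 2 • x := by
  have : opC (QuotModel n lam) = lam ^ 2 • LinearMap.id := by
    refine hom_ext fun b k => ?_
    simp only [opC_apply, lie_hb, lie_eb, lie_fb, lie_add, lie_sub, lie_smul, LinearMap.smul_apply,
      LinearMap.id_apply]
    push_cast
    module
  rw [this]; rfl

theorem opD_eq (x : QuotModel n lam) : opD _ x = (n * lam) • x := by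
  have : opD (QuotModel n lam) = (n * lam) • LinearMap.id := by
    refine hom_ext fun b k => ?_
    simp only [opD_apply, lie_h, lie_e, lie_f_succ, lie_hb, lie_eb, lie_fb, lie_add, lie_sub,
      lie_smul, LinearMap.smul_apply, LinearMap.id_apply, Nat.add_sub_cancel]
    push_cast
    module
  rw [this]; rfl

end QuotModel

end Models

theorem exists_mem_ne_zero {L M : Type*} [LieRing L] [LieAlgebra ℂ L] [AddCommGroup M] [Module ℂ M]
    [LieRingModule L M] {Q : LieSubmodule ℂ L M} (hQ : Q ≠ ⊥) : ∃ x ∈ Q, x ≠ 0 := by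
  by_contra! h
  exact hQ ((LieSubmodule.eq_bot_iff Q).2 h)

theorem finiteDimensional_orbitSpan_of_pow {L : Type*} [LieRing L] [LieAlgebra ℂ L] {M : Type*}
    [AddCommGroup M] [Module ℂ M] [LieRingModule L M] [LieModule ℂ L M] {x : L} {m : M} {N : ℕ}
    (hN : (LieModule.toEnd ℂ L M x ^ N) m = 0) : FiniteDimensional ℂ (orbitSpan x m) := by
  let s : Set M := (fun k => (LieModule.toEnd ℂ L M x ^ k) m) '' (Finset.range N : Set ℕ)
  have hfin : s.Finite := (Finset.finite_toSet _).image _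
  have : FiniteDimensional ℂ (Submodule.span ℂ s) := FiniteDimensional.span_of_finite ℂ hfin
  refine Submodule.finiteDimensional_of_le (S₂ := Submodule.span ℂ s) ?_
  rw [orbitSpan, Submodule.span_le]
  rintro _ ⟨k, rfl⟩
  by_cases hk : k < N
  · exact Submodule.subset_span ⟨k, by simpa using hk, rfl⟩
  · obtain ⟨d, rfl⟩ := Nat.exists_eq_add_of_le' (not_lt.1 hk)
    have : (LieModule.toEnd ℂ L M x ^ (d + N)) m = 0 := by
      rw [pow_add, Module.End.mul_apply, hN, map_zero]
    simp only [this]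
    exact zero_mem _

theorem exists_pow_eq_zero_of_mem_locallyFinite {M : Type*} [AddCommGroup M] [Module ℂ M]
    [LieRingModule TT M] [LieModule ℂ TT M] {x : M} {μ : ℂ} (hx : ⁅Th, x⁆ = μ • x)
    (h : x ∈ locallyFinite Te M) : ∃ N, (LieModule.toEnd ℂ TT M Te ^ N) x = 0 := by
  have : FiniteDimensional ℂ (orbitSpan Te x) := h
  exact (isSl2Rep_TT M).exists_e_pow_eq_zero hx (orbitSpan Te x)
    fun j => Submodule.subset_span ⟨j, rfl⟩

/-! ### Lowest weight vectors and locally finite vectors of the quotient model. -/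

namespace QuotModel

section

variable {n lam : ℂ}

/-- The coefficients of a vector. -/
noncomputable def coeff (b k : ℕ) : QuotModel n lam →ₗ[ℂ] ℂ := (basis n lam).coord (b, k)

theorem coeff_mon (b k b' k' : ℕ) :
    coeff b k (mon n lam b' k') = if b' = b ∧ k' = k then 1 else 0 := by
  rw [coeff, Module.Basis.coord_apply, mon, Module.Basis.repr_self, Finsupp.single_apply]
  simp only [Prod.mk.injEq]

theorem eq_zero_of_coeff {x : QuotModel n lam} (h : ∀ b k, coeff b k x = 0) : x = 0 :=
  (basis n lam).ext_elem fun p => by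
    rw [map_zero]; exact h p.1 p.2

theorem coeff_lie_f (b k : ℕ) (x : QuotModel n lam) : coeff b k ⁅Tf, x⁆ = coeff b (k + 1) x := by
  have : (coeff b k).comp (LieModule.toEnd ℂ TT (QuotModel n lam) Tf) = coeff b (k + 1) := by
    refine hom_ext fun b' k' => ?_
    rw [LinearMap.comp_apply, LieModule.toEnd_apply_apply]
    rcases k' with _ | k'
    · rw [lie_f_zero, map_zero, coeff_mon, if_neg (by omega)]
    · rw [lie_f_succ, coeff_mon, coeff_mon]; simp
  exact LinearMap.congr_fun this x

theorem coeff_lie_h (b k : ℕ) (x : QuotModel n lam) :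
    coeff b k ⁅Th, x⁆ = (n - 2 * b + 2 * k) * coeff b k x := by
  have : (coeff b k).comp (LieModule.toEnd ℂ TT (QuotModel n lam) Th) =
      (n - 2 * b + 2 * k) • coeff b k := by
    refine hom_ext fun b' k' => ?_
    rw [LinearMap.comp_apply, LieModule.toEnd_apply_apply, lie_h, map_smul, LinearMap.smul_apply,
      coeff_mon]
    split_ifs with h
    · rw [h.1, h.2]
    · simp
  exact LinearMap.congr_fun this x

theorem coeff_zero_lie_e (b : ℕ) (x : QuotModel n lam) :
    coeff b 0 ⁅Te, x⁆ = lam * (b + 1) * coeff (b + 1) 0 x := by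
  have : (coeff b 0).comp (LieModule.toEnd ℂ TT (QuotModel n lam) Te) =
      (lam * (b + 1)) • coeff (b + 1) 0 := by
    refine hom_ext fun b' k' => ?_
    rw [LinearMap.comp_apply, LieModule.toEnd_apply_apply, lie_e, map_add, map_smul, map_smul,
      LinearMap.smul_apply, coeff_mon, coeff_mon, coeff_mon, if_neg (by omega)]
    rcases b' with _ | b'
    · simp
    · simp only [Nat.add_sub_cancel, Nat.add_right_cancel_iff, smul_zero, zero_add]
      split_ifs with h
      · rw [h.1]; push_cast; rfl
      · simp
  exact LinearMap.congr_fun this x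

/-- Along the vectors y_b = `mon b 0` the operator e passes the coefficient at b + 1 on to b with
the factor lam (b + 1). Thus e ^ k x cannot vanish when `x` involves some y_{b+k}; this is where lam
≠ 0 enters. -/
theorem coeff_zero_e_pow (hlam : lam ≠ 0) (k b : ℕ) (x : QuotModel n lam)
    (hx : coeff (b + k) 0 x ≠ 0) :
    coeff b 0 ((LieModule.toEnd ℂ TT (QuotModel n lam) Te ^ k) x) ≠ 0 := by
  induction k generalizing b with
  | zero => exact hx
  | succ k ih =>
    rw [pow_succ', Module.End.mul_apply, LieModule.toEnd_apply_apply, coeff_zero_lie_e]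
    exact mul_ne_zero (mul_ne_zero hlam (Nat.cast_add_one_ne_zero b))
      (ih (b + 1) (by rwa [show b + 1 + k = b + (k + 1) by omega]))

/-- f lowers the second index, so a vector killed by f involves only the y_b, and these have
pairwise different weights. -/
theorem exists_eq_smul_mon {x : QuotModel n lam} {μ : ℂ} (hf : ⁅Tf, x⁆ = 0)
    (hh : ⁅Th, x⁆ = μ • x) (h0 : x ≠ 0) :
    ∃ (b : ℕ) (c : ℂ), c ≠ 0 ∧ μ = n - 2 * b ∧ x = c • mon n lam b 0 := by
  have h1 : ∀ b k, coeff b (k + 1) x = 0 := fun b k => by rw [← coeff_lie_f, hf, map_zero]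
  have h2 : ∃ b, coeff b 0 x ≠ 0 := by
    by_contra! h
    exact h0 (eq_zero_of_coeff fun b k => by cases k with | zero => exact h b | succ k => exact h1 b k)
  obtain ⟨b, hb⟩ := h2
  have h3 : ∀ b, coeff b 0 x ≠ 0 → μ = n - 2 * b := fun b hb => by
    have := coeff_lie_h b 0 x
    rw [hh, map_smul, smul_eq_mul] at this
    simpa using mul_right_cancel₀ hb this
  refine ⟨b, coeff b 0 x, hb, h3 b hb, ?_⟩
  rw [← sub_eq_zero]
  refine eq_zero_of_coeff fun b' k => ?_
  rw [map_sub, map_smul, coeff_mon, smul_eq_mul]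
  cases k with
  | succ k => simp [h1]
  | zero =>
    by_cases hbb : b = b'
    · simp [hbb]
    · by_cases hb' : coeff b' 0 x = 0
      · simp [hbb, hb']
      · have h4 : (b : ℂ) = b' := by
          have := (h3 b hb).symm.trans (h3 b' hb')
          linear_combination -this / 2
        exact absurd (by exact_mod_cast h4) hbb

theorem exists_f_pow_eq_zero (x : QuotModel n lam) :
    ∃ k, (LieModule.toEnd ℂ TT (QuotModel n lam) Tf ^ k) x = 0 := by
  have hmon : ∀ b k, (LieModule.toEnd ℂ TT (QuotModel n lam) Tf ^ (k + 1)) (mon n lam b k) = 0 := by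
    intro b k
    induction k with
    | zero => simp [lie_f_zero]
    | succ k ih =>
      rw [pow_succ, Module.End.mul_apply, LieModule.toEnd_apply_apply, lie_f_succ, ih]
  have hle : ∀ {a b : ℕ} {y : QuotModel n lam}, a ≤ b →
      (LieModule.toEnd ℂ TT (QuotModel n lam) Tf ^ a) y = 0 →
      (LieModule.toEnd ℂ TT (QuotModel n lam) Tf ^ b) y = 0 := by
    intro a b y hab hy
    obtain ⟨d, rfl⟩ := Nat.exists_eq_add_of_le' hab
    rw [pow_add, Module.End.mul_apply, hy, map_zero]
  have hx : x ∈ Submodule.span ℂ (Set.range (basis n lam)) := by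
    rw [(basis n lam).span_eq]; trivial
  induction hx using Submodule.span_induction with
  | mem y hy =>
    obtain ⟨⟨b, k⟩, rfl⟩ := hy
    exact ⟨k + 1, hmon b k⟩
  | zero => exact ⟨0, map_zero _⟩
  | add y z _ _ hy hz =>
    obtain ⟨a, ha⟩ := hy
    obtain ⟨b, hb⟩ := hz
    exact ⟨max a b, by rw [map_add, hle (le_max_left a b) ha, hle (le_max_right a b) hb, add_zero]⟩
  | smul c y _ hy =>
    obtain ⟨a, ha⟩ := hy
    exact ⟨a, by rw [map_smul, ha, smul_zero]⟩

/-- With l = 2i - n, the left side is the projection to the L(l - 2)-component of ḡ ⊗ L(l), applied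
to the lowest weight vector y_i. The factor on the right shows when it leads down to y_{i-1}. -/
theorem lowering_identity (i : ℕ) : ((2 * i - n) * (2 * i - n + 1) : ℂ) • ⁅Teb, mon n lam i 0⁆ +
    (2 * i - n + 1) • ⁅Te, ⁅Thb, mon n lam i 0⁆⁆ - ⁅Te, ⁅Te, ⁅Tfb, mon n lam i 0⁆⁆⁆ =
    (lam ^ 2 * i * (i - n)) • mon n lam (i - 1) 0 := by
  simp only [lie_e, lie_hb, lie_eb, lie_fb, lie_add, lie_smul, Nat.add_sub_cancel]
  push_cast
  module

end

variable {n : ℤ} {lam : ℂ}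

theorem lie_h_mon_zero (i : ℕ) :
    ⁅Th, mon (n : ℂ) lam i 0⁆ = (n - 2 * i : ℂ) • mon (n : ℂ) lam i 0 := by
  rw [lie_h]; simp

/-- The vector e ^ (l + 1) y_i is killed by f and has weight l + 2. If nonzero, it would be a
multiple of some y_b with n - 2b = l + 2, that is n = b + i + 1 > i. -/
theorem e_pow_mon_zero {i : ℕ} {l : ℕ} (hi : n ≤ i) (hl : (l : ℤ) = 2 * i - n) :
    ePow (mon (n : ℂ) lam i 0) (l + 1) = 0 := by
  have hl' : (l : ℂ) = 2 * i - n := by exact_mod_cast hl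
  by_contra h0
  obtain ⟨b, c, -, hb, -⟩ := exists_eq_smul_mon (x := ePow (mon (n : ℂ) lam i 0) (l + 1))
    (by
      rw [lie_f_ePow (lie_f_zero i) (lie_h_mon_zero i), hl']
      rw [show -((2 * i - n + 1 : ℂ) * (n - 2 * i + (2 * i - n))) = 0 by ring, zero_smul])
    (lie_h_ePow (lie_h_mon_zero i) (l + 1)) h0
  push_cast at hb
  have h1 : ((b + i + 1 : ℤ) : ℂ) = (n : ℤ) := by
    push_cast
    linear_combination hb / 2 - hl'
  have h2 : (b + i + 1 : ℤ) = n := by exact_mod_cast h1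
  omega

theorem mon_zero_mem_iff (hlam : lam ≠ 0) (i : ℕ) :
    mon (n : ℂ) lam i 0 ∈ locallyFinite Te (QuotModel (n : ℂ) lam) ↔ n ≤ i := by
  constructor
  · intro h
    by_contra! hi
    obtain ⟨N, hN⟩ := exists_pow_eq_zero_of_mem_locallyFinite (lie_h_mon_zero i) h
    have h0 : mon (n : ℂ) lam i 0 ≠ 0 := (basis (n : ℂ) lam).ne_zero _
    obtain ⟨l, hl, hl1, -⟩ := (isSl2Rep_TT _).exists_nat (lie_h_mon_zero i) (lie_f_zero i) h0 hN
    have h1 : ((n - 2 * i : ℤ) : ℂ) = ((-l : ℤ) : ℂ) := by push_cast; exact hl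
    have h2 : n - 2 * i = -l := by exact_mod_cast h1
    -- From l = 2i - n and i < n it follows that l + 1 ≤ i. Hence e ^ (l + 1) y_i has a nonzero
    -- coefficient at y_b, although it is zero.
    obtain ⟨b, hb⟩ : ∃ b, i = b + (l + 1) := ⟨i - (l + 1), by omega⟩
    refine coeff_zero_e_pow hlam (l + 1) b (mon (n : ℂ) lam i 0) ?_ (by rw [hl1, map_zero])
    rw [coeff_mon, if_pos ⟨hb, rfl⟩]
    exact one_ne_zero
  · intro hi
    exact finiteDimensional_orbitSpan_of_pow
      (e_pow_mon_zero (l := (2 * i - n).toNat) hi (by omega))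

/-- The locally finite vectors are spanned by the vectors `e ^ j y_i`, for the lowest weight
vectors `y_i` with `n ≤ i`. -/
theorem mem_span_of_mem_locallyFinite (hlam : lam ≠ 0) {x : QuotModel (n : ℂ) lam}
    (hx : x ∈ locallyFinite Te (QuotModel (n : ℂ) lam)) :
    x ∈ Submodule.span ℂ {y | ∃ i : ℕ, n ≤ i ∧ ∃ j, y = ePow (mon (n : ℂ) lam i 0) j} := by
  classical
  set K := locallyFinite Te (QuotModel (n : ℂ) lam) with hK
  set s := ((basis (n : ℂ) lam).repr x).support with hs
  set w : ℕ × ℕ → ℂ := fun p => n - 2 * p.1 + 2 * p.2 with hw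
  set y : ℕ × ℕ → QuotModel (n : ℂ) lam := fun p => (basis (n : ℂ) lam).repr x p • mon _ _ p.1 p.2
    with hy
  have hxs : x = ∑ p ∈ s, y p := ((basis (n : ℂ) lam).linearCombination_repr x).symm
  have hwt : ∀ p ∈ s, LieModule.toEnd ℂ TT (QuotModel (n : ℂ) lam) Th (y p) = w p • y p := by
    intro p _
    rw [hy, map_smul, LieModule.toEnd_apply_apply, lie_h, smul_comm]
  rw [hxs, ← Finset.sum_fiberwise_of_maps_to (t := s.image w) (g := w)
    (fun p hp => Finset.mem_image_of_mem w hp)]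
  refine Submodule.sum_mem _ fun ν _ => ?_
  -- The locally finite vectors are stable under h, so they contain the weight components of `x`, to
  -- which sl₂-theory for weight vectors applies.
  have hmem : ∑ p ∈ s with w p = ν, y p ∈ K.toSubmodule :=
    sum_filter_mem _ s w y hwt ν (W := K.toSubmodule) (fun z hz => K.lie_mem hz) (hxs ▸ hx)
  have hmw : LieModule.toEnd ℂ TT (QuotModel (n : ℂ) lam) Th (∑ p ∈ s with w p = ν, y p) =
      ν • ∑ p ∈ s with w p = ν, y p := by
    rw [map_sum, Finset.smul_sum]
    refine Finset.sum_congr rfl fun p hp => ?_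
    rw [hwt p (Finset.mem_of_mem_filter p hp), (Finset.mem_filter.1 hp).2]
  obtain ⟨k, hk⟩ := exists_f_pow_eq_zero (∑ p ∈ s with w p = ν, y p)
  have := (isSl2Rep_TT (QuotModel (n : ℂ) lam)).mem_span_of_nilpotent (K := K.toSubmodule)
    (fun z hz => K.lie_mem hz) (fun z hz => K.lie_mem hz)
    (fun z hz μ hzμ => exists_pow_eq_zero_of_mem_locallyFinite hzμ hz) k hmem hmw hk
  refine Submodule.span_le.2 ?_ this
  rintro _ ⟨u, hu, j, μ, hh, hf, rfl⟩
  by_cases hu0 : u = 0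
  · rw [hu0, map_zero]; exact zero_mem _
  obtain ⟨b, c, hc, -, rfl⟩ := exists_eq_smul_mon hf hh hu0
  rw [map_smul]
  exact Submodule.smul_mem _ _ (Submodule.subset_span ⟨b, (mon_zero_mem_iff hlam b).1
    ((K.toSubmodule.smul_mem_iff hc).1 hu), j, rfl⟩)

/-- f is locally nilpotent, so a nonzero submodule contains a nonzero vector killed by f, a
combination of the y_i; these are separated by weight. -/
theorem exists_mon_mem (Q : LieSubmodule ℂ TT (QuotModel (n : ℂ) lam)) (hQ : Q ≠ ⊥) :
    ∃ i, mon (n : ℂ) lam i 0 ∈ Q := by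
  classical
  obtain ⟨x, hx, hx0⟩ := exists_mem_ne_zero hQ
  have hex := exists_f_pow_eq_zero x
  obtain ⟨k, hk⟩ := Nat.exists_eq_succ_of_ne_zero (n := Nat.find hex) fun h => hx0 <| by
    simpa [h] using Nat.find_spec hex
  set F := LieModule.toEnd ℂ TT (QuotModel (n : ℂ) lam) Tf with hF
  have h1 : (F ^ (k + 1)) x = 0 := by
    have := Nat.find_spec hex
    rwa [hk] at this
  have h2 : (F ^ k) x ≠ 0 := Nat.find_min hex (by omega)
  have h3 : (F ^ k) x ∈ Q := by
    clear h1 h2 hk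
    induction k with
    | zero => exact hx
    | succ k ih => rw [pow_succ', Module.End.mul_apply]; exact Q.lie_mem ih
  set z := (F ^ k) x with hz
  have hfz : ⁅Tf, z⁆ = 0 := by
    rw [hz, ← LieModule.toEnd_apply_apply ℂ, ← hF, ← Module.End.mul_apply, ← pow_succ', h1]
  have hc1 : ∀ b k, coeff b (k + 1) z = 0 := fun b k => by rw [← coeff_lie_f, hfz, map_zero]
  obtain ⟨i, hi⟩ : ∃ b, coeff b 0 z ≠ 0 := by
    by_contra! h
    exact h2 (eq_zero_of_coeff fun b k => by cases k with | zero => exact h b | succ k => exact hc1 b k)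
  refine ⟨i, ?_⟩
  set s := ((basis (n : ℂ) lam).repr z).support with hs
  set w : ℕ × ℕ → ℂ := fun p => n - 2 * p.1 + 2 * p.2 with hw
  set y : ℕ × ℕ → QuotModel (n : ℂ) lam := fun p => (basis (n : ℂ) lam).repr z p • mon _ _ p.1 p.2
    with hy
  have hzs : z = ∑ p ∈ s, y p := ((basis (n : ℂ) lam).linearCombination_repr z).symm
  have hwt : ∀ p ∈ s, LieModule.toEnd ℂ TT (QuotModel (n : ℂ) lam) Th (y p) = w p • y p := by
    intro p _
    rw [hy, map_smul, LieModule.toEnd_apply_apply, lie_h, smul_comm]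
  have hmem : ∑ p ∈ s with w p = w (i, 0), y p ∈ Q.toSubmodule :=
    sum_filter_mem _ s w y hwt _ (W := Q.toSubmodule) (fun z hz => Q.lie_mem hz) (hzs ▸ h3)
  rw [Finset.sum_eq_single (i, 0)] at hmem
  · exact (Q.toSubmodule.smul_mem_iff hi).1 hmem
  · rintro ⟨b, k⟩ hp hne
    rw [Finset.mem_filter] at hp
    rcases k with _ | k
    · have h4 : (b : ℂ) = i := by
        have := hp.2
        simp only [hw] at this
        linear_combination -this / 2
      exact absurd (by rw [show b = i by exact_mod_cast h4]) hne
    · exact absurd (hc1 b k) (Finsupp.mem_support_iff.1 hp.1)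
  · intro h
    exact (h (Finset.mem_filter.2 ⟨Finsupp.mem_support_iff.2 hi, rfl⟩)).elim

theorem mon_mem_of_mem (hlam : lam ≠ 0) (Q : LieSubmodule ℂ TT (QuotModel (n : ℂ) lam)) {i : ℕ}
    (hin : n ≤ i) (hi : mon (n : ℂ) lam i 0 ∈ Q) {k : ℕ} (hk : n ≤ k) :
    mon (n : ℂ) lam k 0 ∈ Q := by
  -- The descent stops at i = max(n, 0), which is where the factor i (i - n) first vanishes. From
  -- there f̄ reaches every y_k above.
  have hmin : mon (n : ℂ) lam n.toNat 0 ∈ Q := by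
    obtain ⟨d, hd⟩ : ∃ d, i = n.toNat + d := ⟨i - n.toNat, by omega⟩
    clear hk
    induction d generalizing i with
    | zero => rwa [hd] at hi
    | succ d ih =>
      refine ih (i := i - 1) (by omega) ?_ (by omega)
      have h1 : (lam ^ 2 * i * (i - n) : ℂ) • mon (n : ℂ) lam (i - 1) 0 ∈ Q := by
        rw [← lowering_identity]
        exact sub_mem (add_mem (Q.smul_mem _ (Q.lie_mem hi))
          (Q.smul_mem _ (Q.lie_mem (Q.lie_mem hi)))) (Q.lie_mem (Q.lie_mem (Q.lie_mem hi)))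
      refine (Q.toSubmodule.smul_mem_iff (mul_ne_zero (mul_ne_zero (pow_ne_zero 2 hlam) ?_) ?_)).1 h1
      · exact Nat.cast_ne_zero.2 (by omega)
      · rw [sub_ne_zero]
        exact_mod_cast (by omega : (i : ℤ) ≠ n)
  obtain ⟨d, rfl⟩ : ∃ d, k = n.toNat + d := ⟨k - n.toNat, by omega⟩
  clear hk
  induction d with
  | zero => exact hmin
  | succ d ih =>
    have := Q.lie_mem (x := Tfb) ih
    rwa [lie_fb] at this

theorem eq_of_le_locallyFinite (hlam : lam ≠ 0) (Q : LieSubmodule ℂ TT (QuotModel (n : ℂ) lam))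
    (hQ : Q ≠ ⊥) (hle : Q ≤ locallyFinite Te (QuotModel (n : ℂ) lam)) :
    locallyFinite Te (QuotModel (n : ℂ) lam) ≤ Q := by
  obtain ⟨i, hi⟩ := exists_mon_mem Q hQ
  have hin := (mon_zero_mem_iff hlam i).1 (hle hi)
  intro x hx
  have := mem_span_of_mem_locallyFinite hlam hx
  have hspan : Submodule.span ℂ {y | ∃ i : ℕ, n ≤ i ∧ ∃ j, y = ePow (mon (n : ℂ) lam i 0) j} ≤
      Q.toSubmodule := by
    rw [Submodule.span_le]
    rintro _ ⟨k, hk, j, rfl⟩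
    induction j with
    | zero => exact mon_mem_of_mem hlam Q hin hi hk
    | succ j ih => rw [ePow_succ]; exact Q.lie_mem ih
  exact hspan this

theorem isIrreducible_locallyFinite (hlam : lam ≠ 0) :
    LieModule.IsIrreducible ℂ TT (locallyFinite Te (QuotModel (n : ℂ) lam)) := by
  set K := locallyFinite Te (QuotModel (n : ℂ) lam) with hK
  have hy : mon (n : ℂ) lam n.toNat 0 ∈ K := (mon_zero_mem_iff hlam _).2 (by omega)
  have : Nontrivial K := ⟨⟨⟨_, hy⟩, 0, fun h =>
    (basis (n : ℂ) lam).ne_zero (n.toNat, 0) (congrArg Subtype.val h)⟩⟩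
  refine LieModule.IsIrreducible.mk fun Q hQ => ?_
  have hQ' : Q.map K.incl ≠ ⊥ := by
    obtain ⟨x, hx, hx0⟩ := exists_mem_ne_zero hQ
    intro h
    have h1 : K.incl x ∈ Q.map K.incl := LieSubmodule.mem_map_of_mem hx
    rw [h, LieSubmodule.mem_bot] at h1
    exact hx0 (Subtype.ext h1)
  have hle : K ≤ Q.map K.incl := eq_of_le_locallyFinite hlam _ hQ' (by
    intro x hx
    obtain ⟨y, -, rfl⟩ := (LieSubmodule.mem_map _).1 hx
    exact y.2)
  rw [eq_top_iff]
  rintro ⟨x, hx⟩ -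
  obtain ⟨y, hy, hyx⟩ := (LieSubmodule.mem_map _).1 (hle hx)
  have : y = ⟨x, hx⟩ := Subtype.ext hyx
  rwa [← this]

theorem isMinimalVector_mon {ε : ℤ} (hε : ε * ε = 1) (hn : ε * n.natAbs = n) :
    IsMinimalVector n.natAbs (ε * lam) (mon (n : ℂ) lam n.toNat 0) := by
  have hε' : (ε : ℂ) * ε = 1 := by exact_mod_cast hε
  have hn' : (ε : ℂ) * n.natAbs = n := by
    have := congrArg (Int.cast (R := ℂ)) hn
    rwa [Int.cast_mul, Int.cast_natCast] at this
  refine ⟨lie_f_zero _, ?_, fun x => ?_, fun x => ?_, ?_⟩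
  · rw [lie_h]
    have h1 : (n - 2 * n.toNat : ℤ) = -n.natAbs := by omega
    have h2 : ((n - 2 * n.toNat : ℤ) : ℂ) = ((-n.natAbs : ℤ) : ℂ) := by rw [h1]
    congr 1
    rw [Int.cast_neg, Int.cast_natCast] at h2
    rw [← h2]
    push_cast
    ring
  · rw [opC_eq]
    congr 1
    linear_combination (-lam ^ 2) * hε'
  · rw [opD_eq]
    congr 1
    linear_combination (-lam) * hn'
  · simp only [lie_e, lie_eb, lie_fb, lie_add, lie_smul, Nat.add_sub_cancel]
    -- For ε = 1 one has n ≥ 0 and the vector is y_n; for ε = -1 one has n ≤ 0 and it is y_0. Both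
    -- signs are allowed at n = 0.
    rcases Int.isUnit_iff.1 (IsUnit.of_mul_eq_one ε hε) with rfl | rfl
    · lift n to ℕ using (by omega)
      simp only [Int.natAbs_natCast, Int.toNat_natCast, Int.cast_natCast]
      push_cast
      module
    · obtain ⟨m, rfl⟩ : ∃ m : ℕ, n = -(m : ℤ) := ⟨n.natAbs, by omega⟩
      simp only [Int.natAbs_neg, Int.natAbs_natCast, Int.toNat_neg_natCast, Nat.zero_sub]
      push_cast
      module

end QuotModel

/-! ### Mapping properties of balanced tensor products and Verma modules. -/

section Tensor

attribute [local instance 100] LieRing.ofAssociativeRing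

variable {L : Type*} [LieRing L] [LieAlgebra ℂ L] {A : Type*} [Ring A] [Algebra ℂ A]
  {S : Type*} [AddCommGroup S] [Module ℂ S] [Module (UniversalEnvelopingAlgebra ℂ L) S]
  [IsScalarTower ℂ (UniversalEnvelopingAlgebra ℂ L) S]
  {M : Type*} [AddCommGroup M] [Module ℂ M]

namespace BalancedTensor

variable (ρ : Aᵐᵒᵖ →+* Module.End (UniversalEnvelopingAlgebra ℂ L) S)
  (σ : A →ₐ[ℂ] Module.End ℂ M)

/-- The quotient map. -/
noncomputable def mk : (S ⊗[ℂ] M) →ₗ[UniversalEnvelopingAlgebra ℂ L] BalancedTensor ρ σ :=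
  (balancedRel ρ σ).mkQ

theorem mk_surjective : Function.Surjective (mk ρ σ) := (balancedRel ρ σ).mkQ_surjective

/-- The class of an elementary tensor. -/
noncomputable def tmul (s : S) (m : M) : BalancedTensor ρ σ := mk ρ σ (s ⊗ₜ[ℂ] m)

variable {ρ σ}

theorem lie_tmul (z : L) (s : S) (m : M) :
    ⁅z, tmul ρ σ s m⁆ = tmul ρ σ (UniversalEnvelopingAlgebra.ι ℂ z • s) m := rfl

theorem smul_tmul (c : ℂ) (s : S) (m : M) : c • tmul ρ σ s m = tmul ρ σ s (c • m) := by
  change mk ρ σ (c • (s ⊗ₜ[ℂ] m)) = _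
  rw [TensorProduct.smul_tmul', TensorProduct.smul_tmul]
  rfl

theorem tmul_add (s : S) (m m' : M) : tmul ρ σ s (m + m') = tmul ρ σ s m + tmul ρ σ s m' := by
  rw [tmul, TensorProduct.tmul_add, map_add]; rfl

theorem zero_tmul (m : M) : tmul ρ σ 0 m = 0 := by
  rw [tmul, TensorProduct.zero_tmul, map_zero]

theorem tmul_zero (s : S) : tmul ρ σ s 0 = 0 := by
  rw [tmul, TensorProduct.tmul_zero, map_zero]

theorem tmul_balanced (s : S) (a : A) (m : M) :
    tmul ρ σ (ρ (MulOpposite.op a) s) m = tmul ρ σ s (σ a m) := by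
  rw [← sub_eq_zero, tmul, tmul, ← map_sub]
  refine (Submodule.Quotient.mk_eq_zero _).2 ?_
  exact Submodule.subset_span ⟨s, a, m, rfl⟩

theorem induction {p : BalancedTensor ρ σ → Prop} (zero : p 0) (tmul : ∀ s m, p (tmul ρ σ s m))
    (add : ∀ x y, p x → p y → p (x + y)) (x : BalancedTensor ρ σ) : p x := by
  obtain ⟨t, rfl⟩ := mk_surjective ρ σ x
  induction t using TensorProduct.induction_on with
  | zero => rw [map_zero]; exact zero
  | tmul s m => exact tmul s m
  | add a b ha hb => rw [map_add]; exact add _ _ ha hb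

variable {Q : Type*} [AddCommGroup Q] [Module ℂ Q] [LieRingModule L Q] [LieModule ℂ L Q]

theorem lift_aux (β : S →ₗ[ℂ] M →ₗ[ℂ] Q)
    (hβ : ∀ (z : L) s m, β (UniversalEnvelopingAlgebra.ι ℂ z • s) m = ⁅z, β s m⁆)
    (a : UniversalEnvelopingAlgebra ℂ L) (t : S ⊗[ℂ] M) :
    TensorProduct.lift β (a • t) = envAction L Q a (TensorProduct.lift β t) := by
  have h : ∀ s m, β (a • s) m = envAction L Q a (β s m) := by
    let B : Subalgebra ℂ (UniversalEnvelopingAlgebra ℂ L) :=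
      { carrier := {a | ∀ s m, β (a • s) m = envAction L Q a (β s m)}
        mul_mem' := fun {a b} ha hb s m => by
          rw [mul_smul, ha, hb, map_mul, Module.End.mul_apply]
        add_mem' := fun {a b} ha hb s m => by
          rw [add_smul, map_add, LinearMap.add_apply, ha, hb, map_add, LinearMap.add_apply]
        algebraMap_mem' := fun c s m => by
          rw [algebraMap_smul, map_smul, AlgHom.commutes, Module.algebraMap_end_apply,
            LinearMap.smul_apply] }
    exact uea_induction B (fun z s m => by rw [hβ, envAction_ι]) a
  induction t using TensorProduct.induction_on with
  | zero => simp
  | tmul s m => rw [TensorProduct.smul_tmul', TensorProduct.lift.tmul, TensorProduct.lift.tmul, h]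
  | add x y hx hy => rw [smul_add, map_add, hx, hy, map_add, map_add]

/-- The homomorphism given by a balanced bilinear map. -/
noncomputable def lift (β : S →ₗ[ℂ] M →ₗ[ℂ] Q)
    (hβ : ∀ (z : L) s m, β (UniversalEnvelopingAlgebra.ι ℂ z • s) m = ⁅z, β s m⁆)
    (hb : ∀ s a m, β (ρ (MulOpposite.op a) s) m = β s (σ a m)) :
    BalancedTensor ρ σ →ₗ⁅ℂ, L⁆ Q :=
  letI : Module (UniversalEnvelopingAlgebra ℂ L) Q :=
    Module.compHom Q (envAction L Q).toRingHom
  let g : (S ⊗[ℂ] M) →ₗ[UniversalEnvelopingAlgebra ℂ L] Q :=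
    { toFun := TensorProduct.lift β
      map_add' := map_add _
      map_smul' := lift_aux β hβ }
  have hg : balancedRel ρ σ ≤ LinearMap.ker g := by
    rw [balancedRel, Submodule.span_le]
    rintro _ ⟨s, a, m, rfl⟩
    change TensorProduct.lift β _ = 0
    rw [map_sub, TensorProduct.lift.tmul, TensorProduct.lift.tmul, hb, sub_self]
  { toFun := (balancedRel ρ σ).liftQ g hg
    map_add' := map_add _
    map_smul' := fun c x => by
      obtain ⟨t, rfl⟩ := mk_surjective ρ σ x
      exact map_smul (TensorProduct.lift β) c t
    map_lie' := fun {z x} => by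
      obtain ⟨t, rfl⟩ := mk_surjective ρ σ x
      exact (lift_aux β hβ (UniversalEnvelopingAlgebra.ι ℂ z) t).trans (envAction_ι z _) }

theorem lift_tmul (β : S →ₗ[ℂ] M →ₗ[ℂ] Q)
    (hβ : ∀ (z : L) s m, β (UniversalEnvelopingAlgebra.ι ℂ z • s) m = ⁅z, β s m⁆)
    (hb : ∀ s a m, β (ρ (MulOpposite.op a) s) m = β s (σ a m)) (s : S) (m : M) :
    lift β hβ hb (tmul ρ σ s m) = β s m :=
  TensorProduct.lift.tmul s m

end BalancedTensor

namespace Verma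

variable {b : LieSubalgebra ℂ L} {lam : LieAlgebra.LieCharacter ℂ b}

variable (b lam) in
/-- The highest weight vector of a Verma module. -/
noncomputable def vec : Verma b lam := BalancedTensor.tmul _ _ 1 1

theorem lie_vec (z : b) : ⁅(z : L), vec b lam⁆ = lam z • vec b lam := by
  rw [vec, BalancedTensor.lie_tmul, BalancedTensor.smul_tmul]
  have := BalancedTensor.tmul_balanced (ρ := (rightMul (L := L) (UniversalEnvelopingAlgebra.lift ℂ
      ((UniversalEnvelopingAlgebra.ι ℂ).comp b.incl)).toRingHom))
    (σ := ((Algebra.lmul ℂ ℂ).comp (UniversalEnvelopingAlgebra.lift ℂ lam))) 1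
    (UniversalEnvelopingAlgebra.ι ℂ z) 1
  convert this using 2
  · change _ = 1 * (UniversalEnvelopingAlgebra.lift ℂ
      ((UniversalEnvelopingAlgebra.ι ℂ).comp b.incl)) (UniversalEnvelopingAlgebra.ι ℂ z)
    rw [UniversalEnvelopingAlgebra.lift_ι_apply, one_mul, smul_eq_mul, mul_one]
    rfl
  · change _ = (UniversalEnvelopingAlgebra.lift ℂ lam) (UniversalEnvelopingAlgebra.ι ℂ z) * 1
    rw [UniversalEnvelopingAlgebra.lift_ι_apply]
    rfl

theorem mem_of_vec_mem (W : Submodule ℂ (Verma b lam)) (hW : ∀ (z : L), ∀ m ∈ W, ⁅z, m⁆ ∈ W)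
    (hv : vec b lam ∈ W) (x : Verma b lam) : x ∈ W := by
  induction x using BalancedTensor.induction with
  | zero => exact zero_mem _
  | add x y hx hy => exact add_mem hx hy
  | tmul a c =>
    have h : ∀ a : UniversalEnvelopingAlgebra ℂ L, ∀ x : Verma b lam,
        envAction L (Verma b lam) a x = a • x := by
      intro a
      let B : Subalgebra ℂ (UniversalEnvelopingAlgebra ℂ L) :=
        { carrier := {a | ∀ x : Verma b lam, envAction L (Verma b lam) a x = a • x}
          mul_mem' := fun {a b} ha hb x => by
            rw [map_mul, Module.End.mul_apply, ha, hb, mul_smul]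
          add_mem' := fun {a b} ha hb x => by
            rw [map_add, LinearMap.add_apply, ha, hb, add_smul]
          algebraMap_mem' := fun c x => by
            rw [AlgHom.commutes, Module.algebraMap_end_apply, algebraMap_smul] }
      exact uea_induction B (fun z x => by rw [envAction_ι]; rfl) a
    have h1 : BalancedTensor.tmul _ _ a c = c • a • vec b lam := by
      change _ = c • BalancedTensor.tmul _ _ (a * 1) 1
      rw [mul_one, BalancedTensor.smul_tmul, smul_eq_mul, mul_one]
    rw [h1, ← h]
    exact W.smul_mem _ (envAction_mem W hW a hv)

variable {Q : Type*} [AddCommGroup Q] [Module ℂ Q] [LieRingModule L Q] [LieModule ℂ L Q]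

/-- The homomorphism from a Verma module given by a vector of the right weight. -/
noncomputable def lift (q : Q) (hq : ∀ z : b, ⁅(z : L), q⁆ = lam z • q) :
    Verma b lam →ₗ⁅ℂ, L⁆ Q :=
  BalancedTensor.lift
    ((LinearMap.lsmul ℂ Q).flip.comp (((LinearMap.applyₗ q).comp
      (envAction L Q).toLinearMap : UniversalEnvelopingAlgebra ℂ L →ₗ[ℂ] Q)))
    (fun z s m => by
      change m • envAction L Q (UniversalEnvelopingAlgebra.ι ℂ z * s) q =
        ⁅z, m • envAction L Q s q⁆
      rw [map_mul, Module.End.mul_apply, envAction_ι, lie_smul])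
    (fun s a m => by
      change m • envAction L Q (s * UniversalEnvelopingAlgebra.lift ℂ
        ((UniversalEnvelopingAlgebra.ι ℂ).comp b.incl) a) q =
        (UniversalEnvelopingAlgebra.lift ℂ lam a * m) • envAction L Q s q
      have h : ∀ a, envAction L Q (UniversalEnvelopingAlgebra.lift ℂ
          ((UniversalEnvelopingAlgebra.ι ℂ).comp b.incl) a) q =
          UniversalEnvelopingAlgebra.lift ℂ lam a • q := by
        let B : Subalgebra ℂ (UniversalEnvelopingAlgebra ℂ b) :=
          { carrier := {a | envAction L Q (UniversalEnvelopingAlgebra.lift ℂ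
              ((UniversalEnvelopingAlgebra.ι ℂ).comp b.incl) a) q =
              UniversalEnvelopingAlgebra.lift ℂ lam a • q}
            mul_mem' := fun {a c} (ha : _ = _) (hc : _ = _) => by
              change _ = _
              rw [map_mul, map_mul, Module.End.mul_apply, hc, map_smul, ha, smul_smul, map_mul,
                mul_comm]
            add_mem' := fun {a c} (ha : _ = _) (hc : _ = _) => by
              change _ = _
              rw [map_add, map_add, LinearMap.add_apply, ha, hc, map_add, add_smul]
            algebraMap_mem' := fun c => by
              change _ = _
              rw [AlgHom.commutes, AlgHom.commutes, AlgHom.commutes, Module.algebraMap_end_apply]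
              rfl }
        exact fun a => uea_induction B (fun z => by
          change _ = _
          rw [UniversalEnvelopingAlgebra.lift_ι_apply, UniversalEnvelopingAlgebra.lift_ι_apply]
          exact (envAction_ι _ _).trans (hq z)) a
      rw [map_mul, Module.End.mul_apply, h, map_smul, smul_smul, mul_comm])

theorem lift_vec (q : Q) (hq : ∀ z : b, ⁅(z : L), q⁆ = lam z • q) :
    lift q hq (vec b lam) = q := by
  rw [lift, vec, BalancedTensor.lift_tmul]
  change (1 : ℂ) • envAction L Q 1 q = q
  rw [map_one, one_smul, Module.End.one_apply]

end Verma

end Tensor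

/-! ### The completion of a Verma module as locally finite vectors of the model. -/

section VermaTakiff

attribute [local instance 100] LieRing.ofAssociativeRing

variable {n lam : ℂ}

theorem Te_mem_borelT : Te ∈ borelT :=
  ⟨(by simp : sl2e.mat 1 0 = 0), (by simp : (0 : sl2).mat 1 0 = 0)⟩
theorem Th_mem_borelT : Th ∈ borelT :=
  ⟨(by simp : sl2h.mat 1 0 = 0), (by simp : (0 : sl2).mat 1 0 = 0)⟩
theorem Teb_mem_borelT : Teb ∈ borelT :=
  ⟨(by simp : (0 : sl2).mat 1 0 = 0), (by simp : sl2e.mat 1 0 = 0)⟩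
theorem Thb_mem_borelT : Thb ∈ borelT :=
  ⟨(by simp : (0 : sl2).mat 1 0 = 0), (by simp : sl2h.mat 1 0 = 0)⟩

theorem charT_apply (z : borelT) :
    charT n lam z = n * z.1.lev.mat 0 0 + lam * z.1.bar.mat 0 0 := rfl

variable (n lam) in
/-- The highest weight vector of `Δ(n, lam)`. -/
noncomputable def vermaVec : VermaT n lam := Verma.vec borelT (charT n lam)

theorem lie_e_vermaVec : ⁅Te, vermaVec n lam⁆ = 0 := by
  refine (Verma.lie_vec ⟨Te, Te_mem_borelT⟩).trans ?_
  rw [charT_apply]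
  simp [Te]

theorem lie_h_vermaVec : ⁅Th, vermaVec n lam⁆ = n • vermaVec n lam := by
  refine (Verma.lie_vec ⟨Th, Th_mem_borelT⟩).trans ?_
  rw [charT_apply]
  simp [Th, vermaVec]

theorem lie_eb_vermaVec : ⁅Teb, vermaVec n lam⁆ = 0 := by
  refine (Verma.lie_vec ⟨Teb, Teb_mem_borelT⟩).trans ?_
  rw [charT_apply]
  simp [Teb]

theorem lie_hb_vermaVec : ⁅Thb, vermaVec n lam⁆ = lam • vermaVec n lam := by
  refine (Verma.lie_vec ⟨Thb, Thb_mem_borelT⟩).trans ?_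
  rw [charT_apply]
  simp [Thb, vermaVec]

/-- The vectors `f ^ j u`. -/
noncomputable def fPow {M : Type*} [AddCommGroup M] [Module ℂ M] [LieRingModule TT M]
    [LieModule ℂ TT M] (u : M) (j : ℕ) : M := (LieModule.toEnd ℂ TT M Tf ^ j) u

theorem fPow_succ {M : Type*} [AddCommGroup M] [Module ℂ M] [LieRingModule TT M]
    [LieModule ℂ TT M] (u : M) (j : ℕ) : fPow u (j + 1) = ⁅Tf, fPow u j⁆ := by
  rw [fPow, pow_succ', Module.End.mul_apply]; rfl

/-- Only spanning is needed here: independence is read off later from the images in the model, so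
the Poincaré-Birkhoff-Witt theorem is not used. -/
theorem verma_mem_span (x : VermaT n lam) : x ∈ Submodule.span ℂ
    (Set.range fun p : ℕ × ℕ => fPow (fbPow (vermaVec n lam) p.2) p.1) := by
  set Z := Submodule.span ℂ
    (Set.range fun p : ℕ × ℕ => fPow (fbPow (vermaVec n lam) p.2) p.1) with hZ
  have hgen : ∀ a b, fPow (fbPow (vermaVec n lam) b) a ∈ Z := fun a b =>
    Submodule.subset_span ⟨(a, b), rfl⟩
  have hstab : ∀ z : TT, (∀ a b, ⁅z, fPow (fbPow (vermaVec n lam) b) a⁆ ∈ Z) →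
      ∀ x ∈ Z, ⁅z, x⁆ ∈ Z := fun z hz x hx => by
    have : Z ≤ Z.comap (LieModule.toEnd ℂ TT _ z) := by
      rw [hZ, Submodule.span_le]
      rintro _ ⟨⟨a, b⟩, rfl⟩
      exact hz a b
    exact this hx
  have hf : ∀ x ∈ Z, ⁅Tf, x⁆ ∈ Z := hstab Tf fun a b => by rw [← fPow_succ]; exact hgen _ _
  have hfb : ∀ x ∈ Z, ⁅Tfb, x⁆ ∈ Z := hstab Tfb fun a b => by
    have : ⁅Tfb, fPow (fbPow (vermaVec n lam) b) a⁆ = fPow (fbPow (vermaVec n lam) (b + 1)) a := by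
      induction a with
      | zero => exact (fbPow_succ _ b).symm
      | succ a ih => rw [fPow_succ, fPow_succ, ← ih, lie_ffb]
    rw [this]; exact hgen _ _
  have h0 : ∀ (z : TT), ⁅z, vermaVec n lam⁆ ∈ Z := by
    have hv : vermaVec n lam ∈ Z := hgen 0 0
    refine lie_mem_of_generators ?_ ?_ (hf _ hv) ?_ ?_ (hfb _ hv)
    · rw [lie_e_vermaVec]; exact zero_mem _
    · rw [lie_h_vermaVec]; exact Z.smul_mem _ hv
    · rw [lie_eb_vermaVec]; exact zero_mem _
    · rw [lie_hb_vermaVec]; exact Z.smul_mem _ hv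
  have h1 : ∀ b (z : TT), ⁅z, fbPow (vermaVec n lam) b⁆ ∈ Z := by
    intro b
    induction b with
    | zero => exact h0
    | succ b ih =>
      intro z
      rw [fbPow_succ, leibniz_lie]
      exact add_mem (ih _) (hfb _ (ih z))
  have h2 : ∀ a b (z : TT), ⁅z, fPow (fbPow (vermaVec n lam) b) a⁆ ∈ Z := by
    intro a b
    induction a with
    | zero => exact h1 b
    | succ a ih =>
      intro z
      rw [fPow_succ, leibniz_lie]
      exact add_mem (ih _) (hf _ (ih z))
  exact Verma.mem_of_vec_mem Z (fun z => hstab z fun a b => h2 a b z) (hgen 0 0) x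

namespace LocModel

theorem lie_borel (z : borelT) : ⁅(z : TT), mon n lam 0 0⁆ =
    charT (n - 2) lam z • mon n lam 0 0 := by
  obtain ⟨z, h1, h2⟩ := z
  have h1 : z.lev.mat 1 0 = 0 := h1
  have h2 : z.bar.mat 1 0 = 0 := h2
  rw [lie_decomp, lie_e, lie_h, lie_eb, lie_hb, h1, h2]
  simp only [formE, formH, formEb, formHb, charT]
  change _ = ((n - 2) * z.lev.mat 0 0 + lam * z.bar.mat 0 0) • mon n lam 0 0
  push_cast
  module

variable (n lam) in
/-- The embedding of the Verma module. -/
noncomputable def ofVerma : VermaT (n - 2) lam →ₗ⁅ℂ, TT⁆ LocModel n lam :=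
  Verma.lift (mon n lam 0 0) lie_borel

theorem ofVerma_vec : ofVerma n lam (vermaVec (n - 2) lam) = mon n lam 0 0 :=
  Verma.lift_vec _ _

theorem ofVerma_fbPow (b : ℕ) : ofVerma n lam (fbPow (vermaVec (n - 2) lam) b) = mon n lam b 0 := by
  induction b with
  | zero => exact ofVerma_vec
  | succ b ih => rw [fbPow_succ, LieModuleHom.map_lie, ih, lie_fb, formFb]

theorem proj_ofVerma (x : VermaT (n - 2) lam) : QuotModel.projHom n lam (ofVerma n lam x) = 0 := by
  let W := ((QuotModel.projHom n lam).comp (ofVerma n lam)).ker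
  refine Verma.mem_of_vec_mem W.toSubmodule (fun z m hm => W.lie_mem hm) ?_ x
  change QuotModel.projHom n lam (ofVerma n lam (vermaVec (n - 2) lam)) = 0
  rw [ofVerma_vec]
  exact (QuotModel.proj_mon 0 0).trans (QuotModel.zmon_of_nonneg 0 le_rfl)

/-- f shifts the integer exponent j by one. Its invertibility lets the action of U extend to U_(f)
by the universal property of the Ore localization. -/
theorem isUnit_f : IsUnit (LieModule.toEnd ℂ TT (LocModel n lam) Tf) := by
  refine ⟨⟨LieModule.toEnd ℂ TT (LocModel n lam) Tf, op n lam (fun b j => mon n lam b (j - 1)),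
    ?_, ?_⟩, rfl⟩
  · refine hom_ext fun b j => ?_
    rw [Module.End.mul_apply, op_mon, LieModule.toEnd_apply_apply, lie_f, formF, sub_add_cancel]
    rfl
  · refine hom_ext fun b j => ?_
    rw [Module.End.mul_apply, LieModule.toEnd_apply_apply, lie_f, formF, op_mon,
      add_sub_cancel_right]
    rfl

theorem isUnit_fPowers (s : fPowers) :
    IsUnit ((envAction TT (LocModel n lam)).toRingHom.toMonoidHom.comp fPowers.subtype s) := by
  obtain ⟨_, k, rfl⟩ := s
  change IsUnit (envAction TT (LocModel n lam) (UniversalEnvelopingAlgebra.ι ℂ Tf ^ k))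
  rw [map_pow]
  refine IsUnit.pow k ?_
  have : envAction TT (LocModel n lam) (UniversalEnvelopingAlgebra.ι ℂ Tf) =
      LieModule.toEnd ℂ TT (LocModel n lam) Tf := LinearMap.ext fun x => envAction_ι _ x
  rw [this]
  exact isUnit_f

variable (n lam) in
/-- The action of the localized enveloping algebra on the localized Verma module. -/
noncomputable def ufAction : Uf →+* Module.End ℂ (LocModel n lam) :=
  OreLocalization.universalHom (envAction TT (LocModel n lam)).toRingHom
    (IsUnit.liftRight ((envAction TT (LocModel n lam)).toRingHom.toMonoidHom.comp fPowers.subtype)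
      isUnit_fPowers)
    (fun _ => rfl)

theorem ufAction_toUf (a : UniversalEnvelopingAlgebra ℂ TT) :
    ufAction n lam (toUf a) = envAction TT (LocModel n lam) a :=
  OreLocalization.universalHom_commutes _ _ _

end LocModel

section Uf

variable (a : UniversalEnvelopingAlgebra ℂ TT)

theorem smul_eq_toUf_mul (s : Uf) : a • s = toUf a * s := by
  rw [← smul_one_eq_toUf, smul_mul_assoc, one_mul]

theorem complex_smul_eq_toUf_mul (c : ℂ) (s : Uf) :
    c • s = toUf (algebraMap ℂ (UniversalEnvelopingAlgebra ℂ TT) c) * s := by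
  rw [Algebra.smul_def]; rfl

/-- The element `f ^ (-k)` of the localization. -/
noncomputable def fInv (k : ℕ) : Uf :=
  (1 : UniversalEnvelopingAlgebra ℂ TT) /ₒ (⟨UniversalEnvelopingAlgebra.ι ℂ Tf ^ k, k, rfl⟩ : fPowers)

theorem exists_eq_fInv_mul (s : Uf) : ∃ k a, s = fInv k * toUf a := by
  induction s using OreLocalization.ind with
  | _ r s =>
    obtain ⟨_, k, rfl⟩ := s
    refine ⟨k, r, ?_⟩
    have := OreLocalization.mul_div_one (p := (1 : UniversalEnvelopingAlgebra ℂ TT)) (r := r)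
      (s := (⟨UniversalEnvelopingAlgebra.ι ℂ Tf ^ k, k, rfl⟩ : fPowers))
    rw [one_mul] at this
    exact this.symm

theorem fInv_mul_self (k : ℕ) : fInv k * toUf (UniversalEnvelopingAlgebra.ι ℂ Tf ^ k) = 1 := by
  refine (OreLocalization.mul_div_one (p := (1 : UniversalEnvelopingAlgebra ℂ TT))).trans ?_
  rw [one_mul]
  exact OreLocalization.div_eq_one' _

theorem fInv_add_mul (k d : ℕ) :
    fInv (k + d) * toUf (UniversalEnvelopingAlgebra.ι ℂ Tf ^ d) = fInv k := by
  have h : IsUnit (toUf (UniversalEnvelopingAlgebra.ι ℂ Tf ^ k)) :=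
    OreLocalization.numerator_isUnit (⟨_, k, rfl⟩ : fPowers)
  refine h.mul_left_injective ?_
  simp only
  rw [mul_assoc, ← map_mul, ← pow_add, add_comm d k, fInv_mul_self, fInv_mul_self]

end Uf

namespace LocModel

theorem f_pow_mon (k b : ℕ) (j : ℤ) :
    envAction TT (LocModel n lam) (UniversalEnvelopingAlgebra.ι ℂ Tf ^ k) (mon n lam b j) =
      mon n lam b (j + k) := by
  induction k with
  | zero => simp
  | succ k ih =>
    rw [pow_succ', map_mul, Module.End.mul_apply, ih, envAction_ι, lie_f, formF]
    congr 1; push_cast; ring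

theorem ufAction_fInv (k b : ℕ) (j : ℤ) :
    ufAction n lam (fInv k) (mon n lam b j) = mon n lam b (j - k) := by
  have h : mon n lam b j = envAction TT (LocModel n lam) (UniversalEnvelopingAlgebra.ι ℂ Tf ^ k)
      (mon n lam b (j - k)) := by rw [f_pow_mon, sub_add_cancel]
  rw [h, ← ufAction_toUf, ← Module.End.mul_apply, ← map_mul, fInv_mul_self, map_one]
  rfl

variable (n lam)

/-- The bilinear map `U_(f) × Δ → QuotModel`. -/
noncomputable def pairing : Uf →ₗ[ℂ] VermaT (n - 2) lam →ₗ[ℂ] QuotModel n lam where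
  toFun s := (QuotModel.proj n lam).comp
    ((ufAction n lam s).comp (ofVerma n lam : VermaT (n - 2) lam →ₗ[ℂ] LocModel n lam))
  map_add' s t := by
    ext m
    simp only [map_add, LinearMap.comp_apply, LinearMap.add_apply]
  map_smul' c s := by
    ext m
    rw [complex_smul_eq_toUf_mul, map_mul, ufAction_toUf, AlgHom.commutes]
    simp only [LinearMap.comp_apply, Module.End.mul_apply, Module.algebraMap_end_apply, map_smul,
      LinearMap.smul_apply, RingHom.id_apply]

variable {n lam}

theorem pairing_apply (s : Uf) (m : VermaT (n - 2) lam) :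
    pairing n lam s m = QuotModel.projHom n lam (ufAction n lam s (ofVerma n lam m)) := rfl

theorem pairing_mul_toUf (s : Uf) (a : UniversalEnvelopingAlgebra ℂ TT) (m : VermaT (n - 2) lam) :
    pairing n lam (s * toUf a) m = pairing n lam s (envAction TT _ a m) := by
  rw [pairing_apply, pairing_apply, map_mul, ufAction_toUf, envAction_map, Module.End.mul_apply]

theorem pairing_toUf_mul (s : Uf) (a : UniversalEnvelopingAlgebra ℂ TT) (m : VermaT (n - 2) lam) :
    pairing n lam (toUf a * s) m = envAction TT _ a (pairing n lam s m) := by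
  rw [pairing_apply, pairing_apply, map_mul, ufAction_toUf, Module.End.mul_apply, envAction_map]

/-- Elements of U keep the image of the Verma module inside the symbols with j ≥ 0, which the
projection kills. The pairing thus descends to S_f. -/
theorem Uimage_le_ker : Uimage.restrictScalars ℂ ≤ LinearMap.ker (pairing n lam) := by
  rintro _ ⟨a, rfl⟩
  rw [LinearMap.mem_ker, LinearMap.toSpanSingleton_apply, smul_one_eq_toUf]
  ext m
  rw [← one_mul (toUf a), pairing_mul_toUf, pairing_apply, map_one]
  exact proj_ofVerma _

variable (n lam) in
/-- The bilinear map `S_f × Δ → QuotModel`. -/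
noncomputable def sfPairing : Sf →ₗ[ℂ] VermaT (n - 2) lam →ₗ[ℂ] QuotModel n lam :=
  ((Uimage.restrictScalars ℂ).liftQ (pairing n lam) Uimage_le_ker).comp
    (Submodule.Quotient.restrictScalarsEquiv ℂ Uimage).symm.toLinearMap

theorem sfPairing_mk (s : Uf) (m : VermaT (n - 2) lam) :
    sfPairing n lam (Uimage.mkQ s) m = pairing n lam s m := rfl

variable (n lam) in
/-- The homomorphism `S_f ⊗ Δ → QuotModel`. -/
noncomputable def sfTensorHom : BalancedTensor SfRight (envAction TT (VermaT (n - 2) lam)) →ₗ⁅ℂ, TT⁆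
    QuotModel n lam :=
  BalancedTensor.lift (sfPairing n lam)
    (fun z s m => by
      obtain ⟨s, rfl⟩ := Uimage.mkQ_surjective s
      rw [← map_smul, smul_eq_toUf_mul, sfPairing_mk, sfPairing_mk, pairing_toUf_mul, envAction_ι])
    (fun s a m => by
      obtain ⟨s, rfl⟩ := Uimage.mkQ_surjective s
      exact pairing_mul_toUf s a m)

variable (n lam) in
/-- The class of `f ^ (-k) ⊗ f̄ ^ b v`. -/
noncomputable def sfVec (b k : ℕ) : BalancedTensor SfRight (envAction TT (VermaT (n - 2) lam)) :=
  BalancedTensor.tmul _ _ (Uimage.mkQ (fInv k)) (fbPow (vermaVec (n - 2) lam) b)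

theorem sfTensorHom_sfVec (b k : ℕ) :
    sfTensorHom n lam (sfVec n lam b (k + 1)) = QuotModel.mon n lam b k := by
  rw [sfVec, sfTensorHom, BalancedTensor.lift_tmul, sfPairing_mk, pairing_apply, ofVerma_fbPow,
    ufAction_fInv]
  exact (QuotModel.proj_mon b _).trans (QuotModel.zmon_eq b k (by push_cast; ring))

theorem sfVec_zero (b : ℕ) : sfVec n lam b 0 = 0 := by
  have : Uimage.mkQ (fInv 0) = 0 := by
    rw [Submodule.mkQ_apply, Submodule.Quotient.mk_eq_zero]
    refine ⟨1, ?_⟩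
    rw [LinearMap.toSpanSingleton_apply, one_smul]
    have := fInv_mul_self 0
    rw [pow_zero, map_one, mul_one] at this
    exact this.symm
  rw [sfVec, this, BalancedTensor.zero_tmul]

theorem envAction_f_pow {M : Type*} [AddCommGroup M] [Module ℂ M] [LieRingModule TT M]
    [LieModule ℂ TT M] (a : ℕ) (u : M) :
    envAction TT M (UniversalEnvelopingAlgebra.ι ℂ Tf ^ a) u = fPow u a := by
  induction a with
  | zero => rw [pow_zero, map_one]; rfl
  | succ a ih => rw [pow_succ', map_mul, Module.End.mul_apply, ih, envAction_ι, fPow_succ]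

theorem tmul_balanced (s : Uf) (a : UniversalEnvelopingAlgebra ℂ TT) (m : VermaT (n - 2) lam) :
    BalancedTensor.tmul SfRight (envAction TT (VermaT (n - 2) lam)) (Uimage.mkQ (s * toUf a)) m =
    BalancedTensor.tmul SfRight (envAction TT (VermaT (n - 2) lam)) (Uimage.mkQ s)
      (envAction TT _ a m) :=
  BalancedTensor.tmul_balanced (Uimage.mkQ s) a m

theorem mem_span_sfVec (x : BalancedTensor SfRight (envAction TT (VermaT (n - 2) lam))) :
    x ∈ Submodule.span ℂ (Set.range fun p : ℕ × ℕ => sfVec n lam p.1 (p.2 + 1)) := by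
  set Z := Submodule.span ℂ (Set.range fun p : ℕ × ℕ => sfVec n lam p.1 (p.2 + 1)) with hZ
  have hgen : ∀ b k, sfVec n lam b k ∈ Z := by
    rintro b (_ | k)
    · rw [sfVec_zero]; exact zero_mem _
    · exact Submodule.subset_span ⟨(b, k), rfl⟩
  have hgen' : ∀ a b k, BalancedTensor.tmul SfRight (envAction TT (VermaT (n - 2) lam))
      (Uimage.mkQ (fInv k)) (fPow (fbPow (vermaVec (n - 2) lam) b) a) ∈ Z := by
    intro a b k
    -- The factor f ^ a is carried to the left of the tensor sign: f ^ (a - k) is a negative power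
    -- when a < k, and lies in U, hence is zero in S_f, when a ≥ k.
    rw [← envAction_f_pow, ← tmul_balanced]
    rcases le_total a k with h | h
    · obtain ⟨d, rfl⟩ := Nat.exists_eq_add_of_le' h
      rw [fInv_add_mul]
      exact hgen b d
    · obtain ⟨d, rfl⟩ := Nat.exists_eq_add_of_le h
      have : Uimage.mkQ (fInv k * toUf (UniversalEnvelopingAlgebra.ι ℂ Tf ^ (k + d))) = 0 := by
        rw [pow_add, map_mul toUf, ← mul_assoc, fInv_mul_self, one_mul, Submodule.mkQ_apply,
          Submodule.Quotient.mk_eq_zero]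
        exact ⟨_, smul_one_eq_toUf _⟩
      rw [this, BalancedTensor.zero_tmul]
      exact zero_mem _
  induction x using BalancedTensor.induction with
  | zero => exact zero_mem _
  | add x y hx hy => exact add_mem hx hy
  | tmul s m =>
    obtain ⟨s, rfl⟩ := Uimage.mkQ_surjective s
    obtain ⟨k, a, rfl⟩ := exists_eq_fInv_mul s
    rw [tmul_balanced]
    have hm := verma_mem_span (envAction TT (VermaT (n - 2) lam) a m)
    generalize envAction TT (VermaT (n - 2) lam) a m = m' at hm
    induction hm using Submodule.span_induction with
    | mem y hy => obtain ⟨p, rfl⟩ := hy; exact hgen' _ _ _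
    | zero => rw [BalancedTensor.tmul_zero]; exact zero_mem _
    | add y z _ _ hy hz => rw [BalancedTensor.tmul_add]; exact add_mem hy hz
    | smul c y _ hy => rw [← BalancedTensor.smul_tmul]; exact Z.smul_mem c hy

/-- A spanning family of the tensor product is sent to the basis of the model, so the linear map `g`
in the other direction is a surjective right inverse. -/
theorem sfTensorHom_bijective : Function.Bijective (sfTensorHom n lam) := by
  let g : QuotModel n lam →ₗ[ℂ] BalancedTensor SfRight (envAction TT (VermaT (n - 2) lam)) :=
    (QuotModel.basis n lam).constr ℂ fun p => sfVec n lam p.1 (p.2 + 1)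
  have hg : ∀ b k, g (QuotModel.mon n lam b k) = sfVec n lam b (k + 1) := fun b k =>
    (QuotModel.basis n lam).constr_basis ℂ _ _
  have h1 : ∀ y, sfTensorHom n lam (g y) = y := by
    have : (sfTensorHom n lam : _ →ₗ[ℂ] _).comp g = LinearMap.id :=
      QuotModel.hom_ext fun b k => by
        rw [LinearMap.comp_apply, hg]
        exact sfTensorHom_sfVec b k
    exact LinearMap.congr_fun this
  have h2 : Function.Surjective g := by
    rw [← LinearMap.range_eq_top, eq_top_iff]
    intro x _
    refine Submodule.span_le.2 ?_ (mem_span_sfVec x)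
    rintro _ ⟨p, rfl⟩
    exact ⟨_, hg p.1 p.2⟩
  refine ⟨fun x y hxy => ?_, fun y => ⟨_, h1 y⟩⟩
  obtain ⟨x, rfl⟩ := h2 x
  obtain ⟨y, rfl⟩ := h2 y
  rw [h1, h1] at hxy
  rw [hxy]

end LocModel

theorem map_mem_locallyFinite {L : Type*} [LieRing L] [LieAlgebra ℂ L]
    [FiniteDimensional ℂ L] {x : L} {M M' : Type*} [AddCommGroup M] [Module ℂ M]
    [LieRingModule L M] [LieModule ℂ L M] [AddCommGroup M'] [Module ℂ M'] [LieRingModule L M']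
    [LieModule ℂ L M'] (φ : M →ₗ⁅ℂ, L⁆ M') {m : M} (hm : m ∈ locallyFinite x M) :
    φ m ∈ locallyFinite x M' := by
  have : FiniteDimensional ℂ (orbitSpan x m) := hm
  refine finiteDimensional_orbitSpan_of_le ((orbitSpan x m).map (φ : M →ₗ[ℂ] M'))
    ⟨m, self_mem_orbitSpan x m, rfl⟩ ?_
  rintro _ ⟨w, hw, rfl⟩
  exact ⟨⁅x, w⁆, lie_mem_orbitSpan x m w hw, φ.map_lie x w⟩

/-- The restriction of an isomorphism to the locally finite vectors. -/
noncomputable def locallyFiniteEquiv {L : Type*} [LieRing L] [LieAlgebra ℂ L]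
    [FiniteDimensional ℂ L] (x : L) {M M' : Type*} [AddCommGroup M] [Module ℂ M]
    [LieRingModule L M] [LieModule ℂ L M] [AddCommGroup M'] [Module ℂ M'] [LieRingModule L M']
    [LieModule ℂ L M'] (φ : M ≃ₗ⁅ℂ, L⁆ M') : locallyFinite x M ≃ₗ⁅ℂ, L⁆ locallyFinite x M' :=
  { LinearEquiv.ofSubmodules φ.toLinearEquiv (locallyFinite x M).toSubmodule
      (locallyFinite x M').toSubmodule (by
        ext m
        constructor
        · rintro ⟨w, hw, rfl⟩
          exact map_mem_locallyFinite φ.toLieModuleHom hw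
        · intro hm
          exact ⟨φ.symm m, map_mem_locallyFinite φ.symm.toLieModuleHom hm,
            φ.apply_symm_apply m⟩) with
    map_lie' := fun {z m} => Subtype.ext (φ.toLieModuleHom.map_lie z m) }

variable (n lam) in
/-- `EA(Δ(n - 2, lam))` as the space of locally finite vectors of `QuotModel`. -/
noncomputable def eaEquiv :
    EA (VermaT (n - 2) lam) ≃ₗ⁅ℂ, TT⁆ locallyFinite Te (QuotModel n lam) :=
  locallyFiniteEquiv Te (lieEquivOfBijective (LocModel.sfTensorHom n lam)
    LocModel.sfTensorHom_bijective)

end VermaTakiff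

/-! ### Simple sl₂-modules generated by lowest weight vectors. -/

section LowestWeight

attribute [local instance 100] LieRing.ofAssociativeRing

theorem map_toEnd_pow {L : Type*} [LieRing L] [LieAlgebra ℂ L]
    {M M' : Type*} [AddCommGroup M] [Module ℂ M]
    [LieRingModule L M] [LieModule ℂ L M] [AddCommGroup M'] [Module ℂ M'] [LieRingModule L M']
    [LieModule ℂ L M'] (φ : M →ₗ⁅ℂ, L⁆ M') (z : L) (j : ℕ) (x : M) :
    φ ((LieModule.toEnd ℂ L M z ^ j) x) = (LieModule.toEnd ℂ L M' z ^ j) (φ x) := by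
  induction j with
  | zero => rfl
  | succ j ih =>
    rw [pow_succ', pow_succ', Module.End.mul_apply, Module.End.mul_apply, ← ih]
    exact φ.map_lie _ _

/-- The span of the `e ^ j x`, for a lowest weight vector `x`, is stable. -/
theorem IsSl2Rep.mem_span_e_pow {M : Type*} [AddCommGroup M] [Module ℂ M] {e h f : Module.End ℂ M}
    (H : IsSl2Rep e h f) {x : M} {μ : ℂ} (hx : h x = μ • x) (hf : f x = 0) {y : M}
    (hy : y ∈ Submodule.span ℂ (Set.range fun j : ℕ => (e ^ j) x)) :
    e y ∈ Submodule.span ℂ (Set.range fun j : ℕ => (e ^ j) x) ∧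
    h y ∈ Submodule.span ℂ (Set.range fun j : ℕ => (e ^ j) x) ∧
    f y ∈ Submodule.span ℂ (Set.range fun j : ℕ => (e ^ j) x) := by
  set W := Submodule.span ℂ (Set.range fun j : ℕ => (e ^ j) x) with hW
  have hmem : ∀ j, (e ^ j) x ∈ W := fun j => Submodule.subset_span ⟨j, rfl⟩
  have key : W ≤ W.comap e ⊓ W.comap h ⊓ W.comap f := by
    rw [hW, Submodule.span_le]
    rintro _ ⟨j, rfl⟩
    refine ⟨⟨?_, ?_⟩, ?_⟩
    · change e ((e ^ j) x) ∈ W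
      rw [← Module.End.mul_apply, ← pow_succ']
      exact hmem _
    · change h ((e ^ j) x) ∈ W
      rw [H.h_e_pow hx]
      exact W.smul_mem _ (hmem _)
    · change f ((e ^ j) x) ∈ W
      rcases j with _ | j
      · rw [pow_zero, Module.End.one_apply, hf]; exact zero_mem _
      · rw [H.f_e_pow hx hf]
        exact W.smul_mem _ (hmem _)
  exact ⟨(key hy).1.1, (key hy).1.2, (key hy).2⟩

/-- A vector of weight `-m` that generates a simple `sl₂`-module of dimension `m + 1`. -/
structure IsLowest {W : Type*} [AddCommGroup W] [Module ℂ W] [LieRingModule sl2 W]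
    [LieModule ℂ sl2 W] (m : ℕ) (u : W) : Prop where
  ne_zero : u ≠ 0
  lie_f : ⁅sl2f, u⁆ = 0
  lie_h : ⁅sl2h, u⁆ = (-m : ℂ) • u
  e_pow : (LieModule.toEnd ℂ sl2 W sl2e ^ (m + 1)) u = 0

variable {W : Type*} [AddCommGroup W] [Module ℂ W] [LieRingModule sl2 W] [LieModule ℂ sl2 W]
  {W' : Type*} [AddCommGroup W'] [Module ℂ W'] [LieRingModule sl2 W'] [LieModule ℂ sl2 W']

/-- The submodule spanned by the `e ^ j u` for a lowest weight vector `u`. -/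
noncomputable def eSpan {u : W} {μ : ℂ} (hu : ⁅sl2h, u⁆ = μ • u) (hf : ⁅sl2f, u⁆ = 0) :
    LieSubmodule ℂ sl2 W :=
  { Submodule.span ℂ (Set.range fun j : ℕ => (LieModule.toEnd ℂ sl2 W sl2e ^ j) u) with
    lie_mem := fun {z x} hx => by
      obtain ⟨h1, h2, h3⟩ := (isSl2Rep_sl2 W).mem_span_e_pow hu hf hx
      rw [sl2_lie_decomp]
      exact add_mem (add_mem (Submodule.smul_mem _ _ h1) (Submodule.smul_mem _ _ h2))
        (Submodule.smul_mem _ _ h3) }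

/-- The submodule spanned by the `f ^ j u` for a highest weight vector `u`. -/
noncomputable def fSpan {u : W} {μ : ℂ} (hu : ⁅sl2h, u⁆ = μ • u) (he : ⁅sl2e, u⁆ = 0) :
    LieSubmodule ℂ sl2 W :=
  { Submodule.span ℂ (Set.range fun j : ℕ => (LieModule.toEnd ℂ sl2 W sl2f ^ j) u) with
    lie_mem := fun {z x} hx => by
      obtain ⟨h1, h2, h3⟩ := (isSl2Rep_sl2 W).symm.mem_span_e_pow (μ := -μ)
        (by rw [LinearMap.neg_apply, LieModule.toEnd_apply_apply, hu, neg_smul]) he hx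
      rw [sl2_lie_decomp]
      exact add_mem (add_mem (Submodule.smul_mem _ _ h3) (Submodule.smul_mem _ _
        (neg_mem_iff.1 h2))) (Submodule.smul_mem _ _ h1) }

namespace IsLowest

theorem map {m : ℕ} {u : W} (H : IsLowest m u) (φ : W →ₗ⁅ℂ, sl2⁆ W') (h : φ u ≠ 0) :
    IsLowest m (φ u) where
  ne_zero := h
  lie_f := by rw [← φ.map_lie, H.lie_f, map_zero]
  lie_h := by rw [← φ.map_lie, H.lie_h, map_smul]
  e_pow := by rw [← map_toEnd_pow, H.e_pow, map_zero]

theorem of_map {m : ℕ} {u : W} (φ : W →ₗ⁅ℂ, sl2⁆ W') (hφ : Function.Injective φ)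
    (H : IsLowest m (φ u)) : IsLowest m u where
  ne_zero := fun h => H.ne_zero (by rw [h, map_zero])
  lie_f := hφ (by rw [φ.map_lie, H.lie_f, map_zero])
  lie_h := hφ (by rw [φ.map_lie, H.lie_h, map_smul])
  e_pow := hφ (by rw [map_toEnd_pow, H.e_pow, map_zero])

variable {m : ℕ} {u : W} (H : IsLowest m u)
include H

/-- The simple submodule generated by `u`. -/
noncomputable def span : LieSubmodule ℂ sl2 W := eSpan H.lie_h H.lie_f

omit H in
theorem mem_span_iff (H : IsLowest m u) {x : W} : x ∈ H.span ↔
    x ∈ Submodule.span ℂ (Set.range fun j : ℕ => (LieModule.toEnd ℂ sl2 W sl2e ^ j) u) := Iff.rfl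

theorem self_mem_span : u ∈ H.span := Submodule.subset_span ⟨0, rfl⟩

theorem span_le {N : LieSubmodule ℂ sl2 W} (h : u ∈ N) : H.span ≤ N := by
  intro x hx
  suffices hle : H.span.toSubmodule ≤ N.toSubmodule from hle hx
  refine Submodule.span_le.2 ?_
  rintro _ ⟨j, rfl⟩
  induction j with
  | zero => exact h
  | succ j ih =>
    simp only [pow_succ', Module.End.mul_apply]
    exact N.lie_mem ih

theorem finiteDimensional_span : FiniteDimensional ℂ H.span := by
  have hle : H.span.toSubmodule ≤ Submodule.span ℂ (Set.range fun j : Fin (m + 1) =>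
      (LieModule.toEnd ℂ sl2 W sl2e ^ (j : ℕ)) u) := by
    refine Submodule.span_le.2 ?_
    rintro _ ⟨j, rfl⟩
    by_cases hj : j < m + 1
    · exact Submodule.subset_span ⟨⟨j, hj⟩, rfl⟩
    · obtain ⟨d, rfl⟩ := Nat.exists_eq_add_of_le' (not_lt.1 hj)
      simp only [pow_add _ d, Module.End.mul_apply, H.e_pow, map_zero]
      exact zero_mem _
  have := FiniteDimensional.span_of_finite ℂ (Set.finite_range fun j : Fin (m + 1) =>
      (LieModule.toEnd ℂ sl2 W sl2e ^ (j : ℕ)) u)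
  exact Submodule.finiteDimensional_of_le hle

/-- By `IsSl2Rep.mem_of_sum_e_pow`, powers of f bring any nonzero vector of the span back to a
nonzero multiple of `u`. -/
theorem isIrreducible_span : LieModule.IsIrreducible ℂ sl2 H.span := by
  have hnt : Nontrivial (LieSubmodule ℂ sl2 H.span) := by
    refine ⟨⊥, ⊤, fun h => H.ne_zero ?_⟩
    have h1 : (⟨u, H.self_mem_span⟩ : H.span) ∈ (⊥ : LieSubmodule ℂ sl2 H.span) :=
      h ▸ LieSubmodule.mem_top _
    exact congrArg Subtype.val ((LieSubmodule.mem_bot _).1 h1)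
  refine ⟨fun Q => or_iff_not_imp_left.2 fun hQ => ?_⟩
  obtain ⟨⟨y, hy⟩, hyQ, hy0⟩ := exists_mem_ne_zero hQ
  have hu : u ∈ (Q.map H.span.incl) := by
    refine (isSl2Rep_sl2 W).mem_of_sum_e_pow H.lie_h H.lie_f H.e_pow
      (W := (Q.map H.span.incl).toSubmodule) (fun x hx => LieSubmodule.lie_mem _ hx) (y := y)
      ⟨⟨y, hy⟩, hyQ, rfl⟩ (fun h => hy0 (Subtype.ext h)) (H.mem_span_iff.1 hy)
  rw [eq_top_iff]
  rintro ⟨x, hx⟩ -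
  obtain ⟨z, hz, hzx⟩ := (LieSubmodule.mem_map x).1 (H.span_le hu hx)
  exact (Subtype.ext hzx : z = ⟨x, hx⟩) ▸ hz

theorem span_eq_top [LieModule.IsIrreducible ℂ sl2 W] : H.span = ⊤ :=
  (IsSimpleOrder.eq_bot_or_eq_top H.span).resolve_left fun h => H.ne_zero <| by
    have := H.self_mem_span
    rwa [h, LieSubmodule.mem_bot] at this

theorem casimir_eq {x : W} (hx : x ∈ H.span) :
    IsSl2Rep.casimir (LieModule.toEnd ℂ sl2 W sl2e) (LieModule.toEnd ℂ sl2 W sl2h)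
      (LieModule.toEnd ℂ sl2 W sl2f) x = ((m * (m + 2) : ℕ) : ℂ) • x := by
  set C := IsSl2Rep.casimir (LieModule.toEnd ℂ sl2 W sl2e) (LieModule.toEnd ℂ sl2 W sl2h)
      (LieModule.toEnd ℂ sl2 W sl2f)
  suffices h : H.span.toSubmodule ≤ Module.End.eigenspace C ((m * (m + 2) : ℕ) : ℂ) from
    Module.End.mem_eigenspace_iff.1 (h hx)
  refine Submodule.span_le.2 ?_
  rintro _ ⟨j, rfl⟩
  refine Module.End.mem_eigenspace_iff.2 ?_
  induction j with
  | zero =>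
    refine (IsSl2Rep.casimir_lowest H.lie_h H.lie_f).trans ?_
    congr 1
    push_cast
    ring
  | succ j ih =>
    simp only [pow_succ', Module.End.mul_apply]
    rw [(isSl2Rep_sl2 W).casimir_e, ih, map_smul]

/-- The Casimir eigenvalue m(m + 2) determines the natural number m. -/
theorem eq_of_mem_span {m' : ℕ} {u' : W} (H' : IsLowest m' u') (h : u' ∈ H.span) : m' = m := by
  have h1 := H.casimir_eq h
  rw [H'.casimir_eq H'.self_mem_span] at h1
  have h2 := smul_left_injective ℂ H'.ne_zero h1
  have h3 : m' * (m' + 2) = m * (m + 2) := by exact_mod_cast h2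
  nlinarith [Nat.lt_trichotomy m m', h3, Nat.le_total m m']

end IsLowest

/-- Finite-dimensional modules have lowest weight vectors. -/
theorem exists_isLowest (W : Type*) [AddCommGroup W] [Module ℂ W] [LieRingModule sl2 W]
    [LieModule ℂ sl2 W] [FiniteDimensional ℂ W] [Nontrivial W] :
    ∃ (m : ℕ) (u : W), IsLowest m u := by
  classical
  obtain ⟨μ, hμ⟩ := Module.End.exists_eigenvalue (LieModule.toEnd ℂ sl2 W sl2h)
  obtain ⟨x, hx⟩ := hμ.exists_hasEigenvector
  have hh := Module.End.mem_eigenspace_iff.1 hx.1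
  have S := isSl2Rep_sl2 W
  have hex : ∃ k, (LieModule.toEnd ℂ sl2 W sl2f ^ k) x = 0 :=
    S.symm.exists_e_pow_eq_zero (μ := -μ) (by rw [LinearMap.neg_apply, hh, neg_smul]) ⊤
      fun _ => Submodule.mem_top
  obtain ⟨k, hk⟩ : ∃ k, Nat.find hex = k + 1 := by
    refine Nat.exists_eq_succ_of_ne_zero fun h => hx.2 ?_
    simpa [h] using Nat.find_spec hex
  have h1 : (LieModule.toEnd ℂ sl2 W sl2f ^ (k + 1)) x = 0 := hk ▸ Nat.find_spec hex
  have h2 : (LieModule.toEnd ℂ sl2 W sl2f ^ k) x ≠ 0 := Nat.find_min hex (by omega)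
  rw [pow_succ', Module.End.mul_apply] at h1
  obtain ⟨N, hN⟩ := S.exists_e_pow_eq_zero (S.h_f_pow hh k) ⊤ fun _ => Submodule.mem_top
  obtain ⟨l, hl, h3, -⟩ := S.exists_nat (S.h_f_pow hh k) h1 h2 hN
  exact ⟨l, _, h2, h1, (S.h_f_pow hh k).trans (by rw [hl]), h3⟩

end LowestWeight

/-! ### Modules with trivial action of the ideal. -/

section Inflation

variable {W : Type*} [AddCommGroup W] [Module ℂ W] [LieRingModule sl2 W] [LieModule ℂ sl2 W]
  {W' : Type*} [AddCommGroup W'] [Module ℂ W'] [LieRingModule sl2 W'] [LieModule ℂ sl2 W']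

/-- An element of `W` as an element of the inflation. -/
def toInfl (x : W) : Infl W := x

omit [Module ℂ W] [LieModule ℂ sl2 W] in
theorem lie_Infl_eq_zero {z : TT} (hz : z.lev = 0) (x : Infl W) : ⁅z, x⁆ = 0 := by
  have h : ∀ x : W, ⁅z.lev, x⁆ = 0 := by rw [hz]; exact zero_lie
  exact h x

theorem opC_Infl (x : Infl W) : opC (Infl W) x = 0 := by
  have h : ∀ (z : TT) (y : Infl W), z.lev = 0 → ⁅z, y⁆ = 0 := fun z y hz => lie_Infl_eq_zero hz y
  rw [opC_apply, h Thb _ rfl, h Tfb _ rfl, smul_zero, add_zero]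

omit [LieModule ℂ sl2 W] in
theorem isIrreducible_Infl [hW : LieModule.IsIrreducible ℂ sl2 W] :
    LieModule.IsIrreducible ℂ TT (Infl W) := by
  have hnt : Nontrivial (LieSubmodule ℂ TT (Infl W)) := by
    have : Nontrivial W := (LieSubmodule.nontrivial_iff ℂ sl2 W).1 inferInstance
    exact (LieSubmodule.nontrivial_iff ℂ TT (Infl W)).2 this
  refine ⟨fun Q => ?_⟩
  let Q' : LieSubmodule ℂ sl2 W :=
    { carrier := {x | toInfl x ∈ Q}
      add_mem' := fun ha hb => Q.add_mem ha hb
      zero_mem' := Q.zero_mem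
      smul_mem' := fun c _ ha => Q.smul_mem c ha
      lie_mem := fun {a x} hx => Q.lie_mem (x := Takiff.incl sl2 a) hx }
  rcases IsSimpleOrder.eq_bot_or_eq_top Q' with h | h
  · left
    rw [eq_bot_iff]
    intro x hx
    have : ∀ x : W, toInfl x ∈ Q → x = 0 := fun x (hx : x ∈ Q') => by
      rwa [h, LieSubmodule.mem_bot] at hx
    exact (LieSubmodule.mem_bot _).2 (this x hx)
  · right
    rw [eq_top_iff]
    intro x _
    have : ∀ x : W, x ∈ Q' := fun x => h ▸ LieSubmodule.mem_top x
    exact this x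

theorem IsLowest.isMinimalVector {m : ℕ} {u : W} (H : IsLowest m u) :
    IsMinimalVector m 0 (toInfl u) := by
  have h : ∀ (z : TT) (y : Infl W), z.lev = 0 → ⁅z, y⁆ = 0 := fun z y hz => lie_Infl_eq_zero hz y
  refine ⟨H.lie_f, H.lie_h, fun x => ?_, fun x => ?_, ?_⟩
  · rw [opC_Infl]; simp
  · rw [opD_apply, h Thb _ rfl, h Tfb _ rfl, h Teb _ rfl]; simp
  · rw [h Tfb _ rfl, h Teb _ rfl]; simp

/-- The uniqueness theorem for Takiff modules, applied to the inflations with λ = 0, contains the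
one for simple sl₂-modules. -/
theorem IsLowest.nonempty_equiv [LieModule.IsIrreducible ℂ sl2 W] [LieModule.IsIrreducible ℂ sl2 W']
    {m : ℕ} {u : W} {u' : W'} (H : IsLowest m u) (H' : IsLowest m u') :
    Nonempty (W ≃ₗ⁅ℂ, sl2⁆ W') := by
  have := isIrreducible_Infl (W := W)
  have := isIrreducible_Infl (W := W')
  obtain ⟨φ⟩ := H.isMinimalVector.nonempty_equiv H'.isMinimalVector H.ne_zero H'.ne_zero
  let ψ : W →ₗ⁅ℂ, sl2⁆ W' :=
    { toFun := fun x => φ (toInfl x)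
      map_add' := fun x y => map_add φ.toLinearEquiv (toInfl x) (toInfl y)
      map_smul' := fun c x => map_smul φ.toLinearEquiv c (toInfl x)
      map_lie' := fun {a x} => φ.toLieModuleHom.map_lie (Takiff.incl sl2 a) (toInfl x) }
  exact ⟨lieEquivOfBijective ψ φ.toLinearEquiv.bijective⟩

end Inflation

/-! ### The modules L(n) as quotients of Verma modules, and sl₂-types. -/

section SimpleModules

attribute [local instance 100] LieRing.ofAssociativeRing

/-- An element of `V` as an element of the restriction. -/
def toRes {V : Type*} [AddCommGroup V] [Module ℂ V] : V ≃ₗ[ℂ] Res V := LinearEquiv.refl ℂ V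

section Verma

variable {n : ℂ}

theorem sl2e_mem_borelSl2 : sl2e ∈ borelSl2 := (by simp : sl2e.mat 1 0 = 0)
theorem sl2h_mem_borelSl2 : sl2h ∈ borelSl2 := (by simp : sl2h.mat 1 0 = 0)

theorem char_apply (z : borelSl2) : char n z = n * z.1.mat 0 0 := rfl

variable (n) in
/-- The highest weight vector of the Verma module of `sl₂`. -/
noncomputable def sl2Vec : VermaSl2 n := Verma.vec borelSl2 (char n)

theorem lie_e_sl2Vec : ⁅sl2e, sl2Vec n⁆ = 0 := by
  refine (Verma.lie_vec ⟨sl2e, sl2e_mem_borelSl2⟩).trans ?_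
  rw [char_apply]
  simp

theorem lie_h_sl2Vec : ⁅sl2h, sl2Vec n⁆ = n • sl2Vec n := by
  refine (Verma.lie_vec ⟨sl2h, sl2h_mem_borelSl2⟩).trans ?_
  rw [char_apply]
  simp [sl2Vec]

theorem eq_top_of_sl2Vec_mem {N : LieSubmodule ℂ sl2 (VermaSl2 n)} (h : sl2Vec n ∈ N) : N = ⊤ :=
  eq_top_iff.2 fun x _ => Verma.mem_of_vec_mem N.toSubmodule (fun _ _ hm => N.lie_mem hm) h x

theorem sl2Verma_mem_span (x : VermaSl2 n) : x ∈ Submodule.span ℂ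
    (Set.range fun j : ℕ => (LieModule.toEnd ℂ sl2 _ sl2f ^ j) (sl2Vec n)) := by
  have h : fSpan (lie_h_sl2Vec (n := n)) lie_e_sl2Vec = ⊤ :=
    eq_top_of_sl2Vec_mem (Submodule.subset_span ⟨0, rfl⟩)
  have h2 : x ∈ fSpan (lie_h_sl2Vec (n := n)) lie_e_sl2Vec := h ▸ LieSubmodule.mem_top x
  exact h2

/-- The sl₂-Verma module is realized on the symbols f ^ j of the Takiff model. The shift to n + 2
compensates the n - 2 built into that model. -/
theorem LocModel.lie_borelSl2 (z : borelSl2) :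
    ⁅(z : sl2), toRes (mon (n + 2) 0 0 0)⁆ = char n z • toRes (mon (n + 2) 0 0 0) := by
  have h := lie_borel (n := n + 2) (lam := 0)
    ⟨Takiff.incl sl2 z, z.2, borelSl2.zero_mem⟩
  refine h.trans ?_
  rw [charT_apply, char_apply, add_sub_cancel_right, zero_mul, add_zero]
  rfl

variable (n) in
/-- The embedding of the Verma module of `sl₂`. -/
noncomputable def LocModel.ofSl2 : VermaSl2 n →ₗ⁅ℂ, sl2⁆ Res (LocModel (n + 2) 0) :=
  Verma.lift (toRes (mon (n + 2) 0 0 0)) lie_borelSl2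

theorem LocModel.ofSl2_f_pow (j : ℕ) : ofSl2 n ((LieModule.toEnd ℂ sl2 _ sl2f ^ j) (sl2Vec n)) =
    toRes (mon (n + 2) 0 0 j) := by
  rw [map_toEnd_pow, sl2Vec, ofSl2, Verma.lift_vec]
  induction j with
  | zero => rfl
  | succ j ih =>
    rw [pow_succ', Module.End.mul_apply, ih]
    refine (LocModel.lie_f 0 j).trans ?_
    rw [formF, Nat.cast_succ]
    rfl

variable (n) in
/-- The coefficient of the highest weight vector. -/
noncomputable def vecCoeff : VermaSl2 n →ₗ[ℂ] ℂ :=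
  ((LocModel.basis (n + 2) 0).coord (0, 0)).comp
    (toRes.symm.toLinearMap.comp (LocModel.ofSl2 n : _ →ₗ[ℂ] _))

theorem vecCoeff_f_pow (j : ℕ) :
    vecCoeff n ((LieModule.toEnd ℂ sl2 _ sl2f ^ j) (sl2Vec n)) = if j = 0 then 1 else 0 := by
  change (LocModel.basis (n + 2) 0).coord (0, 0) (toRes.symm (LocModel.ofSl2 n _)) = _
  rw [LocModel.ofSl2_f_pow, LinearEquiv.symm_apply_apply, LocModel.mon, Module.Basis.coord_apply,
    Module.Basis.repr_self, Finsupp.single_apply]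
  simp

/-- A submodule contains the weight components of its elements. A nonzero coefficient at the highest
weight vector would put that generator into the submodule. -/
theorem vecCoeff_eq_zero {N : LieSubmodule ℂ sl2 (VermaSl2 n)} (hN : N ≠ ⊤) {x : VermaSl2 n}
    (hx : x ∈ N) : vecCoeff n x = 0 := by
  by_contra h0
  refine hN (eq_top_of_sl2Vec_mem ?_)
  obtain ⟨c, rfl⟩ := Finsupp.mem_span_range_iff_exists_finsupp.1 (sl2Verma_mem_span x)
  have hw : ∀ j ∈ c.support, LieModule.toEnd ℂ sl2 (VermaSl2 n) sl2h
      (c j • (LieModule.toEnd ℂ sl2 _ sl2f ^ j) (sl2Vec n)) =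
      (n - 2 * j) • c j • (LieModule.toEnd ℂ sl2 _ sl2f ^ j) (sl2Vec n) := fun j _ => by
    rw [map_smul, (isSl2Rep_sl2 _).h_f_pow lie_h_sl2Vec, smul_comm]
  have h1 := sum_filter_mem _ c.support (fun j => n - 2 * j) _ hw n (W := N.toSubmodule)
    (fun x hx => N.lie_mem hx) hx
  have h2 : ∀ j : ℕ, (n - 2 * j = n) ↔ j = 0 := fun j => by
    rw [sub_eq_self, mul_eq_zero, Nat.cast_eq_zero]; simp
  simp only [h2, Finset.filter_eq'] at h1
  have h3 : vecCoeff n (c.sum fun j a => a • (LieModule.toEnd ℂ sl2 _ sl2f ^ j) (sl2Vec n)) =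
      c 0 := by
    rw [Finsupp.sum, map_sum]
    simp only [map_smul, vecCoeff_f_pow]
    simpa using Eq.symm
  rw [h3] at h0
  rw [if_pos (Finsupp.mem_support_iff.2 h0), Finset.sum_singleton, pow_zero] at h1
  exact (N.toSubmodule.smul_mem_iff h0).1 h1

variable (n) in
/-- The largest proper submodule of the Verma module. -/
noncomputable abbrev maxSubmodule : LieSubmodule ℂ sl2 (VermaSl2 n) := sSup {N | N ≠ ⊤}

theorem vecCoeff_maxSubmodule {x : VermaSl2 n} (hx : x ∈ maxSubmodule n) : vecCoeff n x = 0 := by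
  have h : (maxSubmodule n).toSubmodule ≤ LinearMap.ker (vecCoeff n) := by
    rw [LieSubmodule.sSup_toSubmodule]
    refine sSup_le ?_
    rintro _ ⟨N, hN, rfl⟩ y hy
    exact vecCoeff_eq_zero hN hy
  exact h hx

/-- All proper submodules lie in the kernel of one nonzero functional, hence so does their sum. -/
theorem maxSubmodule_ne_top : maxSubmodule n ≠ ⊤ := fun h => by
  have h1 := vecCoeff_maxSubmodule (n := n) (x := sl2Vec n) (h ▸ LieSubmodule.mem_top _)
  have h2 := vecCoeff_f_pow (n := n) 0
  rw [pow_zero, Module.End.one_apply, h1] at h2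
  simp at h2

theorem isIrreducible_SimpleL : LieModule.IsIrreducible ℂ sl2 (SimpleL n) := by
  have hnt : Nontrivial (LieSubmodule ℂ sl2 (SimpleL n)) := by
    refine (LieSubmodule.nontrivial_iff ℂ sl2 _).2 ?_
    refine Submodule.Quotient.nontrivial_iff.2 fun h => maxSubmodule_ne_top (n := n) ?_
    exact (LieSubmodule.toSubmodule_eq_top _).1 h
  refine ⟨fun Q => ?_⟩
  by_cases h : Q.comap (LieSubmodule.Quotient.mk' (maxSubmodule n)) = ⊤
  · right
    rw [eq_top_iff]
    intro x _
    obtain ⟨y, rfl⟩ := LieSubmodule.Quotient.surjective_mk' (maxSubmodule n) x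
    have : y ∈ Q.comap (LieSubmodule.Quotient.mk' (maxSubmodule n)) := h ▸ LieSubmodule.mem_top y
    exact this
  · left
    rw [eq_bot_iff]
    intro x hx
    obtain ⟨y, rfl⟩ := LieSubmodule.Quotient.surjective_mk' (maxSubmodule n) x
    have hy : y ∈ maxSubmodule n := le_sSup (a := Q.comap _) h hx
    exact (LieSubmodule.mem_bot _).2 ((LieSubmodule.Quotient.mk_eq_zero _).2 hy)

end Verma

theorem exists_isLowest_SimpleL (n : ℕ) : ∃ u : SimpleL (n : ℂ), IsLowest n u := by
  set v := sl2Vec (n : ℂ) with hv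
  have S := isSl2Rep_sl2 (VermaSl2 (n : ℂ))
  have hvh : (-LieModule.toEnd ℂ sl2 (VermaSl2 (n : ℂ)) sl2h) v = (-n : ℂ) • v := by
    rw [LinearMap.neg_apply, LieModule.toEnd_apply_apply, lie_h_sl2Vec, neg_smul]
  set F := LieModule.toEnd ℂ sl2 (VermaSl2 (n : ℂ)) sl2f with hF
  set E := LieModule.toEnd ℂ sl2 (VermaSl2 (n : ℂ)) sl2e with hE
  have hve : E v = 0 := lie_e_sl2Vec
  -- The vector f ^ (n + 1) v is killed by e, so it generates only higher powers of f applied to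
  -- `v`, a proper submodule.
  have h1 : (F ^ (n + 1)) v ∈ maxSubmodule (n : ℂ) := by
    have he : ⁅sl2e, (F ^ (n + 1)) v⁆ = 0 := by
      refine (S.symm.f_e_pow hvh hve n).trans ?_
      rw [neg_add_cancel, mul_zero, neg_zero, zero_smul]
    refine le_sSup (a := fSpan (S.h_f_pow lie_h_sl2Vec (n + 1)) he) ?_
      (Submodule.subset_span ⟨0, rfl⟩)
    intro htop
    have hmem : v ∈ fSpan (S.h_f_pow lie_h_sl2Vec (n + 1)) he := htop ▸ LieSubmodule.mem_top v
    have hle : (fSpan (S.h_f_pow lie_h_sl2Vec (n + 1)) he).toSubmodule ≤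
        LinearMap.ker (vecCoeff (n : ℂ)) := by
      refine Submodule.span_le.2 ?_
      rintro _ ⟨j, rfl⟩
      change vecCoeff (n : ℂ) ((F ^ j) ((F ^ (n + 1)) v)) = 0
      rw [← Module.End.mul_apply, ← pow_add, vecCoeff_f_pow, if_neg (by omega)]
    have h2 : vecCoeff (n : ℂ) v = 0 := hle hmem
    have h3 := vecCoeff_f_pow (n := (n : ℂ)) 0
    rw [pow_zero, Module.End.one_apply, h2] at h3
    simp at h3
  -- The power e ^ n returns f ^ n v to a nonzero multiple of the generator `v`.
  have h2 : (F ^ n) v ∉ maxSubmodule (n : ℂ) := by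
    intro hmem
    obtain ⟨c, hc, hcv⟩ := S.symm.f_pow_e_pow hvh hve n (fun i hi => by
      have : (i : ℂ) ≠ n := by exact_mod_cast hi.ne
      rw [neg_add_eq_sub]; exact sub_ne_zero.2 this)
    have h3 : ∀ k, (E ^ k) ((F ^ n) v) ∈ maxSubmodule (n : ℂ) := fun k => by
      induction k with
      | zero => exact hmem
      | succ k ih =>
        rw [pow_succ', Module.End.mul_apply]
        exact LieSubmodule.lie_mem _ ih
    have h4 := h3 n
    rw [hcv] at h4
    exact maxSubmodule_ne_top (eq_top_of_sl2Vec_mem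
      (((maxSubmodule (n : ℂ)).toSubmodule.smul_mem_iff hc).1 h4))
  refine ⟨LieSubmodule.Quotient.mk' (maxSubmodule (n : ℂ)) ((F ^ n) v), ?_, ?_, ?_, ?_⟩
  · exact fun h => h2 ((LieSubmodule.Quotient.mk_eq_zero _).1 h)
  · rw [← LieModuleHom.map_lie]
    refine (LieSubmodule.Quotient.mk_eq_zero _).2 ?_
    rw [pow_succ', Module.End.mul_apply] at h1
    exact h1
  · rw [← LieModuleHom.map_lie, ← map_smul]
    refine congrArg _ ((S.h_f_pow lie_h_sl2Vec n).trans ?_)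
    congr 1
    ring
  · rw [← map_toEnd_pow]
    rw [show (LieModule.toEnd ℂ sl2 (VermaSl2 (n : ℂ)) sl2e ^ (n + 1)) ((F ^ n) v) = 0 from
      S.symm.f_pow_e_pow_eq_zero hvh hve (Nat.lt_succ_self n), map_zero]

theorem finiteDimensional_SimpleL (n : ℕ) : FiniteDimensional ℂ (SimpleL (n : ℂ)) := by
  obtain ⟨u, H⟩ := exists_isLowest_SimpleL n
  have := isIrreducible_SimpleL (n := (n : ℂ))
  have h := H.finiteDimensional_span
  rw [H.span_eq_top] at h
  exact Module.Finite.equiv (LinearEquiv.ofTop (⊤ : Submodule ℂ (SimpleL (n : ℂ))) rfl)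

section FiniteDimensional

variable {W : Type*} [AddCommGroup W] [Module ℂ W] [LieRingModule sl2 W] [LieModule ℂ sl2 W]

theorem IsLowest.nonempty_equiv_SimpleL [LieModule.IsIrreducible ℂ sl2 W] {m : ℕ} {u : W}
    (H : IsLowest m u) : Nonempty (W ≃ₗ⁅ℂ, sl2⁆ SimpleL (m : ℂ)) := by
  obtain ⟨u', H'⟩ := exists_isLowest_SimpleL m
  have := isIrreducible_SimpleL (n := (m : ℂ))
  exact H.nonempty_equiv H'

theorem exists_isLowest_of_isIrreducible [LieModule.IsIrreducible ℂ sl2 W]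
    [FiniteDimensional ℂ W] : ∃ (m : ℕ) (u : W), IsLowest m u := by
  have : Nontrivial W := (LieSubmodule.nontrivial_iff ℂ sl2 W).1 inferInstance
  exact exists_isLowest W

/-- The finite-dimensional simple `sl₂`-modules are the `L(n)`. -/
theorem exists_equiv_SimpleL [LieModule.IsIrreducible ℂ sl2 W] [FiniteDimensional ℂ W] :
    ∃ n : ℕ, Nonempty (W ≃ₗ⁅ℂ, sl2⁆ SimpleL (n : ℂ)) := by
  obtain ⟨m, u, H⟩ := exists_isLowest_of_isIrreducible (W := W)
  exact ⟨m, H.nonempty_equiv_SimpleL⟩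

end FiniteDimensional

variable {V : Type*} [AddCommGroup V] [Module ℂ V] [LieRingModule TT V] [LieModule ℂ TT V]

/-- The `sl₂`-types of `V` correspond to its lowest weight vectors. -/
theorem hasType_iff {m : ℕ} : HasType V m ↔ ∃ u : Res V, IsLowest m u := by
  constructor
  · rintro ⟨W, ⟨φ⟩⟩
    obtain ⟨u, H⟩ := exists_isLowest_SimpleL m
    have h1 : IsLowest m (φ.symm u) := H.map φ.symm.toLieModuleHom fun h => H.ne_zero <| by
      have := congrArg φ h
      rwa [show φ.symm.toLieModuleHom u = φ.symm u from rfl, φ.apply_symm_apply,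
        show φ 0 = 0 from map_zero φ.toLinearEquiv] at this
    exact ⟨_, h1.map W.incl fun h => h1.ne_zero (Subtype.ext h)⟩
  · rintro ⟨u, H⟩
    have := H.isIrreducible_span
    refine ⟨H.span, ?_⟩
    have h1 : IsLowest m (⟨u, H.self_mem_span⟩ : H.span) :=
      IsLowest.of_map H.span.incl Subtype.val_injective H
    exact h1.nonempty_equiv_SimpleL

end SimpleModules

/-! ### A criterion for Harish-Chandra modules. -/

section Criterion

attribute [local instance 100] LieRing.ofAssociativeRing

theorem isIrreducible_of_equiv {L : Type*} [LieRing L] [LieAlgebra ℂ L]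
    {M M' : Type*} [AddCommGroup M] [Module ℂ M]
    [LieRingModule L M] [LieModule ℂ L M] [AddCommGroup M'] [Module ℂ M'] [LieRingModule L M']
    [LieModule ℂ L M'] (φ : M ≃ₗ⁅ℂ, L⁆ M') [LieModule.IsIrreducible ℂ L M'] :
    LieModule.IsIrreducible ℂ L M := by
  have hnt : Nontrivial (LieSubmodule ℂ L M) := by
    have : Nontrivial M' := (LieSubmodule.nontrivial_iff ℂ L M').1 inferInstance
    exact (LieSubmodule.nontrivial_iff ℂ L M).2 φ.toLinearEquiv.toEquiv.nontrivial
  refine ⟨fun Q => ?_⟩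
  rcases IsSimpleOrder.eq_bot_or_eq_top (Q.comap φ.symm.toLieModuleHom) with h | h
  · left
    rw [eq_bot_iff]
    intro x hx
    have : φ x ∈ Q.comap φ.symm.toLieModuleHom := by
      change φ.symm (φ x) ∈ Q
      rwa [φ.symm_apply_apply]
    rw [h, LieSubmodule.mem_bot] at this
    rw [LieSubmodule.mem_bot]
    exact φ.toLinearEquiv.map_eq_zero_iff.1 this
  · right
    rw [eq_top_iff]
    intro x _
    have : φ x ∈ Q.comap φ.symm.toLieModuleHom := h ▸ LieSubmodule.mem_top _
    have h2 : φ.symm (φ x) ∈ Q := this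
    rwa [φ.symm_apply_apply] at h2

variable {V : Type*} [AddCommGroup V] [Module ℂ V] [LieRingModule TT V] [LieModule ℂ TT V]
  {V' : Type*} [AddCommGroup V'] [Module ℂ V'] [LieRingModule TT V'] [LieModule ℂ TT V']

/-- The restriction of a homomorphism to `sl₂`. -/
def resHom (φ : V →ₗ⁅ℂ, TT⁆ V') : Res V →ₗ⁅ℂ, sl2⁆ Res V' :=
  { (φ : V →ₗ[ℂ] V') with
    map_lie' := fun {a x} => φ.map_lie (Takiff.incl sl2 a) x }

theorem toRes_ePow (u : V) (j : ℕ) :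
    (LieModule.toEnd ℂ sl2 (Res V) sl2e ^ j) (toRes u) = toRes (ePow u j) := by
  induction j with
  | zero => rfl
  | succ j ih =>
    rw [pow_succ', Module.End.mul_apply, ih, ePow_succ]
    rfl

theorem isLowest_toRes_iff {m : ℕ} {u : V} : IsLowest m (toRes u) ↔
    u ≠ 0 ∧ ⁅Tf, u⁆ = 0 ∧ ⁅Th, u⁆ = (-m : ℂ) • u ∧ ePow u (m + 1) = 0 :=
  ⟨fun H => ⟨H.ne_zero, H.lie_f, H.lie_h, by
      have := H.e_pow
      rwa [toRes_ePow, LinearEquiv.map_eq_zero_iff] at this⟩,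
    fun ⟨h0, hf, hh, he⟩ => ⟨h0, hf, hh, by rw [toRes_ePow, he, map_zero]⟩⟩

/-- Lowest weight vectors of pairwise different weights that generate `V` over `sl₂` show that `V`
is a Harish-Chandra module. -/
theorem isHarishChandra_of_isLowest {ι : Type*} {l : ι → ℕ} (hl : Function.Injective l)
    {u : ι → Res V} (H : ∀ i, IsLowest (l i) (u i))
    (hspan : ∀ N : LieSubmodule ℂ sl2 (Res V), (∀ i, u i ∈ N) → N = ⊤) : IsHarishChandra V := by
  refine ⟨Set.range fun i => (H i).span, ?_, ?_, ?_, ?_⟩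
  · rintro _ ⟨i, rfl⟩
    exact ⟨(H i).isIrreducible_span, (H i).finiteDimensional_span⟩
  · refine iSupIndep.sSupIndep_range ?_
    refine LieSubmodule.iSupIndep_toSubmodule.1 ?_
    -- The summands lie in Casimir eigenspaces for l(l + 2), and these eigenvalues are distinct for
    -- distinct l.
    have h1 := (Module.End.eigenspaces_iSupIndep (IsSl2Rep.casimir
      (LieModule.toEnd ℂ sl2 (Res V) sl2e) (LieModule.toEnd ℂ sl2 (Res V) sl2h)
      (LieModule.toEnd ℂ sl2 (Res V) sl2f))).comp (f := fun i => ((l i * (l i + 2) : ℕ) : ℂ)) (by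
        intro i j hij
        have h3 : l i * (l i + 2) = l j * (l j + 2) := Nat.cast_injective hij
        exact hl (by nlinarith [Nat.le_total (l i) (l j)]))
    exact h1.mono fun i x hx => Module.End.mem_eigenspace_iff.2 ((H i).casimir_eq hx)
  · refine hspan _ fun i => ?_
    exact (le_sSup (Set.mem_range_self i) : (H i).span ≤ _) (H i).self_mem_span
  · rintro _ ⟨i, rfl⟩
    refine (Set.finite_singleton (H i).span).subset ?_
    rintro _ ⟨⟨j, rfl⟩, ⟨φ⟩⟩
    have h1 : IsLowest (l j) (⟨u j, (H j).self_mem_span⟩ : (H j).span) :=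
      IsLowest.of_map (H j).span.incl Subtype.val_injective (H j)
    have h2 := h1.map φ.toLieModuleHom fun h => h1.ne_zero (φ.toLinearEquiv.map_eq_zero_iff.1 h)
    have h3 := h2.map (H i).span.incl fun h => h2.ne_zero (Subtype.ext h)
    rw [hl ((H i).eq_of_mem_span h3 (Subtype.prop _))]
    rfl

theorem IsMinimalVector.of_map {m : ℕ} {lam : ℂ} {u : V} (φ : V →ₗ⁅ℂ, TT⁆ V')
    (hφ : Function.Injective φ) (H : IsMinimalVector m lam (φ u)) : IsMinimalVector m lam u where
  lie_f := hφ (by rw [φ.map_lie, H.lie_f, map_zero])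
  lie_h := hφ (by rw [φ.map_lie, H.lie_h, map_smul])
  opC_eq x := hφ (by rw [opC_map, H.opC_eq, map_smul])
  opD_eq x := hφ (by rw [opD_map, H.opD_eq, map_smul])
  lie_eb := hφ (by
    simp only [map_add, map_smul, φ.map_lie]
    exact H.lie_eb)

end Criterion

/-! ### Simplicity, types and isomorphisms of the modules V(n, λ). -/

section Completion

variable {V : Type*} [AddCommGroup V] [Module ℂ V] [LieRingModule TT V] [LieModule ℂ TT V]
  {V' : Type*} [AddCommGroup V'] [Module ℂ V'] [LieRingModule TT V'] [LieModule ℂ TT V']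

/-- An embedding of `V` in `QuotModel` as the space of locally finite vectors. -/
structure IsCompletion {n : ℤ} {lam : ℂ} (φ : V →ₗ⁅ℂ, TT⁆ QuotModel (n : ℂ) lam) : Prop where
  injective : Function.Injective φ
  mem : ∀ x, φ x ∈ locallyFinite Te (QuotModel (n : ℂ) lam)
  exists_eq : ∀ y ∈ locallyFinite Te (QuotModel (n : ℂ) lam), ∃ x, φ x = y

namespace IsCompletion

variable {n : ℤ} {lam : ℂ}

omit [LieModule ℂ TT V] in
theorem of_equiv (ψ : V ≃ₗ⁅ℂ, TT⁆ locallyFinite Te (QuotModel (n : ℂ) lam)) :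
    IsCompletion ((locallyFinite Te (QuotModel (n : ℂ) lam)).incl.comp ψ.toLieModuleHom) where
  injective := Subtype.val_injective.comp ψ.toLinearEquiv.injective
  mem x := (ψ x).2
  exists_eq y hy := ⟨ψ.symm ⟨y, hy⟩, congrArg Subtype.val (ψ.apply_symm_apply ⟨y, hy⟩)⟩

variable {φ : V →ₗ⁅ℂ, TT⁆ QuotModel (n : ℂ) lam} (Φ : IsCompletion φ)
include Φ

theorem opC_eq (x : V) : opC V x = lam ^ 2 • x :=
  Φ.injective (by rw [opC_map, QuotModel.opC_eq, map_smul])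

theorem opD_eq (x : V) : opD V x = (n * lam) • x :=
  Φ.injective (by rw [opD_map, QuotModel.opD_eq, map_smul])

theorem isIrreducible (hlam : lam ≠ 0) : LieModule.IsIrreducible ℂ TT V := by
  have := QuotModel.isIrreducible_locallyFinite (n := n) hlam
  let ψ : V →ₗ⁅ℂ, TT⁆ locallyFinite Te (QuotModel (n : ℂ) lam) :=
    { toFun := fun x => ⟨φ x, Φ.mem x⟩
      map_add' := fun x y => Subtype.ext (map_add φ x y)
      map_smul' := fun c x => Subtype.ext (map_smul φ c x)
      map_lie' := fun {z x} => Subtype.ext (φ.map_lie z x) }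
  refine isIrreducible_of_equiv (lieEquivOfBijective ψ ⟨fun x y h => ?_, fun y => ?_⟩)
  · exact Φ.injective (congrArg Subtype.val h)
  · obtain ⟨x, hx⟩ := Φ.exists_eq y y.2
    exact ⟨x, Subtype.ext hx⟩

theorem exists_isLowest (hlam : lam ≠ 0) {i l : ℕ} (hi : n ≤ i) (hl : (l : ℤ) = 2 * i - n) :
    ∃ x : V, φ x = QuotModel.mon (n : ℂ) lam i 0 ∧ IsLowest l (toRes x) := by
  obtain ⟨x, hx⟩ := Φ.exists_eq _ ((QuotModel.mon_zero_mem_iff hlam i).2 hi)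
  refine ⟨x, hx, IsLowest.of_map (resHom φ) Φ.injective ?_⟩
  have h : IsLowest l (toRes (QuotModel.mon (n : ℂ) lam i 0)) := by
    refine isLowest_toRes_iff.2 ⟨?_, QuotModel.lie_f_zero i, ?_, QuotModel.e_pow_mon_zero hi hl⟩
    · exact (QuotModel.basis (n : ℂ) lam).ne_zero _
    · rw [QuotModel.lie_h_mon_zero]
      congr 1
      have : (l : ℂ) = 2 * i - n := by exact_mod_cast hl
      rw [this]; ring
  rw [← hx] at h
  exact h

theorem isHarishChandra (hlam : lam ≠ 0) : IsHarishChandra V := by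
  have hex : ∀ i : {i : ℕ // n ≤ i}, ∃ x : V, φ x = QuotModel.mon (n : ℂ) lam i 0 ∧
      IsLowest (2 * i - n : ℤ).toNat (toRes x) :=
    fun i => Φ.exists_isLowest hlam i.2 (Int.toNat_of_nonneg (by have := i.2; omega))
  choose x hx H using hex
  -- The types are L(2i - n) for i ≥ n, each occurring once.
  refine isHarishChandra_of_isLowest (l := fun i : {i : ℕ // n ≤ i} => (2 * i - n : ℤ).toNat)
    ?_ H ?_
  · rintro ⟨i, hi⟩ ⟨j, hj⟩ hij
    exact Subtype.ext (by simp only at hij ⊢; omega)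
  · intro N hN
    rw [eq_top_iff]
    intro y _
    have h1 := QuotModel.mem_span_of_mem_locallyFinite hlam (Φ.mem y)
    let P : Submodule ℂ (QuotModel (n : ℂ) lam) :=
      (N.toSubmodule.comap (toRes : V ≃ₗ[ℂ] Res V).toLinearMap).map (φ : V →ₗ[ℂ] QuotModel (n : ℂ) lam)
    have h2 : φ y ∈ P := by
      refine Submodule.span_le.2 ?_ h1
      rintro _ ⟨i, hi, j, rfl⟩
      refine ⟨ePow (x ⟨i, hi⟩) j, ?_, (map_toEnd_pow φ Te j _).trans (by rw [hx]; rfl)⟩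
      change toRes (ePow _ j) ∈ N
      rw [← toRes_ePow]
      induction j with
      | zero => exact hN _
      | succ j ih =>
        rw [pow_succ', Module.End.mul_apply]
        exact N.lie_mem ih
    obtain ⟨z, hz, hzy⟩ := h2
    exact Φ.injective hzy ▸ hz

/-- A lowest weight vector of type m is a multiple of some y_b with b ≥ max(n, 0) and m = 2b - n.
Thus m ≥ |n|, with equality at b = max(n, 0). -/
theorem isMinimalType (hlam : lam ≠ 0) : IsMinimalType V n.natAbs := by
  refine ⟨hasType_iff.2 ?_, fun m hm => ?_⟩
  · obtain ⟨x, -, H⟩ := Φ.exists_isLowest hlam (i := n.toNat) (l := n.natAbs) (by omega) (by omega)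
    exact ⟨_, H⟩
  · obtain ⟨u, H⟩ := hasType_iff.1 hm
    have H' : IsLowest m (toRes (φ (toRes.symm u))) :=
      H.map (resHom φ) fun h => H.ne_zero (Φ.injective (h.trans (map_zero φ).symm))
    obtain ⟨h0, hf, hh, -⟩ := isLowest_toRes_iff.1 H'
    obtain ⟨b, c, hc, hμ, hx⟩ := QuotModel.exists_eq_smul_mon hf hh h0
    have h1 := Φ.mem (toRes.symm u)
    rw [hx] at h1
    have h2 := (QuotModel.mon_zero_mem_iff hlam b).1
      (((locallyFinite Te (QuotModel (n : ℂ) lam)).toSubmodule.smul_mem_iff hc).1 h1)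
    have h3 : ((-m : ℤ) : ℂ) = ((n - 2 * b : ℤ) : ℂ) := by push_cast; exact hμ
    have h4 : (-m : ℤ) = n - 2 * b := by exact_mod_cast h3
    omega

theorem exists_isMinimalVector (hlam : lam ≠ 0) {ε : ℤ} (hε : ε * ε = 1)
    (hn : ε * n.natAbs = n) : ∃ u : V, u ≠ 0 ∧ IsMinimalVector n.natAbs (ε * lam) u := by
  obtain ⟨x, hx, H⟩ := Φ.exists_isLowest hlam (i := n.toNat) (l := n.natAbs) (by omega) (by omega)
  refine ⟨x, H.ne_zero, IsMinimalVector.of_map φ Φ.injective ?_⟩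
  rw [hx]
  exact QuotModel.isMinimalVector_mon hε hn

/-- An isomorphism preserves the scalars λ² and nλ of C̄ and D, which determine (n, λ) up to a
common sign. Conversely, the minimal vectors of (n, λ) and (-n, -λ) have the same parameters (|n|,
ελ). -/
theorem nonempty_equiv_iff {n' : ℤ} {lam' : ℂ} {φ' : V' →ₗ⁅ℂ, TT⁆ QuotModel (n' : ℂ) lam'}
    (Φ' : IsCompletion φ') (hlam : lam ≠ 0) (hlam' : lam' ≠ 0) : Nonempty (V ≃ₗ⁅ℂ, TT⁆ V') ↔
      (n' = n ∧ lam' = lam) ∨ (n' = -n ∧ lam' = -lam) := by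
  have := Φ.isIrreducible hlam
  have := Φ'.isIrreducible hlam'
  obtain ⟨ε, hε, hn⟩ : ∃ ε : ℤ, ε * ε = 1 ∧ ε * n.natAbs = n := by
    rcases Int.natAbs_eq n with h | h
    · exact ⟨1, by norm_num, by rw [one_mul]; exact h.symm⟩
    · exact ⟨-1, by norm_num, by rw [neg_one_mul]; exact h.symm⟩
  obtain ⟨u, hu, H⟩ := Φ.exists_isMinimalVector hlam hε hn
  constructor
  · rintro ⟨ψ⟩
    have h0 : ψ.toLieModuleHom u ≠ 0 := fun h => hu (ψ.toLinearEquiv.map_eq_zero_iff.1 h)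
    have h1 := opC_map ψ.toLieModuleHom u
    rw [Φ.opC_eq, map_smul, Φ'.opC_eq] at h1
    have h2 := opD_map ψ.toLieModuleHom u
    rw [Φ.opD_eq, map_smul, Φ'.opD_eq] at h2
    have h1 := smul_left_injective ℂ h0 h1
    have h2 := smul_left_injective ℂ h0 h2
    rcases sq_eq_sq_iff_eq_or_eq_neg.1 h1 with h | h
    · left
      subst h
      exact ⟨by exact_mod_cast (mul_right_cancel₀ hlam h2).symm, rfl⟩
    · right
      subst h
      refine ⟨?_, (neg_neg _).symm⟩
      have : (n' : ℂ) = -n := mul_right_cancel₀ hlam' (by linear_combination -h2)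
      exact_mod_cast this
  · rintro (⟨rfl, rfl⟩ | ⟨rfl, rfl⟩)
    · obtain ⟨u', hu', H'⟩ := Φ'.exists_isMinimalVector hlam hε hn
      exact H.nonempty_equiv H' hu hu'
    · obtain ⟨u', hu', H'⟩ := Φ'.exists_isMinimalVector hlam' (ε := -ε) (by linarith)
        (by rw [Int.natAbs_neg]; linarith)
      rw [Int.natAbs_neg, Int.cast_neg, neg_mul_neg] at H'
      exact H.nonempty_equiv H' hu hu'

end IsCompletion

end Completion

/-! ### The inflated modules L(n). -/

section InflatedSimple

/-- Restriction undoes inflation. -/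
def resInfl (W : Type*) [AddCommGroup W] [Module ℂ W] [LieRingModule sl2 W] [LieModule ℂ sl2 W] :
    Res (Infl W) ≃ₗ⁅ℂ, sl2⁆ W :=
  { LinearEquiv.refl ℂ W with
    map_lie' := rfl }

variable (n : ℕ)

theorem exists_isLowest_Infl : ∃ u : Infl (SimpleL (n : ℂ)), IsLowest n (toRes u) := by
  obtain ⟨u, H⟩ := exists_isLowest_SimpleL n
  exact ⟨toInfl u, H.of_map (resInfl (SimpleL (n : ℂ))).toLieModuleHom
    (resInfl (SimpleL (n : ℂ))).toLinearEquiv.injective⟩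

theorem isIrreducible_Infl_SimpleL : LieModule.IsIrreducible ℂ TT (Infl (SimpleL (n : ℂ))) := by
  have := isIrreducible_SimpleL (n := (n : ℂ))
  exact isIrreducible_Infl

theorem isHarishChandra_Infl_SimpleL : IsHarishChandra (Infl (SimpleL (n : ℂ))) := by
  obtain ⟨u, H⟩ := exists_isLowest_Infl n
  have := isIrreducible_SimpleL (n := (n : ℂ))
  have := isIrreducible_of_equiv (resInfl (SimpleL (n : ℂ)))
  refine isHarishChandra_of_isLowest (ι := Unit) (l := fun _ => n) (fun _ _ _ => rfl)
    (fun _ => H) fun N hN => ?_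
  rw [eq_top_iff, ← H.span_eq_top]
  exact H.span_le (hN ())

theorem isMinimalType_Infl_SimpleL : IsMinimalType (Infl (SimpleL (n : ℂ))) n := by
  obtain ⟨u, H⟩ := exists_isLowest_Infl n
  have := isIrreducible_SimpleL (n := (n : ℂ))
  have := isIrreducible_of_equiv (resInfl (SimpleL (n : ℂ)))
  refine ⟨hasType_iff.2 ⟨_, H⟩, fun m hm => ?_⟩
  obtain ⟨u', H'⟩ := hasType_iff.1 hm
  exact (H.eq_of_mem_span H' (H.span_eq_top ▸ LieSubmodule.mem_top _)).ge

theorem cbarActsBy_Infl_SimpleL : CbarActsBy (Infl (SimpleL (n : ℂ))) 0 :=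
  cbarActsBy_iff.2 fun x => by rw [opC_Infl, zero_smul]

theorem exists_isMinimalVector_Infl : ∃ u : Infl (SimpleL (n : ℂ)), u ≠ 0 ∧
    IsMinimalVector n 0 u := by
  obtain ⟨u, H⟩ := exists_isLowest_SimpleL n
  exact ⟨toInfl u, H.ne_zero, H.isMinimalVector⟩

end InflatedSimple

/-! ### Invariance of types and scalars under isomorphism. -/

section Transfer

variable {V : Type*} [AddCommGroup V] [Module ℂ V] [LieRingModule TT V] [LieModule ℂ TT V]
  {V' : Type*} [AddCommGroup V'] [Module ℂ V'] [LieRingModule TT V'] [LieModule ℂ TT V']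

theorem HasType.of_equiv (φ : V ≃ₗ⁅ℂ, TT⁆ V') {m : ℕ} (h : HasType V m) : HasType V' m := by
  obtain ⟨u, H⟩ := hasType_iff.1 h
  exact hasType_iff.2 ⟨_, H.map (resHom φ.toLieModuleHom) fun h =>
    H.ne_zero (φ.toLinearEquiv.map_eq_zero_iff.1 h)⟩

omit [LieModule ℂ TT V] in
theorem IsMinimalType.unique {m n : ℕ} (hm : IsMinimalType V m) (hn : IsMinimalType V n) : m = n :=
  le_antisymm (hm.2 n hn.1) (hn.2 m hm.1)

theorem CbarActsBy.unique [Nontrivial V] {χ χ' : ℂ} (h : CbarActsBy V χ) (h' : CbarActsBy V χ') :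
    χ = χ' := by
  obtain ⟨x, hx⟩ := exists_ne (0 : V)
  exact smul_left_injective ℂ hx ((h x).symm.trans (h' x))

theorem CbarActsBy.of_equiv (φ : V ≃ₗ⁅ℂ, TT⁆ V') {χ : ℂ} (h : CbarActsBy V χ) :
    CbarActsBy V' χ := by
  intro y
  obtain ⟨x, rfl⟩ := φ.toLinearEquiv.surjective y
  have h1 := envAction_map φ.toLieModuleHom Cbar x
  rw [h x, map_smul] at h1
  exact h1.symm

theorem nonempty_Infl_SimpleL_equiv_iff (n m : ℕ) :
    Nonempty (Infl (SimpleL (n : ℂ)) ≃ₗ⁅ℂ, TT⁆ Infl (SimpleL (m : ℂ))) ↔ n = m := by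
  constructor
  · rintro ⟨φ⟩
    have hn := isMinimalType_Infl_SimpleL n
    have hm := isMinimalType_Infl_SimpleL m
    exact le_antisymm (hn.2 m (hm.1.of_equiv φ.symm)) (hm.2 n (hn.1.of_equiv φ))
  · rintro rfl
    exact ⟨LieModuleEquiv.refl⟩

end Transfer

/-! ### A minimal vector in every simple Harish-Chandra module. -/

section Classification

variable {V : Type*} [AddCommGroup V] [Module ℂ V] [LieRingModule TT V] [LieModule ℂ TT V]

namespace IsHarishChandra

theorem mem_locallyFinite (hV : IsHarishChandra V) (x : Res V) :
    x ∈ locallyFinite sl2e (Res V) := by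
  obtain ⟨D, hD, -, htop, -⟩ := hV
  have h : sSup D ≤ locallyFinite sl2e (Res V) := sSup_le fun W hW y hy => by
    have := (hD W hW).2
    exact finiteDimensional_orbitSpan_of_le W.toSubmodule hy fun w hw => W.lie_mem hw
  exact h (htop ▸ LieSubmodule.mem_top x)

/-- Since e acts locally finitely, it is nilpotent on weight vectors, so every lowest weight vector
generates a finite-dimensional simple sl₂-module. -/
theorem exists_isLowest (hV : IsHarishChandra V) {x : V} {μ : ℂ} (hh : ⁅Th, x⁆ = μ • x)
    (hf : ⁅Tf, x⁆ = 0) (h0 : x ≠ 0) : ∃ l : ℕ, μ = -l ∧ IsLowest l (toRes x) := by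
  have : FiniteDimensional ℂ (orbitSpan sl2e (toRes x)) := hV.mem_locallyFinite (toRes x)
  have S := isSl2Rep_sl2 (Res V)
  obtain ⟨N, hN⟩ := S.exists_e_pow_eq_zero (x := toRes x) hh (orbitSpan sl2e (toRes x))
    fun j => Submodule.subset_span (Set.mem_range_self j)
  obtain ⟨l, hl, h1, -⟩ := S.exists_nat (x := toRes x) hh hf h0 hN
  subst hl
  exact ⟨l, rfl, ⟨h0, hf, hh, h1⟩⟩

theorem exists_hasType [Nontrivial V] (hV : IsHarishChandra V) : ∃ m, HasType V m := by
  obtain ⟨D, hD, -, htop, -⟩ := hV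
  obtain ⟨W, hW⟩ : D.Nonempty := by
    by_contra! h
    rw [h, sSup_empty] at htop
    obtain ⟨x, hx⟩ := exists_ne (0 : V)
    have : toRes x ∈ (⊥ : LieSubmodule ℂ sl2 (Res V)) := htop ▸ LieSubmodule.mem_top _
    rw [LieSubmodule.mem_bot] at this
    exact hx this
  have := (hD W hW).1
  have := (hD W hW).2
  obtain ⟨m, h⟩ := exists_equiv_SimpleL (W := W)
  exact ⟨m, W, h⟩

theorem exists_isMinimalType [Nontrivial V] (hV : IsHarishChandra V) : ∃ m, IsMinimalType V m := by
  classical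
  exact ⟨Nat.find hV.exists_hasType, Nat.find_spec hV.exists_hasType,
    fun m hm => Nat.find_min' _ hm⟩

end IsHarishChandra

variable (V) in
/-- The space of lowest weight vectors of weight `-m`. -/
noncomputable def lowestSpace (m : ℕ) : Submodule ℂ V :=
  LinearMap.ker (LieModule.toEnd ℂ TT V Tf) ⊓
    Module.End.eigenspace (LieModule.toEnd ℂ TT V Th) (-m : ℂ)

theorem mem_lowestSpace {m : ℕ} {x : V} :
    x ∈ lowestSpace V m ↔ ⁅Tf, x⁆ = 0 ∧ ⁅Th, x⁆ = (-m : ℂ) • x :=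
  and_congr Iff.rfl Module.End.mem_eigenspace_iff

theorem IsHarishChandra.finiteDimensional_lowestSpace (hV : IsHarishChandra V) (m : ℕ) :
    FiniteDimensional ℂ (lowestSpace V m) := by
  have hV' := hV
  obtain ⟨D, hD, hind, htop, hfin⟩ := hV
  -- The summands of type L(m). They are isomorphic to one another, so the finite multiplicity of
  -- any one of them makes this set finite.
  set D' : Set (LieSubmodule ℂ sl2 (Res V)) := {W ∈ D | ∃ u : W, IsLowest m u} with hD'
  have hD'fin : D'.Finite := by
    rcases D'.eq_empty_or_nonempty with h | ⟨W, hW, u, H⟩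
    · rw [h]; exact Set.finite_empty
    · refine (hfin W hW).subset ?_
      rintro W' ⟨hW', u', H'⟩
      have := (hD W hW).1
      have := (hD W' hW').1
      exact ⟨hW', H'.nonempty_equiv H⟩
  have hind' : iSupIndep fun W : D => (W : LieSubmodule ℂ sl2 (Res V)).toSubmodule :=
    LieSubmodule.iSupIndep_toSubmodule.2 ((sSupIndep_iff D).1 hind)
  have htop' : (⨆ W : D, (W : LieSubmodule ℂ sl2 (Res V)).toSubmodule) = ⊤ := by
    rw [← LieSubmodule.iSup_toSubmodule, ← sSup_eq_iSup', htop, LieSubmodule.top_toSubmodule]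
  have hzero : ∀ (s : Finset D) (y : D → Res V), (∀ W, y W ∈ W.1) →
      ∑ W ∈ s, y W = 0 → ∀ W ∈ s, y W = 0 := fun s y hy hs W hW =>
    (iSupIndep_iff_finsetSum_eq_zero_imp_eq_zero _).1 hind' s y (fun W _ => hy W) hs W hW
  have hle : lowestSpace V m ≤ (⨆ W : D', (W : LieSubmodule ℂ sl2 (Res V)).toSubmodule).comap
      (toRes : V ≃ₗ[ℂ] Res V).toLinearMap := by
    intro x hx
    obtain ⟨hf, hh⟩ := mem_lowestSpace.1 hx
    obtain ⟨y, hy, hyx⟩ := (Submodule.mem_iSup_iff_exists_finsupp _ (toRes x)).1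
      (htop' ▸ Submodule.mem_top)
    have hy : ∀ W : D, y W ∈ W.1 := hy
    change toRes x ∈ _
    -- As the sum is direct, each component of a lowest weight vector satisfies the same two
    -- equations; its summand then belongs to `D'`.
    have hf' : ∀ W ∈ y.support, ⁅sl2f, y W⁆ = 0 := by
      refine hzero y.support (fun W => ⁅sl2f, y W⁆) (fun W => W.1.lie_mem (hy W)) ?_
      rw [← lie_sum]
      exact (congrArg (fun z => ⁅sl2f, z⁆) hyx).trans hf
    have hh' : ∀ W ∈ y.support, ⁅sl2h, y W⁆ - (-m : ℂ) • y W = 0 := by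
      refine hzero y.support (fun W => ⁅sl2h, y W⁆ - (-m : ℂ) • y W)
        (fun W => sub_mem (W.1.lie_mem (hy W)) (W.1.smul_mem _ (hy W))) ?_
      rw [Finset.sum_sub_distrib, ← lie_sum, ← Finset.smul_sum, sub_eq_zero]
      exact (congrArg (fun z => ⁅sl2h, z⁆) hyx).trans
        (hh.trans (congrArg (fun z => (-m : ℂ) • z) hyx.symm))
    rw [← hyx]
    refine sum_mem fun W hW => ?_
    refine Submodule.mem_iSup_of_mem (p := fun W : D' => (W : LieSubmodule ℂ sl2 (Res V)).toSubmodule)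
      ⟨W.1, ?_⟩ (hy W)
    refine ⟨W.2, ⟨y W, hy W⟩, IsLowest.of_map W.1.incl Subtype.val_injective ?_⟩
    obtain ⟨l, hl, H⟩ := hV'.exists_isLowest (x := toRes.symm (y W)) (sub_eq_zero.1 (hh' W hW))
      (hf' W hW) (Finsupp.mem_support_iff.1 hW)
    have : m = l := by exact_mod_cast neg_injective hl
    exact this ▸ H
  have := hD'fin.to_subtype
  have : ∀ W : D', FiniteDimensional ℂ (W : LieSubmodule ℂ sl2 (Res V)).toSubmodule :=
    fun W => (hD W W.2.1).2
  have hfd := Submodule.finiteDimensional_iSup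
    fun W : D' => (W : LieSubmodule ℂ sl2 (Res V)).toSubmodule
  have : FiniteDimensional ℂ ((⨆ W : D', (W : LieSubmodule ℂ sl2 (Res V)).toSubmodule).comap
      (toRes : V ≃ₗ[ℂ] Res V).toLinearMap) := hfd
  exact Submodule.finiteDimensional_of_le hle

/-- A central operator acts on a simple Harish-Chandra module by a scalar. -/
theorem IsHarishChandra.exists_eq_smul [LieModule.IsIrreducible ℂ TT V] (hV : IsHarishChandra V)
    {T : Module.End ℂ V} (hT : ∀ (z : TT) (x : V), T ⁅z, x⁆ = ⁅z, T x⁆) :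
    ∃ c : ℂ, ∀ x, T x = c • x := by
  have : Nontrivial V := (LieSubmodule.nontrivial_iff ℂ TT V).1 inferInstance
  obtain ⟨m, hm⟩ := hV.exists_hasType
  obtain ⟨u, H⟩ := hasType_iff.1 hm
  have := hV.finiteDimensional_lowestSpace m
  have hu : toRes.symm u ∈ lowestSpace V m := mem_lowestSpace.2 ⟨H.lie_f, H.lie_h⟩
  have : Nontrivial (lowestSpace V m) := ⟨⟨⟨_, hu⟩, 0, fun h => H.ne_zero (congrArg Subtype.val h)⟩⟩
  have hmap : ∀ x ∈ lowestSpace V m, T x ∈ lowestSpace V m := fun x hx => by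
    rw [mem_lowestSpace] at hx ⊢
    rw [← hT, ← hT, hx.1, hx.2, map_zero, map_smul]
    exact ⟨rfl, rfl⟩
  obtain ⟨c, hc⟩ := Module.End.exists_eigenvalue (T.restrict hmap)
  obtain ⟨x, hx⟩ := hc.exists_hasEigenvector
  refine ⟨c, eq_smul_of_isIrreducible hT (x := x.1) (fun h => hx.2 (Subtype.ext h)) ?_⟩
  exact congrArg Subtype.val (Module.End.mem_eigenspace_iff.1 hx.1)

/-- The D-relations at u and f̄ u, together with the formula for ē u, overdetermine C̄ u. Their
compatibility forces the scalar to be a square. -/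
theorem opC_eq_sq_of_lie_eb {m : ℕ} {lam χ : ℂ} {u : V} (hm : m ≠ 0) (hu : u ≠ 0)
    (hf : ⁅Tf, u⁆ = 0) (hh : ⁅Th, u⁆ = (-m : ℂ) • u) (hC : opC V u = χ • u)
    (hD : ∀ x, opD V x = (m * lam) • x)
    (heb : ((m + 1) * (m + 2) : ℂ) • ⁅Teb, u⁆ + ⁅Te, ⁅Te, ⁅Tfb, u⁆⁆⁆ =
      ((m + 1) * lam) • ⁅Te, u⁆) : χ = lam ^ 2 := by
  have hf1 : ⁅Tf, ⁅Tfb, u⁆⁆ = 0 := by rw [lie_ffb, hf, lie_zero]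
  have hh1 : ⁅Th, ⁅Tfb, u⁆⁆ = (-m - 2 : ℂ) • ⁅Tfb, u⁆ := by
    rw [lie_hfb, hh, lie_smul]; module
  have e1 := smul_lie_hb_of_opD hf hh (hD u)
  have e2 := congrArg (fun x => ⁅Te, x⁆) (smul_lie_hb_of_opD hf1 hh1 (hD ⁅Tfb, u⁆))
  have e3 := congrArg (fun x => ⁅Tfb, x⁆) heb
  have e4 := congrArg (fun x => ⁅Thb, x⁆) e1
  simp only [lie_add, lie_sub, lie_smul, lie_fbe, lie_hbe, lie_ebfb] at e2 e3 e4
  rw [opC_apply] at hC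
  -- Combining f̄ applied to `heb`, h̄ applied to the D-relation at u and e applied to the one at f̄
  -- u cancels every vector except u. For m = 0 the factor vanishes and nothing is learnt.
  have h : ((m * (m + 2) : ℂ) * (χ - lam ^ 2)) • u = 0 := by
    linear_combination (norm := module) (-(m * (m + 2) : ℂ)) • hC + (m : ℂ) • e4 + (4 : ℂ) • e3 +
      (2 : ℂ) • e2 - (lam * (m + 2)) • e1
  have h2 : ((m : ℂ) + 2) ≠ 0 := by exact_mod_cast (by omega : m + 2 ≠ 0)
  exact sub_eq_zero.1 ((mul_eq_zero.1 ((smul_eq_zero.1 h).resolve_right hu)).resolve_left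
    (mul_ne_zero (Nat.cast_ne_zero.2 hm) h2))

theorem IsHarishChandra.exists_isMinimalVector [LieModule.IsIrreducible ℂ TT V]
    (hV : IsHarishChandra V) {m : ℕ} (hm : IsMinimalType V m) {χ : ℂ} (hχ : ∀ x, opC V x = χ • x) :
    ∃ (lam : ℂ) (u : V), lam ^ 2 = χ ∧ u ≠ 0 ∧ IsMinimalVector m lam u := by
  obtain ⟨u, H⟩ := hasType_iff.1 hm.1
  obtain ⟨u, rfl⟩ := toRes.surjective u
  obtain ⟨h0, hf, hh, he⟩ := isLowest_toRes_iff.1 H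
  obtain ⟨δ, hδ⟩ := hV.exists_eq_smul opD_lie
  -- This combination is the L(m - 2)-component of ḡ ⊗ L(m) evaluated at u: it is killed by f and
  -- has weight 2 - m. If nonzero, it would give a type smaller than the minimal one.
  have hr : (m * (m + 1) : ℂ) • ⁅Teb, u⁆ + (m + 1 : ℂ) • ⁅Te, ⁅Thb, u⁆⁆ - ⁅Te, ⁅Te, ⁅Tfb, u⁆⁆⁆ =
      0 := by
    by_contra hne
    obtain ⟨l, hl, Hl⟩ := hV.exists_isLowest (μ := 2 - m) (by
      simp only [lie_add, lie_sub, lie_smul, lie_he, lie_heb, lie_hhb, lie_hfb, hh]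
      module) (by
      simp only [lie_add, lie_sub, lie_smul, lie_fe, lie_feb, lie_fhb, lie_ffb, lie_he, lie_hhb,
        lie_hfb, hf, hh, lie_zero]
      module) hne
    have h1 := hm.2 l (hasType_iff.2 ⟨_, Hl⟩)
    have h2 : (m : ℂ) = ((l + 2 : ℕ) : ℂ) := by push_cast; linear_combination -hl
    have h3 : m = l + 2 := by exact_mod_cast h2
    omega
  have e1 := smul_lie_hb_of_opD hf hh (hδ u)
  rcases Nat.eq_zero_or_pos m with rfl | hpos
  -- For the trivial type, e u = 0 yields h̄ u = e f̄ u and so D = 0. Nothing ties λ to D, and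
  -- either square root of `χ` serves.
  · obtain ⟨lam, hlam⟩ := IsAlgClosed.exists_pow_nat_eq χ (n := 2) two_pos
    have he : ⁅Te, u⁆ = 0 := he
    have h1 : ⁅Thb, u⁆ = ⁅Te, ⁅Tfb, u⁆⁆ := by
      have := lie_fbe u
      rw [he, lie_zero] at this
      exact (sub_eq_zero.1 this.symm).symm
    have h2 : ⁅Te, ⁅Thb, u⁆⁆ + (2 : ℂ) • ⁅Teb, u⁆ = 0 := by rw [← lie_hbe, he, lie_zero]
    have h3 : δ = 0 := by
      refine (smul_eq_zero.1 ?_).resolve_right h0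
      push_cast at e1
      rw [h1] at e1
      linear_combination (norm := module) e1
    refine ⟨lam, u, hlam, h0, hf, hh, fun x => by rw [hχ, hlam], fun x => ?_, ?_⟩
    · rw [hδ, h3]; simp
    · rw [← h1, he]
      linear_combination (norm := (push_cast; module)) h2
  · have hm0 : (m : ℂ) ≠ 0 := Nat.cast_ne_zero.2 hpos.ne'
    -- For m > 0 the eigenvalue of D defines λ = δ / m. Eliminating e h̄ u between `hr` and the
    -- D-relation, and dividing by m, gives the required formula for ē u.
    obtain ⟨lam, rfl⟩ : ∃ lam, δ = m * lam := ⟨δ / m, by field_simp⟩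
    have e2 := congrArg (fun x => ⁅Te, x⁆) e1
    simp only [lie_sub, lie_smul] at e2
    have heb : ((m + 1) * (m + 2) : ℂ) • ⁅Teb, u⁆ + ⁅Te, ⁅Te, ⁅Tfb, u⁆⁆⁆ =
        ((m + 1) * lam) • ⁅Te, u⁆ := by
      refine smul_right_injective V hm0 ?_
      simp only
      linear_combination (norm := module) (m + 2 : ℂ) • hr - (m + 1 : ℂ) • e2
    have hsq := opC_eq_sq_of_lie_eb hpos.ne' h0 hf hh (hχ u) hδ heb
    exact ⟨lam, u, hsq.symm, h0, hf, hh, fun x => by rw [hχ, hsq], hδ, heb⟩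

end Classification

end TakiffHC

/-! ### The classification theorem. -/

open TakiffHC in
theorem theorem4p16 :
    -- every simple Harish-Chandra module is in the list
    (∀ (V : Type u) [AddCommGroup V] [Module ℂ V] [LieRingModule TakiffHC.TT V]
        [LieModule ℂ TakiffHC.TT V],
      LieModule.IsIrreducible ℂ TakiffHC.TT V → TakiffHC.IsHarishChandra V →
        (∃! chi : ℂ, TakiffHC.CbarActsBy V chi) ∧
        (∃! n : ℕ, TakiffHC.IsMinimalType V n) ∧
        ∀ (chi : ℂ) (n : ℕ), TakiffHC.CbarActsBy V chi → TakiffHC.IsMinimalType V n →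
          (chi ≠ 0 → ∃ lam2 : ℂ, lam2 ^ 2 = chi ∧
            Nonempty (V ≃ₗ⁅ℂ, TakiffHC.TT⁆ TakiffHC.VEA n lam2)) ∧
          (chi = 0 → Nonempty (V ≃ₗ⁅ℂ, TakiffHC.TT⁆ TakiffHC.Infl (TakiffHC.SimpleL n)))) ∧
    -- the modules `V(n, lam2)` are simple Harish-Chandra modules
    (∀ (n : ℤ) (lam2 : ℂ), lam2 ≠ 0 →
      LieModule.IsIrreducible ℂ TakiffHC.TT (TakiffHC.VEA n lam2) ∧
      TakiffHC.IsHarishChandra (TakiffHC.VEA n lam2) ∧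
      TakiffHC.CbarActsBy (TakiffHC.VEA n lam2) (lam2 ^ 2) ∧
      TakiffHC.IsMinimalType (TakiffHC.VEA n lam2) n.natAbs) ∧
    -- the `L(n)` are the finite-dimensional simple `sl₂`-modules, up to isomorphism
    (∀ n : ℕ, LieModule.IsIrreducible ℂ TakiffHC.sl2 (TakiffHC.SimpleL n) ∧
      FiniteDimensional ℂ (TakiffHC.SimpleL n)) ∧
    (∀ (W : Type u) [AddCommGroup W] [Module ℂ W] [LieRingModule TakiffHC.sl2 W]
        [LieModule ℂ TakiffHC.sl2 W],
      LieModule.IsIrreducible ℂ TakiffHC.sl2 W → FiniteDimensional ℂ W →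
        ∃ n : ℕ, Nonempty (W ≃ₗ⁅ℂ, TakiffHC.sl2⁆ TakiffHC.SimpleL n)) ∧
    -- with the trivial action of the ideal they are simple Harish-Chandra modules
    (∀ n : ℕ, LieModule.IsIrreducible ℂ TakiffHC.TT (TakiffHC.Infl (TakiffHC.SimpleL n)) ∧
      TakiffHC.IsHarishChandra (TakiffHC.Infl (TakiffHC.SimpleL n)) ∧
      TakiffHC.CbarActsBy (TakiffHC.Infl (TakiffHC.SimpleL n)) 0 ∧
      TakiffHC.IsMinimalType (TakiffHC.Infl (TakiffHC.SimpleL n)) n) ∧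
    -- the isomorphisms between members of the list
    (∀ (n n' : ℤ) (lam2 lam2' : ℂ), lam2 ≠ 0 → lam2' ≠ 0 →
      (Nonempty (TakiffHC.VEA n lam2 ≃ₗ⁅ℂ, TakiffHC.TT⁆ TakiffHC.VEA n' lam2') ↔
        (n' = n ∧ lam2' = lam2) ∨ (n' = -n ∧ lam2' = -lam2))) ∧
    (∀ n m : ℕ, Nonempty (TakiffHC.Infl (TakiffHC.SimpleL n) ≃ₗ⁅ℂ, TakiffHC.TT⁆
        TakiffHC.Infl (TakiffHC.SimpleL m)) ↔ n = m) ∧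
    (∀ (n : ℤ) (lam2 : ℂ) (m : ℕ), lam2 ≠ 0 →
      IsEmpty (TakiffHC.VEA n lam2 ≃ₗ⁅ℂ, TakiffHC.TT⁆
        TakiffHC.Infl (TakiffHC.SimpleL m))) := by
  refine ⟨fun V _ _ _ _ hirr hV => ?_, fun n lam hlam => ?_,
    fun n => ⟨isIrreducible_SimpleL, finiteDimensional_SimpleL n⟩,
    fun W _ _ _ _ hW hfd => exists_equiv_SimpleL,
    fun n => ⟨isIrreducible_Infl_SimpleL n, isHarishChandra_Infl_SimpleL n,
      cbarActsBy_Infl_SimpleL n, isMinimalType_Infl_SimpleL n⟩,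
    fun n n' lam lam' hlam hlam' => ?_, nonempty_Infl_SimpleL_equiv_iff, fun n lam m hlam => ?_⟩
  · have : Nontrivial V := (LieSubmodule.nontrivial_iff ℂ TT V).1 inferInstance
    obtain ⟨χ, hχ⟩ := hV.exists_eq_smul (opC_lie (M := V))
    obtain ⟨m, hm⟩ := hV.exists_isMinimalType
    have hχ' : CbarActsBy V χ := cbarActsBy_iff.2 hχ
    refine ⟨⟨χ, hχ', fun _ h => CbarActsBy.unique h hχ'⟩, ⟨m, hm, fun _ h => h.unique hm⟩,
      fun χ n hχ hn => ?_⟩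
    obtain ⟨lam, u, hlam, hu, H⟩ := hV.exists_isMinimalVector hn (cbarActsBy_iff.1 hχ)
    constructor
    · intro h0
      have hlam0 : lam ≠ 0 := fun h => h0 (by rw [← hlam, h]; norm_num)
      have Φ := IsCompletion.of_equiv (eaEquiv ((n : ℤ) : ℂ) lam)
      have := Φ.isIrreducible hlam0
      -- As n ≥ 0, the sign is ε = 1, and V(n, λ) has a minimal vector for the same (n, λ) as `V`.
      obtain ⟨u', hu', H'⟩ := Φ.exists_isMinimalVector hlam0 (ε := 1) (by norm_num) (by simp)
      rw [Int.natAbs_natCast, Int.cast_one, one_mul] at H'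
      exact ⟨lam, hlam, H.nonempty_equiv H' hu hu'⟩
    · rintro rfl
      obtain rfl := pow_eq_zero_iff (two_ne_zero) |>.1 hlam
      have := isIrreducible_Infl_SimpleL n
      obtain ⟨u', hu', H'⟩ := exists_isMinimalVector_Infl n
      exact H.nonempty_equiv H' hu hu'
  · have Φ := IsCompletion.of_equiv (eaEquiv (n : ℂ) lam)
    exact ⟨Φ.isIrreducible hlam, Φ.isHarishChandra hlam, cbarActsBy_iff.2 Φ.opC_eq,
      Φ.isMinimalType hlam⟩
  · exact (IsCompletion.of_equiv (eaEquiv (n : ℂ) lam)).nonempty_equiv_iff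
      (IsCompletion.of_equiv (eaEquiv (n' : ℂ) lam')) hlam hlam'
  · refine ⟨fun φ => hlam ?_⟩
    have Φ := IsCompletion.of_equiv (eaEquiv (n : ℂ) lam)
    have := isIrreducible_Infl_SimpleL m
    have : Nontrivial (Infl (SimpleL (m : ℂ))) :=
      (LieSubmodule.nontrivial_iff ℂ TT (Infl (SimpleL (m : ℂ)))).1 inferInstance
    -- C̄ would act both by λ² and by 0.
    have h := (CbarActsBy.of_equiv φ (cbarActsBy_iff.2 Φ.opC_eq)).unique
      (cbarActsBy_Infl_SimpleL m)
    exact pow_eq_zero_iff two_ne_zero |>.1 h
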